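/- **Setting.** A dual-hop cognitive radio network has sources $S_1,\dots,S_N$, a relay $R$ with $L_R\ge1$ antennas, a destination $D$ with $L_D\ge1$ antennas, eavesdroppers $E_1,\dots,E_M$ with $L_{E_k}\ge1$ antennas, and a primary receiver $P$. The fading amplitudes $h_q$ of all individual links ($S_i\to R_u$, $S_i\to P$, $S_i\to E_k^{(u)}$, $R\to D_t$, $R\to P$, $R\to E_k^{(u)}$) are mutually independent; $h_q$ is Nakagami distributed with integer severity $m_q\ge1$ and mean power $\Omega_q>0$, where $m_q,\Omega_q$ do not depend on the antenna. Put $g_q=|h_q|^2$ and $\lambda_q=m_q/\Omega_q$. Let $P_{S_i}^{max},P_R^{max},P_I,N_0>0$, $R_s>0$, $\overline\gamma_{S_i}=P_{S_i}^{max}/N_0$, $\overline\gamma_R=P_R^{max}/N_0$, $\overline\gamma_I=P_I/N_0$. The transmit powers are $P_{S_i}=\min(P^{max}_{S_i},P_I/g_{S_iP})$ and $P_R=\min(P_R^{max},P_I/g_{RP})$, and the receivers perform MRC, so that the SNRs are $$\gamma_R^{(i)}=\tfrac{P_{S_i}}{N_0}\sum_{u=1}^{L_R}g_{S_iR_u},\quad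 \gamma_{1E}^{(i,k)}=\tfrac{P_{S_i}}{N_0}\sum_{u=1}^{L_{E_k}}g_{S_iE_k^{(u)}},\quad \gamma_{1E}^{(i,k,J)}=\frac{\gamma_{1E}^{(i,k)}}{\gamma_{1E}^{(J,k)}+1},\quad \gamma_D=\tfrac{P_R}{N_0}\sum_{t=1}^{L_D}g_{RD_t},\quad \gamma_{2E}^{(k)}=\tfrac{P_R}{N_0}\sum_{u=1}^{L_{E_k}}g_{RE_k^{(u)}},$$ where $S_J$, $J\ne i$, is the friendly jammer. Let $C(x,y)=\log_2\frac{1+x}{1+y}$ if $x>y$ and $C(x,y)=0$ otherwise, $C_{1S}^{(i,k,J)}=C(\gamma_R^{(i)},\gamma_{1E}^{(i,k,J)})$, $C_{1S}^{(i,k)}=C(\gamma_R^{(i)},\gamma_{1E}^{(i,k)})$, $C_{2S}^{(k)}=C(\gamma_D,\gamma_{2E}^{(k)})$, and let $$SOP_1^{(i,k,J)}=\Pr(C_{1S}^{(i,k,J)}<R_s),\quad SOP_1^{(i,k)}=\Pr(C_{1S}^{(i,k)}<R_s),\quad SOP_2^{(k)}=\Pr(C_{2S}^{(k)}<R_s).$$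 The overall SOPs are defined by $SOP^{(i,J)}=1-\prod_{k=1}^M\Pr(\min(C_{1S}^{(i,k,J)},C_{2S}^{(k)})\ge R_s)$, $SOP^{(i)}=1-\prod_{k=1}^M\Pr(\min(C_{1S}^{(i,k)},C_{2S}^{(k)})\ge R_s)$, and for the whole system by $\frac1{N(N-1)}\sum_i\sum_{J\ne i}SOP^{(i,J)}$ with a jammer and $\frac1N\sum_iSOP^{(i)}$ without. **Special functions.** $\gamma(a,x)=\int_0^xt^{a-1}e^{-t}dt$; $\Gamma(a,x)=\int_x^\infty t^{a-1}e^{-t}dt$ for $x>0$ and $\Gamma(a,0)=\Gamma(a)$. The upper incomplete Meijer G-function is $$G^{m,n}_{p,q}\left(z\left|\begin{array}{c}(a_1,\alpha_1),\dots,(a_n,\alpha_n);(a_{n+1},\alpha_{n+1}),\dots,(a_p,\alpha_p)\\(b_1,\beta_1),\dots,(b_m,\beta_m);(b_{m+1},\beta_{m+1}),\dots,(b_q,\beta_q)\end{array}\right.\right)=\frac1{2\pi\mathrm i}\int_{c-\mathrm i\infty}^{c+\mathrm i\infty}\frac{\prod_{j\le m}\Gamma(b_j+s,\beta_j)\prod_{j\le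 n}\Gamma(1-a_j-s,\alpha_j)}{\prod_{j>n}\Gamma(a_j+s,\alpha_j)\prod_{j>m}\Gamma(1-b_j-s,\beta_j)}z^{-s}ds,$$ where the line $\mathrm{Re}\,s=c$ has the poles of the factors $\Gamma(b_j+s,\beta_j)$ on its left and those of the factors $\Gamma(1-a_j-s,\alpha_j)$ on its right. The ordinary Meijer G-function, written without second arguments, is the case where all $\alpha_j,\beta_j$ are $0$. **Notation.** $\gamma=2^{R_s}$, $\varpi_i^{(k)}=\gamma\lambda_{S_iR}+\lambda_{S_iE_k}$, $\sigma_i=\overline\gamma_I/\overline\gamma_{S_i}$, $\delta=\overline\gamma_I/\overline\gamma_R$, $\theta_i^{(k,J)}=\lambda_{S_JE_k}/(\overline\gamma_{S_J}\lambda_{S_iE_k})$, $\varsigma_i^{(k,J)}=\lambda_{S_JE_k}/(\lambda_{S_JP}\lambda_{S_iE_k})$, $\varphi_{S_i}=\lambda_{S_iP}\overline\gamma_I/\overline\gamma_{S_i}$, $\varphi_J=\lambda_{S_JP}\overline\gamma_I/\overline\gamma_{S_J}$, $\varphi_R=\lambda_{RP}\overline\gamma_I/\overline\gamma_R$, $\xi_{S_iR}=\lambda_{S_iR}(\gamma-1)$,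 $\xi_{RD}=\lambda_{RD}(\gamma-1)$, $\mu_{i,k}^{(h,l)}=L_{E_k}m_{S_iE_k}-h+l$, $$\Omega_h^{(i,k)}=\binom{L_{E_k}m_{S_iE_k}-1}{h}\lambda_{S_iE_k}^{L_{E_k}m_{S_iE_k}-h-1},\quad \Upsilon_l^{(i)}=\binom{L_Rm_{S_iR}-1}{l}\gamma^l(\gamma-1)^{L_Rm_{S_iR}-1-l},\quad \mathcal B_j=\binom{L_Dm_{RD}-1}{j}(\gamma-1)^{L_Dm_{RD}-1-j},$$ $$\beta_k^{(J)}=\frac1{\Gamma(L_{E_k}m_{S_JE_k})\Gamma(m_{S_JP})},\qquad \alpha_i^{(k,J)}=\frac{\beta_k^{(J)}\lambda_{S_iR}^{L_Rm_{S_iR}}}{\Gamma(L_{E_k}m_{S_iE_k})\Gamma(L_Rm_{S_iR})},$$ $$\mathcal M_1^{(h,l)}(z)=G^{2,2}_{2,3}\left(z\left|\begin{array}{c}-h,1;-\\\mu_{i,k}^{(h,l)},L_{E_k}m_{S_JE_k};0\end{array}\right.\right),\quad \mathcal M_3(z)=G^{2,1}_{2,2}\left(z\left|\begin{array}{c}(1-m_{S_iP},\varphi_{S_i});(1,0)\\(0,0),(L_Rm_{S_iR},0);-\end{array}\right.\right),$$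 $$\mathcal M_2^{(h,l)}(z)=G^{2,3}_{3,3}\left(z\left|\begin{array}{c}(1-m_{S_JP},\varphi_J),(1,0),(-h,0);-\\(L_{E_k}m_{S_JE_k},0),(\mu_{i,k}^{(h,l)},0);(0,0)\end{array}\right.\right),$$ $$\mathcal K_l^{(i)}=\frac{\gamma(m_{S_iP},\varphi_{S_i})e^{-\sigma_i\xi_{S_iR}/\overline\gamma_I}}{\sigma_i^{-L_Rm_{S_iR}+l+1}}+\frac{\lambda_{S_iP}^{m_{S_iP}}\Gamma\left(m_{S_iP}+L_Rm_{S_iR}-l-1,\varphi_{S_i}+\frac{\sigma_i\xi_{S_iR}}{\overline\gamma_I}\right)}{\left(\lambda_{S_iP}+\frac{\xi_{S_iR}}{\overline\gamma_I}\right)^{m_{S_iP}+L_Rm_{S_iR}-l-1}}.$$ **Theorem 1.** All the Mellin-Barnes integrals below converge absolutely and do not depend on the choice of the separating line, and for all $i$, all $k$ and all $J\neq i$: $$SOP_1^{(i,k,J)}=1-\frac{\gamma(m_{S_iP},\varphi_{S_i})\Gamma\left(L_Rm_{S_iR},\frac{\sigma_i\xi_{S_iR}}{\overline\gamma_I}\right)+\mathcal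 M_3\left(\frac{\xi_{S_iR}}{\lambda_{S_iP}\overline\gamma_I}\right)}{\Gamma(L_Rm_{S_iR})\Gamma(m_{S_iP})}$$ $$\qquad+\frac{\gamma\,\alpha_i^{(k,J)}}{\Gamma(m_{S_iP})}\sum_{h=0}^{L_{E_k}m_{S_iE_k}-1}\Omega_h^{(i,k)}\sum_{l=0}^{L_Rm_{S_iR}-1}\frac{\Upsilon_l^{(i)}\,\overline\gamma_I^{-L_Rm_{S_iR}+l+1}}{(\varpi_i^{(k)})^{L_{E_k}m_{S_iE_k}+l-h}}\,\mathcal K_l^{(i)}\left[\gamma(m_{S_JP},\varphi_J)\,\mathcal M_1^{(h,l)}(\varpi_i^{(k)}\theta_i^{(k,J)})+\mathcal M_2^{(h,l)}\left(\frac{\varsigma_i^{(k,J)}\varpi_i^{(k)}}{\overline\gamma_I}\right)\right],$$ $$SOP_1^{(i,k)}=1-\frac{\lambda_{S_iR}^{L_Rm_{S_iR}}\gamma}{\Gamma(L_{E_k}m_{S_iE_k})\Gamma(L_Rm_{S_iR})\Gamma(m_{S_iP})}\sum_{l=0}^{L_Rm_{S_iR}-1}\frac{\Upsilon_l^{(i)}\,\overline\gamma_I^{-L_Rm_{S_iR}+l+1}}{(\gamma\lambda_{S_iR})^{l+1}}G^{1,2}_{2,2}\left(\frac{\lambda_{S_iE_k}}{\lambda_{S_iR}\gamma}\left|\begin{array}{c}-l,1;-\\L_{E_k}m_{S_iE_k};0\end{array}\right.\right)\mathcal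 K_l^{(i)},$$ $$SOP_2^{(k)}=1-\frac{\lambda_{RD}^{L_Dm_{RD}}}{\Gamma(L_{E_k}m_{RE_k})\Gamma(L_Dm_{RD})\Gamma(m_{RP})}\sum_{j=0}^{L_Dm_{RD}-1}\frac{\mathcal B_j\,\overline\gamma_I^{-L_Dm_{RD}+j+1}}{\lambda_{RD}^{j+1}}G^{1,2}_{2,2}\left(\frac{\lambda_{RE_k}}{\lambda_{RD}\gamma}\left|\begin{array}{c}-j,1;-\\L_{E_k}m_{RE_k};0\end{array}\right.\right)$$ $$\qquad\times\left[\frac{e^{-\delta\xi_{RD}/\overline\gamma_I}\gamma(m_{RP},\varphi_R)}{\delta^{-L_Dm_{RD}+j+1}}+\frac{\lambda_{RP}^{m_{RP}}\Gamma\left(L_Dm_{RD}+m_{RP}-j-1,\varphi_R+\frac{\delta\xi_{RD}}{\overline\gamma_I}\right)}{\left(\frac{\xi_{RD}}{\overline\gamma_I}+\lambda_{RP}\right)^{L_Dm_{RD}+m_{RP}-j-1}}\right].$$ Moreover $SOP^{(i,J)}=1-\prod_{k=1}^M[1-SOP_1^{(i,k,J)}][1-SOP_2^{(k)}]$ and $SOP^{(i)}=1-\prod_{k=1}^M[1-SOP_1^{(i,k)}][1-SOP_2^{(k)}]$,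 so that these and the two system SOPs are given in closed form by inserting the three expressions above. -/

import Mathlib

open MeasureTheory ProbabilityTheory

/-! ### Special functions -/

/-- The lower incomplete Gamma function `γ(a, x) = ∫₀ˣ t^(a-1) e^(-t) dt` (for `0 < Re a`, `0 ≤ x`). -/
noncomputable def lowerGamma (a : ℂ) (x : ℝ) : ℂ := Complex.partialGamma a x

/-- The upper incomplete Gamma function `Γ(a, x) = ∫ₓ^∞ t^(a-1) e^(-t) dt` for `x > 0`, and
`Γ(a, 0) = Γ(a)` (with the analytic continuation of the complete Gamma function). -/
noncomputable def upperGamma (a : ℂ) (x : ℝ) : ℂ :=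
  if x = 0 then Complex.Gamma a
  else ∫ t in Set.Ioi x, (Real.exp (-t) : ℂ) * (t : ℂ) ^ (a - 1)

/-- The parameters of an upper incomplete Meijer G-function `G^{m,n}_{p,q}`: in the order
`a₁, …, aₙ ; a_{n+1}, …, a_p` and `b₁, …, b_m ; b_{m+1}, …, b_q`, each with the second argument
of the incomplete Gamma function in which it occurs. -/
structure MeijerParams where
  aNum : List (ℂ × ℝ)
  aDen : List (ℂ × ℝ)
  bNum : List (ℂ × ℝ)
  bDen : List (ℂ × ℝ)

namespace MeijerParams

/-- The parameters of an ordinary Meijer G-function: all second arguments are `0`, so that every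
factor is a complete Gamma function. -/
def ordinary (aNum aDen bNum bDen : List ℂ) : MeijerParams where
  aNum := aNum.map fun a => (a, 0)
  aDen := aDen.map fun a => (a, 0)
  bNum := bNum.map fun b => (b, 0)
  bDen := bDen.map fun b => (b, 0)

/-- The Mellin-Barnes integrand
`∏ Γ(b_j + s, β_j) ∏ Γ(1 - a_j - s, α_j) / (∏ Γ(a_j + s, α_j) ∏ Γ(1 - b_j - s, β_j)) z^(-s)`. -/
noncomputable def kernel (p : MeijerParams) (z s : ℂ) : ℂ :=
  (p.bNum.map fun b => upperGamma (b.1 + s) b.2).prod *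
      (p.aNum.map fun a => upperGamma (1 - a.1 - s) a.2).prod /
    ((p.aDen.map fun a => upperGamma (a.1 + s) a.2).prod *
      (p.bDen.map fun b => upperGamma (1 - b.1 - s) b.2).prod) * z ^ (-s)

/-- The vertical line `Re s = c` separates the poles of the factors `Γ(b_j + s, β_j)` (on its left)
from those of the factors `Γ(1 - a_j - s, α_j)` (on its right). A factor whose second argument
is positive is an entire function of `s` and has no poles. -/
def Separates (p : MeijerParams) (c : ℝ) : Prop :=
  (∀ b ∈ p.bNum, b.2 = 0 → -b.1.re < c) ∧ (∀ a ∈ p.aNum, a.2 = 0 → c < 1 - a.1.re)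

/-- `(1 / (2πi)) ∫_{c - i∞}^{c + i∞} kernel z s ds`. -/
noncomputable def lineIntegral (p : MeijerParams) (z : ℂ) (c : ℝ) : ℂ :=
  (1 / (2 * Real.pi : ℝ) : ℂ) * ∫ t : ℝ, p.kernel z (c + t * Complex.I)

/-- The upper incomplete Meijer G-function, as a Mellin-Barnes integral along a vertical line that
separates the poles. -/
noncomputable def G (p : MeijerParams) (z : ℂ) : ℂ :=
  p.lineIntegral z (Classical.epsilon fun c : ℝ => p.Separates c)

/-- The Mellin-Barnes integral that defines `G` makes sense: there is a separating vertical line,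
and along each of them the integral converges absolutely and has the same value. -/
def WellDefined (p : MeijerParams) (z : ℂ) : Prop :=
  (∃ c : ℝ, p.Separates c) ∧
    ∀ c : ℝ, p.Separates c →
      Integrable (fun t : ℝ => p.kernel z (c + t * Complex.I)) ∧ p.lineIntegral z c = p.G z

end MeijerParams

/-! ### Nakagami fading -/

/-- The Nakagami density with shape `m` and mean power `w`. -/
noncomputable def nakagamiPDF (m w r : ℝ) : ℝ :=
  if 0 ≤ r then
    2 * m ^ m / (Real.Gamma m * w ^ m) * r ^ (2 * m - 1) * Real.exp (-(m / w) * r ^ 2)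
  else 0

/-- The Nakagami distribution with shape `m` and mean power `w`. -/
noncomputable def nakagamiMeasure (m w : ℝ) : Measure ℝ :=
  volume.withDensity fun r => ENNReal.ofReal (nakagamiPDF m w r)

/-! ### The dual-hop cognitive radio network -/

/-- The parameters of the network: `N` sources `S_i`, a relay `R` with `LR` antennas, a destination
`D` with `LD` antennas, `M` eavesdroppers `E_k` with `LE k` antennas, a primary receiver `P`;
integer fading severities `m..`, average channel power gains `w..`, maximal transmit powers,
the maximal tolerated interference power `PI`, the noise power `N0`, the secrecy rate `Rs`. -/
structure RelayNet where
  N : ℕ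
  M : ℕ
  LR : ℕ
  LD : ℕ
  LE : Fin M → ℕ
  mSR : Fin N → ℕ
  mSP : Fin N → ℕ
  mSE : Fin N → Fin M → ℕ
  mRD : ℕ
  mRP : ℕ
  mRE : Fin M → ℕ
  wSR : Fin N → ℝ
  wSP : Fin N → ℝ
  wSE : Fin N → Fin M → ℝ
  wRD : ℝ
  wRP : ℝ
  wRE : Fin M → ℝ
  PSmax : Fin N → ℝ
  PRmax : ℝ
  PI : ℝ
  N0 : ℝ
  Rs : ℝ
  LR_pos : 0 < LR
  LD_pos : 0 < LD
  LE_pos : ∀ k, 0 < LE k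
  mSR_pos : ∀ i, 0 < mSR i
  mSP_pos : ∀ i, 0 < mSP i
  mSE_pos : ∀ i k, 0 < mSE i k
  mRD_pos : 0 < mRD
  mRP_pos : 0 < mRP
  mRE_pos : ∀ k, 0 < mRE k
  wSR_pos : ∀ i, 0 < wSR i
  wSP_pos : ∀ i, 0 < wSP i
  wSE_pos : ∀ i k, 0 < wSE i k
  wRD_pos : 0 < wRD
  wRP_pos : 0 < wRP
  wRE_pos : ∀ k, 0 < wRE k
  PSmax_pos : ∀ i, 0 < PSmax i
  PRmax_pos : 0 < PRmax
  PI_pos : 0 < PI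
  N0_pos : 0 < N0
  Rs_pos : 0 < Rs

namespace RelayNet

/-- The individual antenna-to-antenna links of the network. -/
inductive Link (c : RelayNet) : Type
  | SR (i : Fin c.N) (u : Fin c.LR)
  | SP (i : Fin c.N)
  | SE (i : Fin c.N) (k : Fin c.M) (u : Fin (c.LE k))
  | RD (t : Fin c.LD)
  | RP
  | RE (k : Fin c.M) (u : Fin (c.LE k))

/-- The fading severity `m_q` of a link. -/
def severity (c : RelayNet) : c.Link → ℕ
  | .SR i _ => c.mSR i
  | .SP i => c.mSP i
  | .SE i k _ => c.mSE i k
  | .RD _ => c.mRD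
  | .RP => c.mRP
  | .RE k _ => c.mRE k

/-- The average channel power gain `Ω_q` of a link. -/
def meanGain (c : RelayNet) : c.Link → ℝ
  | .SR i _ => c.wSR i
  | .SP i => c.wSP i
  | .SE i k _ => c.wSE i k
  | .RD _ => c.wRD
  | .RP => c.wRP
  | .RE k _ => c.wRE k

/-- The fading amplitudes `h` of the links are mutually independent, and each of them is Nakagami
distributed with the parameters of its link. -/
structure IsNakagamiFading (c : RelayNet) {Ω : Type*} [MeasurableSpace Ω] (P : Measure Ω)
    (h : c.Link → Ω → ℝ) : Prop where
  measurable : ∀ q, Measurable (h q)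
  law : ∀ q, P.map (h q) = nakagamiMeasure (c.severity q) (c.meanGain q)
  indep : iIndepFun h P

section System

variable (c : RelayNet) {Ω : Type*} (h : c.Link → Ω → ℝ)

/-- The channel gain `g_q = |h_q|²`. -/
def gain (q : c.Link) (ω : Ω) : ℝ := |h q ω| ^ 2

/-- The transmit power `min (P_{S_i}^max, P_I / g_{S_i P})` of the source `S_i`. -/
noncomputable def powerS (i : Fin c.N) (ω : Ω) : ℝ :=
  min (c.PSmax i) (c.PI / c.gain h (.SP i) ω)

/-- The transmit power `min (P_R^max, P_I / g_{RP})` of the relay. -/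
noncomputable def powerR (ω : Ω) : ℝ := min c.PRmax (c.PI / c.gain h .RP ω)

/-- The SNR at the relay after maximal ratio combining. -/
noncomputable def snrR (i : Fin c.N) (ω : Ω) : ℝ :=
  c.powerS h i ω / c.N0 * ∑ u, c.gain h (.SR i u) ω

/-- The SNR at `E_k` in the first hop, without jammer. -/
noncomputable def snrE1 (i : Fin c.N) (k : Fin c.M) (ω : Ω) : ℝ :=
  c.powerS h i ω / c.N0 * ∑ u, c.gain h (.SE i k u) ω

/-- The SNR at `E_k` in the first hop, with the friendly jammer `S_J`. -/
noncomputable def snrE1Jam (i J : Fin c.N) (k : Fin c.M) (ω : Ω) : ℝ :=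
  (c.powerS h i ω / c.N0 * ∑ u, c.gain h (.SE i k u) ω) /
    (c.powerS h J ω / c.N0 * ∑ u, c.gain h (.SE J k u) ω + 1)

/-- The SNR at the destination after maximal ratio combining. -/
noncomputable def snrD (ω : Ω) : ℝ :=
  c.powerR h ω / c.N0 * ∑ t, c.gain h (.RD t) ω

/-- The SNR at `E_k` in the second hop. -/
noncomputable def snrE2 (k : Fin c.M) (ω : Ω) : ℝ :=
  c.powerR h ω / c.N0 * ∑ u, c.gain h (.RE k u) ω

end System

/-- The secrecy capacity of a main link with SNR `x` against a wiretap link with SNR `y`. -/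
noncomputable def secrecyCapacity (x y : ℝ) : ℝ :=
  if y < x then Real.logb 2 ((1 + x) / (1 + y)) else 0

section Outage

variable (c : RelayNet) {Ω : Type*} [MeasurableSpace Ω] (P : Measure Ω) (h : c.Link → Ω → ℝ)

/-- `C_{1S}^{(i,k,J)}`. -/
noncomputable def cap1Jam (i J : Fin c.N) (k : Fin c.M) (ω : Ω) : ℝ :=
  secrecyCapacity (c.snrR h i ω) (c.snrE1Jam h i J k ω)

/-- `C_{1S}^{(i,k)}`. -/
noncomputable def cap1 (i : Fin c.N) (k : Fin c.M) (ω : Ω) : ℝ :=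
  secrecyCapacity (c.snrR h i ω) (c.snrE1 h i k ω)

/-- `C_{2S}^{(k)}`. -/
noncomputable def cap2 (k : Fin c.M) (ω : Ω) : ℝ :=
  secrecyCapacity (c.snrD h ω) (c.snrE2 h k ω)

/-- `SOP_1^{(i,k,J)}`: first hop, with the friendly jammer `S_J`. -/
noncomputable def sop1Jam (i J : Fin c.N) (k : Fin c.M) : ℝ :=
  P.real {ω | c.cap1Jam h i J k ω < c.Rs}

/-- `SOP_1^{(i,k)}`: first hop, without jammer. -/
noncomputable def sop1 (i : Fin c.N) (k : Fin c.M) : ℝ :=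
  P.real {ω | c.cap1 h i k ω < c.Rs}

/-- `SOP_2^{(k)}`: second hop. -/
noncomputable def sop2 (k : Fin c.M) : ℝ :=
  P.real {ω | c.cap2 h k ω < c.Rs}

/-- `SOP^{(i,J)} = 1 - ∏_k Pr(min(C_{1S}^{(i,k,J)}, C_{2S}^{(k)}) ≥ R_s)`. -/
noncomputable def sopJam (i J : Fin c.N) : ℝ :=
  1 - ∏ k, P.real {ω | c.Rs ≤ min (c.cap1Jam h i J k ω) (c.cap2 h k ω)}

/-- `SOP^{(i)} = 1 - ∏_k Pr(min(C_{1S}^{(i,k)}, C_{2S}^{(k)}) ≥ R_s)`. -/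
noncomputable def sopNoJam (i : Fin c.N) : ℝ :=
  1 - ∏ k, P.real {ω | c.Rs ≤ min (c.cap1 h i k ω) (c.cap2 h k ω)}

/-- The SOP of the system with a friendly jammer chosen uniformly among the other sources. -/
noncomputable def sopSystemJam : ℝ :=
  1 / ((c.N : ℝ) * ((c.N : ℝ) - 1)) *
    ∑ i, ∑ J ∈ Finset.univ.filter (fun J => J ≠ i), c.sopJam P h i J

/-- The SOP of the system without jammer. -/
noncomputable def sopSystemNoJam : ℝ :=
  1 / (c.N : ℝ) * ∑ i, c.sopNoJam P h i

end Outage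

/-! ### The quantities in the closed forms -/

section ClosedForms

variable (c : RelayNet)

noncomputable def lamSR (i : Fin c.N) : ℝ := c.mSR i / c.wSR i
noncomputable def lamSP (i : Fin c.N) : ℝ := c.mSP i / c.wSP i
noncomputable def lamSE (i : Fin c.N) (k : Fin c.M) : ℝ := c.mSE i k / c.wSE i k
noncomputable def lamRD : ℝ := c.mRD / c.wRD
noncomputable def lamRP : ℝ := c.mRP / c.wRP
noncomputable def lamRE (k : Fin c.M) : ℝ := c.mRE k / c.wRE k

/-- `L_R m_{S_i R}` -/
def nSR (i : Fin c.N) : ℕ := c.LR * c.mSR i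
/-- `L_{E_k} m_{S_i E_k}` -/
def nSE (i : Fin c.N) (k : Fin c.M) : ℕ := c.LE k * c.mSE i k
/-- `L_D m_{RD}` -/
def nRD : ℕ := c.LD * c.mRD
/-- `L_{E_k} m_{R E_k}` -/
def nRE (k : Fin c.M) : ℕ := c.LE k * c.mRE k

/-- `γ̄_{S_i} = P_{S_i}^max / N_0` -/
noncomputable def gamS (i : Fin c.N) : ℝ := c.PSmax i / c.N0
/-- `γ̄_R = P_R^max / N_0` -/
noncomputable def gamR : ℝ := c.PRmax / c.N0
/-- `γ̄_I = P_I / N_0` -/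
noncomputable def gamI : ℝ := c.PI / c.N0
/-- `γ = 2^{R_s}` -/
noncomputable def gam : ℝ := (2 : ℝ) ^ c.Rs

/-- `ϖ_i^{(k)}` -/
noncomputable def varpi (i : Fin c.N) (k : Fin c.M) : ℝ := c.gam * c.lamSR i + c.lamSE i k
/-- `σ_i` -/
noncomputable def sigma (i : Fin c.N) : ℝ := c.gamI / c.gamS i
/-- `δ` -/
noncomputable def delta : ℝ := c.gamI / c.gamR
/-- `θ_i^{(k,J)}` -/
noncomputable def theta (i J : Fin c.N) (k : Fin c.M) : ℝ :=
  c.lamSE J k / (c.gamS J * c.lamSE i k)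
/-- `ς_i^{(k,J)}` -/
noncomputable def varsigma (i J : Fin c.N) (k : Fin c.M) : ℝ :=
  c.lamSE J k / (c.lamSP J * c.lamSE i k)
/-- `φ_{S_i}`, and `φ_J` for `i = J` -/
noncomputable def phiS (i : Fin c.N) : ℝ := c.lamSP i * c.gamI / c.gamS i
/-- `φ_R` -/
noncomputable def phiR : ℝ := c.lamRP * c.gamI / c.gamR
/-- `ξ_{S_i R}` -/
noncomputable def xiSR (i : Fin c.N) : ℝ := c.lamSR i * (c.gam - 1)
/-- `ξ_{RD}` -/
noncomputable def xiRD : ℝ := c.lamRD * (c.gam - 1)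

/-- `μ_{i,k}^{(h,l)}` -/
def mu (i : Fin c.N) (k : Fin c.M) (h l : ℕ) : ℤ := (c.nSE i k : ℤ) - h + l

/-- `Ω_h^{(i,k)}` -/
noncomputable def omegaCoef (i : Fin c.N) (k : Fin c.M) (h : ℕ) : ℝ :=
  ((c.nSE i k - 1).choose h : ℝ) * c.lamSE i k ^ ((c.nSE i k : ℤ) - h - 1)

/-- `Υ_l^{(i)}` -/
noncomputable def upsilon (i : Fin c.N) (l : ℕ) : ℝ :=
  ((c.nSR i - 1).choose l : ℝ) * c.gam ^ l * (c.gam - 1) ^ ((c.nSR i : ℤ) - 1 - l)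

/-- `B_j` -/
noncomputable def bCoef (j : ℕ) : ℝ :=
  ((c.nRD - 1).choose j : ℝ) * (c.gam - 1) ^ ((c.nRD : ℤ) - 1 - j)

/-- `β_k^{(J)}` -/
noncomputable def betaCoef (J : Fin c.N) (k : Fin c.M) : ℝ :=
  1 / (Real.Gamma (c.nSE J k) * Real.Gamma (c.mSP J))

/-- `α_i^{(k,J)}` -/
noncomputable def alphaCoef (i J : Fin c.N) (k : Fin c.M) : ℝ :=
  c.betaCoef J k * c.lamSR i ^ c.nSR i / (Real.Gamma (c.nSE i k) * Real.Gamma (c.nSR i))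

/-- Parameters of `M_1^{(h,l)}`, a `G^{2,2}_{2,3}`. -/
def paramsM1 (i J : Fin c.N) (k : Fin c.M) (h l : ℕ) : MeijerParams :=
  .ordinary [-(h : ℂ), 1] [] [(c.mu i k h l : ℂ), (c.nSE J k : ℂ)] [0]

/-- Parameters of `M_2^{(h,l)}`, an upper incomplete `G^{2,3}_{3,3}`. -/
noncomputable def paramsM2 (i J : Fin c.N) (k : Fin c.M) (h l : ℕ) : MeijerParams where
  aNum := [(1 - (c.mSP J : ℂ), c.phiS J), (1, 0), (-(h : ℂ), 0)]
  aDen := []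
  bNum := [((c.nSE J k : ℂ), 0), ((c.mu i k h l : ℂ), 0)]
  bDen := [(0, 0)]

/-- Parameters of `M_3`, an upper incomplete `G^{2,1}_{2,2}`. -/
noncomputable def paramsM3 (i : Fin c.N) : MeijerParams where
  aNum := [(1 - (c.mSP i : ℂ), c.phiS i)]
  aDen := [(1, 0)]
  bNum := [(0, 0), ((c.nSR i : ℂ), 0)]
  bDen := []

/-- Parameters of the `G^{1,2}_{2,2}` with upper row `-l, 1` and lower row `n, 0`. -/
def paramsG (n l : ℕ) : MeijerParams := .ordinary [-(l : ℂ), 1] [] [(n : ℂ)] [0]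

noncomputable def argM1 (i J : Fin c.N) (k : Fin c.M) : ℝ := c.varpi i k * c.theta i J k
noncomputable def argM2 (i J : Fin c.N) (k : Fin c.M) : ℝ :=
  c.varsigma i J k * c.varpi i k / c.gamI
noncomputable def argM3 (i : Fin c.N) : ℝ := c.xiSR i / (c.lamSP i * c.gamI)
noncomputable def argG1 (i : Fin c.N) (k : Fin c.M) : ℝ := c.lamSE i k / (c.lamSR i * c.gam)
noncomputable def argG2 (k : Fin c.M) : ℝ := c.lamRE k / (c.lamRD * c.gam)

/-- The bracket that both first-hop expressions share. -/
noncomputable def bracket1 (i : Fin c.N) (l : ℕ) : ℂ :=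
  lowerGamma (c.mSP i) (c.phiS i) * (Real.exp (-(c.sigma i * c.xiSR i / c.gamI)) : ℂ) /
      (c.sigma i : ℂ) ^ (-(c.nSR i : ℤ) + l + 1) +
    (c.lamSP i : ℂ) ^ c.mSP i *
        upperGamma ((c.mSP i : ℂ) + c.nSR i - l - 1)
          (c.phiS i + c.sigma i * c.xiSR i / c.gamI) /
      ((c.lamSP i + c.xiSR i / c.gamI : ℝ) : ℂ) ^ ((c.mSP i : ℤ) + c.nSR i - l - 1)

/-- The bracket of the second-hop expression. -/
noncomputable def bracket2 (j : ℕ) : ℂ :=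
  (Real.exp (-(c.delta * c.xiRD / c.gamI)) : ℂ) * lowerGamma c.mRP c.phiR /
      (c.delta : ℂ) ^ (-(c.nRD : ℤ) + j + 1) +
    (c.lamRP : ℂ) ^ c.mRP *
        upperGamma ((c.nRD : ℂ) + c.mRP - j - 1) (c.phiR + c.delta * c.xiRD / c.gamI) /
      ((c.xiRD / c.gamI + c.lamRP : ℝ) : ℂ) ^ ((c.nRD : ℤ) + c.mRP - j - 1)

/-- The closed form of `SOP_1^{(i,k,J)}`. -/
noncomputable def closed1Jam (i J : Fin c.N) (k : Fin c.M) : ℂ :=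
  1 - (lowerGamma (c.mSP i) (c.phiS i) *
          upperGamma (c.nSR i) (c.sigma i * c.xiSR i / c.gamI) +
        (c.paramsM3 i).G (c.argM3 i)) /
      ((Real.Gamma (c.nSR i) * Real.Gamma (c.mSP i) : ℝ) : ℂ) +
    ((c.gam * c.alphaCoef i J k / Real.Gamma (c.mSP i) : ℝ) : ℂ) *
      ∑ h ∈ Finset.range (c.nSE i k), (c.omegaCoef i k h : ℂ) *
        ∑ l ∈ Finset.range (c.nSR i),
          ((c.upsilon i l * c.gamI ^ (-(c.nSR i : ℤ) + l + 1) /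
              c.varpi i k ^ ((c.nSE i k : ℤ) + l - h) : ℝ) : ℂ) *
            c.bracket1 i l *
            (lowerGamma (c.mSP J) (c.phiS J) * (c.paramsM1 i J k h l).G (c.argM1 i J k) +
              (c.paramsM2 i J k h l).G (c.argM2 i J k))

/-- The closed form of `SOP_1^{(i,k)}`. -/
noncomputable def closed1 (i : Fin c.N) (k : Fin c.M) : ℂ :=
  1 - ((c.lamSR i ^ c.nSR i * c.gam /
        (Real.Gamma (c.nSE i k) * Real.Gamma (c.nSR i) * Real.Gamma (c.mSP i)) : ℝ) : ℂ) *
    ∑ l ∈ Finset.range (c.nSR i),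
      ((c.upsilon i l * c.gamI ^ (-(c.nSR i : ℤ) + l + 1) /
          (c.gam * c.lamSR i) ^ (l + 1) : ℝ) : ℂ) *
        (paramsG (c.nSE i k) l).G (c.argG1 i k) * c.bracket1 i l

/-- The closed form of `SOP_2^{(k)}`. -/
noncomputable def closed2 (k : Fin c.M) : ℂ :=
  1 - ((c.lamRD ^ c.nRD /
        (Real.Gamma (c.nRE k) * Real.Gamma c.nRD * Real.Gamma c.mRP) : ℝ) : ℂ) *
    ∑ j ∈ Finset.range c.nRD,
      ((c.bCoef j * c.gamI ^ (-(c.nRD : ℤ) + j + 1) / c.lamRD ^ (j + 1) : ℝ) : ℂ) *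
        (paramsG (c.nRE k) j).G (c.argG2 k) * c.bracket2 j

/-- All (incomplete) Meijer G-functions in the closed forms are convergent Mellin-Barnes
integrals. -/
def MeijerWellDefined : Prop :=
  (∀ i J : Fin c.N, J ≠ i → ∀ k, ∀ h < c.nSE i k, ∀ l < c.nSR i,
      (c.paramsM1 i J k h l).WellDefined (c.argM1 i J k) ∧
      (c.paramsM2 i J k h l).WellDefined (c.argM2 i J k)) ∧
    (∀ i, (c.paramsM3 i).WellDefined (c.argM3 i)) ∧
    (∀ i k, ∀ l < c.nSR i, (paramsG (c.nSE i k) l).WellDefined (c.argG1 i k)) ∧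
    (∀ k, ∀ j < c.nRD, (paramsG (c.nRE k) j).WellDefined (c.argG2 k))

end ClosedForms

end RelayNet

/-! The probabilities are computed as real integrals of incomplete Gamma functions, and each Meijer
G-function is separately identified with such an integral; what remains is matching of coefficients.

Probability. Squares of Nakagami amplitudes are Gamma distributed, and sums over antennas of one
link type stay Gamma (`nakagamiMeasure_map_sq`, `map_sum_gamma`). The main and the wiretap SNR of a
hop share one transmit power. With B the inverse transmit SNR, X the main gain and U the wiretap
gain (divided by 1 + W when a jammer with SNR W is present), no outage therefore means (γ - 1)B + γU
≤ X (`gam_mul_le_iff`). Conditioning on (B, U) gives the mean of an upper incomplete Gamma function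
at a sum of two independent terms. Since its order n is an integer, a binomial expansion
(`upperGammaNat_add`) separates the two, and `measureReal_hop` becomes a sum over l of a moment of B
times E Γ(l+1, κU). The moment of B is the bracket common to the terms
(`integral_pow_mul_exp_invPower`). Without a jammer E Γ(l+1, κU) is the integral of v^l e^(-v) γ(n,
zv). With one, `integral_upperGammaNat_jam` writes it as Γ(l+1) minus beta-type transforms of the
distribution function of W. The Γ(l+1) parts resum to Pr((γ - 1)B ≤ X), which yields the `paramsM3`
term, and the two parts of the distribution function of W yield the `paramsM1` and `paramsM2` terms.

Analysis. Starting from Mellin inversion for x^n e^(-x), every integral that occurs is a chain of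
multiplicative convolutions. By `HasMellinInv.mulConv` each convolution multiplies the transform by
one more factor of the Mellin-Barnes kernel and preserves absolute integrability on the line. As the
resulting function is the same for every separating line, `MeijerParams.wellDefined_and_G_eq` gives
convergence, independence of the line and the value together.

The two hops involve disjoint sets of links, so the overall probabilities factor
(`measureReal_le_min_cap2`). -/

/-! ### Inverse Mellin transforms along a vertical line -/

section MellinBarnes

open Complex Set Real in
/-- `f` is the inverse Mellin transform of `F` along the vertical line `Re s = c`, with an absolutely
convergent integral. -/
def HasMellinInv (f : ℝ → ℝ) (F : ℂ → ℂ) (c : ℝ) : Prop :=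
  Integrable (fun t : ℝ => F (c + t * Complex.I)) ∧
    ∀ x : ℝ, 0 < x → (1 / (2 * Real.pi : ℝ) : ℂ) *
      ∫ t : ℝ, F (c + t * Complex.I) * (x : ℂ) ^ (-((c : ℂ) + t * Complex.I)) = (f x : ℂ)

open Set

lemma norm_cpow_neg_line {x : ℝ} (hx : 0 < x) (c t : ℝ) :
    ‖(x : ℂ) ^ (-((c : ℂ) + t * Complex.I))‖ = x ^ (-c) := by
  rw [Complex.norm_cpow_eq_rpow_re_of_pos hx]
  simp

lemma measurable_cpow_neg_line (x c : ℝ) :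
    Measurable fun t : ℝ => (x : ℂ) ^ (-((c : ℂ) + t * Complex.I)) := by
  fun_prop

lemma HasMellinInv.integrable_mul_cpow {F : ℂ → ℂ} {c : ℝ}
    (hF : Integrable (fun t : ℝ => F (c + t * Complex.I))) {x : ℝ} (hx : 0 < x) :
    Integrable fun t : ℝ => F (c + t * Complex.I) * (x : ℂ) ^ (-((c : ℂ) + t * Complex.I)) :=
  hF.mul_bdd (c := x ^ (-c)) (measurable_cpow_neg_line x c).aestronglyMeasurable
    (.of_forall fun t => (norm_cpow_neg_line hx c t).le)

lemma HasMellinInv.congr {f g : ℝ → ℝ} {F G : ℂ → ℂ} {c : ℝ} (h : HasMellinInv f F c)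
    (hF : ∀ s : ℂ, s.re = c → F s = G s) (hf : ∀ x, 0 < x → f x = g x) : HasMellinInv g G c := by
  have e (t : ℝ) : F (c + t * Complex.I) = G (c + t * Complex.I) := hF _ (by simp)
  refine ⟨by simpa only [e] using h.1, fun x hx => ?_⟩
  rw [← hf x hx, ← h.2 x hx]
  simp only [e]

/-- The multiplicative convolution of an inverse Mellin transform with a weight `w` on `S`
multiplies the transform by `∫ v in S, w v * v ^ (-s)`. -/
lemma HasMellinInv.mulConv {f : ℝ → ℝ} {F : ℂ → ℂ} {c : ℝ} (h : HasMellinInv f F c)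
    {S : Set ℝ} (hS : MeasurableSet S) (hS0 : S ⊆ Ioi 0) {w : ℝ → ℝ}
    (hw : IntegrableOn (fun v => w v * v ^ (-c)) S) :
    HasMellinInv (fun x => ∫ v in S, w v * f (x * v))
      (fun s => F s * ∫ v in S, (w v : ℂ) * (v : ℂ) ^ (-s)) c := by
  have key (x : ℝ) (hx : 0 < x) : Integrable (fun p : ℝ × ℝ =>
      F (c + p.1 * Complex.I) * (x : ℂ) ^ (-((c : ℂ) + p.1 * Complex.I)) *
        ((w p.2 : ℂ) * (p.2 : ℂ) ^ (-((c : ℂ) + p.1 * Complex.I))))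
      (volume.prod (volume.restrict S)) := by
    have h1 : Integrable (fun p : ℝ × ℝ =>
      (F (c + p.1 * Complex.I) * (x : ℂ) ^ (-((c : ℂ) + p.1 * Complex.I))) *
        ((w p.2 * p.2 ^ (-c) : ℝ) : ℂ)) (volume.prod (volume.restrict S)) :=
      (integrable_mul_cpow h.1 hx).mul_prod hw.ofReal
    -- On the line, v^(-s) is v^(-c) times a factor of modulus one, so the product integrability of
    -- `h1` is enough.
    have h2 : Integrable (fun p : ℝ × ℝ =>
      (F (c + p.1 * Complex.I) * (x : ℂ) ^ (-((c : ℂ) + p.1 * Complex.I))) *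
        ((w p.2 * p.2 ^ (-c) : ℝ) : ℂ) * (p.2 : ℂ) ^ (-((0 : ℝ) + p.1 * Complex.I)))
        (volume.prod (volume.restrict S)) := by
      refine h1.mul_bdd (c := 1) (Measurable.aestronglyMeasurable (by fun_prop)) ?_
      have : ∀ᵐ p : ℝ × ℝ ∂volume.prod (volume.restrict S), p.2 ∈ S :=
        Measure.quasiMeasurePreserving_snd.ae (ae_restrict_mem hS)
      filter_upwards [this] with p hp
      rw [norm_cpow_neg_line (hS0 hp)]
      simp
    refine h2.congr ?_
    have : ∀ᵐ p : ℝ × ℝ ∂volume.prod (volume.restrict S), p.2 ∈ S :=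
      Measure.quasiMeasurePreserving_snd.ae (ae_restrict_mem hS)
    filter_upwards [this] with p hp
    have hp0 : (0 : ℝ) < p.2 := hS0 hp
    have hp1 : (p.2 : ℂ) ≠ 0 := by exact_mod_cast hp0.ne'
    have : (p.2 : ℂ) ^ (-((c : ℂ) + p.1 * Complex.I)) =
        ((p.2 ^ (-c) : ℝ) : ℂ) * (p.2 : ℂ) ^ (-((0 : ℝ) + p.1 * Complex.I)) := by
      rw [Complex.ofReal_cpow hp0.le, ← Complex.cpow_add _ _ hp1]
      congr 1
      push_cast
      ring
    rw [this]
    push_cast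
    ring
  refine ⟨?_, fun x hx => ?_⟩
  -- At x = 1 the power of x disappears, and integrating out v in the Fubini bound leaves exactly
  -- the new transform.
  · refine (key 1 one_pos).integral_prod_left.congr (.of_forall fun t => ?_)
    simp only [Complex.ofReal_one, Complex.one_cpow, mul_one]
    rw [integral_const_mul]
  · have e1 : ((∫ v in S, w v * f (x * v) : ℝ) : ℂ) = ∫ v in S, (1 / (2 * Real.pi : ℝ) : ℂ) *
        ∫ t : ℝ, F (c + t * Complex.I) * (x : ℂ) ^ (-((c : ℂ) + t * Complex.I)) *
        ((w v : ℂ) * (v : ℂ) ^ (-((c : ℂ) + t * Complex.I))) := by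
      rw [← integral_complex_ofReal]
      refine setIntegral_congr_fun hS fun v hv => ?_
      have hv0 : 0 < v := hS0 hv
      simp only [Complex.ofReal_mul]
      rw [← h.2 (x * v) (mul_pos hx hv0), mul_left_comm, ← integral_const_mul]
      push_cast
      congr 2
      ext t
      rw [Complex.mul_cpow_ofReal_nonneg hx.le hv0.le]
      ring
    rw [e1, integral_const_mul, ← integral_integral_swap (key x hx)]
    congr 2
    ext t
    rw [integral_const_mul]
    ring

lemma norm_Gamma_le {s : ℂ} (hs : 0 < s.re) : ‖Complex.Gamma s‖ ≤ Real.Gamma s.re := by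
  rw [Complex.Gamma_eq_integral hs, Real.Gamma_eq_integral hs, Complex.GammaIntegral]
  refine (norm_integral_le_integral_norm _).trans_eq (setIntegral_congr_fun measurableSet_Ioi ?_)
  intro x hx
  simp only [norm_mul, Complex.norm_real, Real.norm_eq_abs, Real.abs_exp]
  rw [Complex.norm_cpow_eq_rpow_re_of_pos hx]
  simp

/-- Quadratic decay suffices: Γ(s) = Γ(s+2) / (s(s+1)), and Γ(s+2) is bounded on the line by its
value at the real part. -/
lemma integrable_Gamma_line {a : ℝ} (ha : 0 < a) :
    Integrable fun t : ℝ => Complex.Gamma (a + t * Complex.I) := by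
  have hne (t : ℝ) : (a : ℂ) + t * Complex.I ≠ 0 := fun h => by
    have := congrArg Complex.re h; simp at this; exact ha.ne' this
  have hne1 (t : ℝ) : (a : ℂ) + t * Complex.I + 1 ≠ 0 := fun h => by
    have := congrArg Complex.re h; simp at this; linarith
  have hcont : Continuous fun t : ℝ => Complex.Gamma (a + t * Complex.I) := by
    rw [continuous_iff_continuousAt]
    intro t
    refine ContinuousAt.comp (g := Complex.Gamma) ?_ (by fun_prop)
    refine (Complex.differentiableAt_Gamma _ fun m h => ?_).continuousAt
    have := congrArg Complex.re h
    simp at this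
    have : (0 : ℝ) ≤ m := m.cast_nonneg
    linarith
  -- This b satisfies b ≤ 1, b ≤ a and b ≤ a + 1, so b²(1 + t²) bounds both |s|² and |s+1|² from
  -- below.
  set b := min a 1 with hb
  have hb0 : 0 < b := lt_min ha one_pos
  refine Integrable.mono' (g := fun t : ℝ => Real.Gamma (a + 2) * (b ^ 2)⁻¹ * (1 + t ^ 2)⁻¹)
    (integrable_inv_one_add_sq.const_mul _) hcont.aestronglyMeasurable (.of_forall fun t => ?_)
  have e : Complex.Gamma (a + t * Complex.I) = Complex.Gamma (a + t * Complex.I + 1 + 1) /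
      ((a + t * Complex.I) * (a + t * Complex.I + 1)) := by
    rw [Complex.Gamma_add_one _ (hne1 t), Complex.Gamma_add_one _ (hne t)]
    field_simp [hne t, hne1 t]
  have hG : ‖Complex.Gamma (a + t * Complex.I + 1 + 1)‖ ≤ Real.Gamma (a + 2) := by
    refine (norm_Gamma_le (by simp; linarith)).trans_eq ?_
    congr 1
    simp
    ring
  have hsq {u : ℝ} (hu : b ≤ u) : b ^ 2 * (1 + t ^ 2) ≤ u ^ 2 + t ^ 2 := by
    have : b ^ 2 ≤ u ^ 2 := by gcongr
    have : b ^ 2 ≤ 1 := pow_le_one₀ hb0.le (min_le_right _ _)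
    nlinarith [sq_nonneg t]
  have hn (u : ℝ) : ‖(u : ℂ) + t * Complex.I‖ = √(u ^ 2 + t ^ 2) := Complex.norm_add_mul_I u t
  have hden : b ^ 2 * (1 + t ^ 2) ≤ ‖((a : ℂ) + t * Complex.I) * (a + t * Complex.I + 1)‖ := by
    have e2 : (a : ℂ) + t * Complex.I + 1 = ((a + 1 : ℝ) : ℂ) + t * Complex.I := by
      push_cast; ring
    rw [norm_mul, e2, hn, hn]
    calc b ^ 2 * (1 + t ^ 2) = √(b ^ 2 * (1 + t ^ 2)) * √(b ^ 2 * (1 + t ^ 2)) :=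
          (Real.mul_self_sqrt (by positivity)).symm
      _ ≤ _ := by
          gcongr
          · exact hsq (min_le_left _ _)
          · exact hsq ((min_le_left _ _).trans (by linarith))
  rw [e, norm_div, mul_assoc, ← mul_inv, ← div_eq_mul_inv]
  gcongr

/-- The only appeal to the Mellin inversion theorem; all other inverse transforms are convolutions
built on this one. -/
lemma hasMellinInv_pow_mul_exp_neg (n : ℕ) {c : ℝ} (hc : -(n : ℝ) < c) :
    HasMellinInv (fun x => x ^ n * Real.exp (-x)) (fun s => Complex.Gamma (n + s)) c := by
  have hm (s : ℂ) : mellin (fun x : ℝ => ((x ^ n * Real.exp (-x) : ℝ) : ℂ)) s =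
      Complex.GammaIntegral (n + s) := by
    rw [mellin, Complex.GammaIntegral]
    refine setIntegral_congr_fun measurableSet_Ioi fun x hx => ?_
    have hx0 : (x : ℂ) ≠ 0 := by exact_mod_cast (ne_of_gt hx)
    simp only [smul_eq_mul]
    rw [show (n : ℂ) + s - 1 = (s - 1) + n by ring, Complex.cpow_add _ _ hx0, Complex.cpow_natCast]
    push_cast
    ring
  have hmG (t : ℝ) : mellin (fun x : ℝ => ((x ^ n * Real.exp (-x) : ℝ) : ℂ)) (c + t * Complex.I) =
      Complex.Gamma (n + (c + t * Complex.I)) := by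
    rw [hm, Complex.Gamma_eq_integral (by simp; linarith)]
  have hint : Integrable (fun t : ℝ => Complex.Gamma (n + (c + t * Complex.I))) := by
    have := integrable_Gamma_line (a := n + c) (by linarith)
    simpa [add_assoc] using this
  refine ⟨hint, fun x hx => ?_⟩
  have := mellinInv_mellin_eq c (fun x : ℝ => ((x ^ n * Real.exp (-x) : ℝ) : ℂ)) hx ?_ ?_
    (by fun_prop)
  · rw [← this, mellinInv]
    simp only [hmG, smul_eq_mul, Complex.real_smul]
    push_cast
    simp only [mul_comm]
  · have := Complex.GammaIntegral_convergent (s := n + c) (by simp; linarith)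
    refine this.congr_fun (fun x hx => ?_) measurableSet_Ioi
    have hx0 : (x : ℂ) ≠ 0 := by exact_mod_cast (ne_of_gt hx)
    simp only [smul_eq_mul]
    rw [show (n : ℂ) + c - 1 = (c - 1) + n by ring, Complex.cpow_add _ _ hx0, Complex.cpow_natCast]
    push_cast
    ring
  · simpa only [Complex.VerticalIntegrable, hmG] using hint

end MellinBarnes

/-! ### Incomplete Gamma functions of integer order, and the Mellin weights used as convolution
factors -/

section IncompleteGamma

open Set

/-- The upper incomplete Gamma function of a positive integer. -/
noncomputable def upperGammaNat (n : ℕ) (x : ℝ) : ℝ :=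
  ∫ t in Ioi x, t ^ (n - 1) * Real.exp (-t)

/-- The lower incomplete Gamma function of a positive integer. -/
noncomputable def lowerGammaNat (n : ℕ) (x : ℝ) : ℝ :=
  ∫ t in Ioc 0 x, t ^ (n - 1) * Real.exp (-t)

lemma integrableOn_pow_mul_exp_neg (n : ℕ) :
    IntegrableOn (fun t : ℝ => t ^ n * Real.exp (-t)) (Ioi 0) := by
  refine (Real.GammaIntegral_convergent (s := n + 1) (by positivity)).congr_fun
    (fun t ht => ?_) measurableSet_Ioi
  simp only [add_sub_cancel_right, Real.rpow_natCast]
  ring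

lemma integral_pow_mul_exp_neg (n : ℕ) :
    ∫ t in Ioi (0 : ℝ), t ^ n * Real.exp (-t) = Real.Gamma (n + 1) := by
  rw [Real.Gamma_eq_integral (by positivity)]
  refine setIntegral_congr_fun measurableSet_Ioi fun t ht => ?_
  simp only [add_sub_cancel_right, Real.rpow_natCast]
  ring

lemma upperGammaNat_zero {n : ℕ} (hn : 0 < n) : upperGammaNat n 0 = Real.Gamma n := by
  rw [upperGammaNat, integral_pow_mul_exp_neg]
  congr 1
  exact_mod_cast Nat.succ_pred_eq_of_pos hn

lemma natCast_sub_one_add_one {R : Type*} [AddGroupWithOne R] {n : ℕ} (hn : 0 < n) :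
    ((n - 1 : ℕ) : R) = (n : R) - 1 := by
  rw [Nat.cast_sub hn, Nat.cast_one]

lemma upperGamma_natCast {n : ℕ} (hn : 0 < n) {x : ℝ} (hx : 0 < x) :
    upperGamma n x = (upperGammaNat n x : ℂ) := by
  rw [upperGamma, if_neg hx.ne', upperGammaNat, ← integral_complex_ofReal]
  refine setIntegral_congr_fun measurableSet_Ioi fun t ht => ?_
  rw [← natCast_sub_one_add_one hn, Complex.cpow_natCast]
  push_cast
  ring

lemma lowerGamma_natCast {n : ℕ} (hn : 0 < n) {x : ℝ} (hx : 0 ≤ x) :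
    lowerGamma n x = (lowerGammaNat n x : ℂ) := by
  rw [lowerGamma, Complex.partialGamma, lowerGammaNat, intervalIntegral.integral_of_le hx,
    ← integral_complex_ofReal]
  refine setIntegral_congr_fun measurableSet_Ioc fun t ht => ?_
  rw [← natCast_sub_one_add_one hn, Complex.cpow_natCast]
  push_cast
  ring

/-- Substituting t = xv, Γ(n, x) is the convolution of x^n e^(-x) with 1/v on (1, ∞), whose weight ∫
v^(-1-s) dv = 1/s requires Re s > 0. -/
lemma hasMellinInv_upperGammaNat {n : ℕ} (hn : 0 < n) {c : ℝ} (hc : 0 < c) :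
    HasMellinInv (upperGammaNat n) (fun s => Complex.Gamma (n + s) * (1 / s)) c := by
  have h0 : -(n : ℝ) < c := by have : (0 : ℝ) ≤ n := n.cast_nonneg; linarith
  have hsub : Ioi (1 : ℝ) ⊆ Ioi 0 := Ioi_subset_Ioi zero_le_one
  refine ((hasMellinInv_pow_mul_exp_neg n h0).mulConv measurableSet_Ioi hsub
    (w := fun v => v⁻¹) ?_).congr (fun s hs => ?_) fun x hx => ?_
  · refine (integrableOn_Ioi_rpow_of_lt (a := -1 - c) (by linarith) one_pos).congr_fun
      (fun v hv => ?_) measurableSet_Ioi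
    have hv0 : (0 : ℝ) < v := hsub hv
    simp only
    rw [sub_eq_add_neg, Real.rpow_add hv0, Real.rpow_neg_one]
  · have hs0 : s ≠ 0 := fun h => by simp [h] at hs; exact hc.ne hs
    have : ∫ v in Ioi (1 : ℝ), ((v⁻¹ : ℝ) : ℂ) * (v : ℂ) ^ (-s) = 1 / s := by
      rw [← setIntegral_congr_fun (f := fun v : ℝ => (v : ℂ) ^ (-1 - s)) measurableSet_Ioi,
        integral_Ioi_cpow_of_lt (by simp [hs, hc]) one_pos]
      · rw [Complex.ofReal_one, Complex.one_cpow, show -1 - s + 1 = -s by ring]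
        field_simp
      · intro v hv
        have hv0 : (v : ℂ) ≠ 0 := by exact_mod_cast (ne_of_gt (hsub hv))
        simp only
        rw [sub_eq_add_neg, Complex.cpow_add _ _ hv0, Complex.cpow_neg_one, Complex.ofReal_inv]
    rw [this]
  · rw [upperGammaNat]
    have := integral_comp_mul_left_Ioi (fun t => t ^ (n - 1) * Real.exp (-t)) 1 hx
    rw [mul_one, smul_eq_mul, eq_inv_mul_iff_mul_eq₀ hx.ne'] at this
    rw [← this, ← integral_const_mul]
    refine setIntegral_congr_fun measurableSet_Ioi fun v hv => ?_
    have hv0 : v ≠ 0 := ne_of_gt (hsub hv)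
    obtain ⟨k, rfl⟩ := Nat.exists_eq_succ_of_ne_zero hn.ne'
    simp only [Nat.succ_eq_add_one, Nat.add_sub_cancel]
    field_simp
    ring

/-- The same convolution over (0, 1] has weight -1/s and needs Re s < 0; the line lies between the
poles of Γ(n+s) and 0. -/
lemma hasMellinInv_lowerGammaNat {n : ℕ} (hn : 0 < n) {c : ℝ} (hc : -(n : ℝ) < c) (hc0 : c < 0) :
    HasMellinInv (lowerGammaNat n) (fun s => Complex.Gamma (n + s) * (-1 / s)) c := by
  have hsub : Ioc (0 : ℝ) 1 ⊆ Ioi 0 := fun x hx => hx.1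
  refine ((hasMellinInv_pow_mul_exp_neg n hc).mulConv measurableSet_Ioc hsub
    (w := fun v => v⁻¹) ?_).congr (fun s hs => ?_) fun x hx => ?_
  · have := intervalIntegral.intervalIntegrable_rpow' (a := 0) (b := 1) (r := -1 - c)
      (by linarith)
    rw [intervalIntegrable_iff_integrableOn_Ioc_of_le zero_le_one] at this
    refine this.congr_fun (fun v hv => ?_) measurableSet_Ioc
    have hv0 : (0 : ℝ) < v := hsub hv
    simp only
    rw [sub_eq_add_neg, Real.rpow_add hv0, Real.rpow_neg_one]
  · have hs0 : s ≠ 0 := fun h => by simp [h] at hs; exact hc0.ne hs.symm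
    have : ∫ v in Ioc (0 : ℝ) 1, ((v⁻¹ : ℝ) : ℂ) * (v : ℂ) ^ (-s) = -1 / s := by
      rw [← setIntegral_congr_fun (f := fun v : ℝ => (v : ℂ) ^ (-1 - s)) measurableSet_Ioc,
        ← intervalIntegral.integral_of_le zero_le_one, integral_cpow (by simp [hs, hc0])]
      · rw [Complex.ofReal_one, Complex.one_cpow, Complex.ofReal_zero,
          show -1 - s + 1 = -s by ring]
        rw [Complex.zero_cpow (neg_ne_zero.mpr hs0)]
        field_simp
        ring
      · intro v hv
        have hv0 : (v : ℂ) ≠ 0 := by exact_mod_cast (ne_of_gt (hsub hv))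
        simp only
        rw [sub_eq_add_neg, Complex.cpow_add _ _ hv0, Complex.cpow_neg_one, Complex.ofReal_inv]
    rw [this]
  · rw [lowerGammaNat, ← intervalIntegral.integral_of_le hx.le,
      ← intervalIntegral.integral_of_le zero_le_one]
    have := intervalIntegral.mul_integral_comp_mul_left (a := 0) (b := 1)
      (f := fun t => t ^ (n - 1) * Real.exp (-t)) x
    rw [mul_one, mul_zero] at this
    rw [← this, ← intervalIntegral.integral_const_mul,
      intervalIntegral.integral_of_le zero_le_one, intervalIntegral.integral_of_le zero_le_one]
    refine setIntegral_congr_fun measurableSet_Ioc fun v hv => ?_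
    have hv0 : v ≠ 0 := ne_of_gt (hsub hv)
    obtain ⟨k, rfl⟩ := Nat.exists_eq_succ_of_ne_zero hn.ne'
    simp only [Nat.succ_eq_add_one, Nat.add_sub_cancel]
    field_simp
    ring

lemma integrableOn_pow_mul_exp_neg_mul_rpow (l : ℕ) {c : ℝ} (hc : c < l + 1) :
    IntegrableOn (fun v : ℝ => v ^ l * Real.exp (-v) * v ^ (-c)) (Ioi 0) := by
  refine (Real.GammaIntegral_convergent (s := l + 1 - c) (by linarith)).congr_fun
    (fun v hv => ?_) measurableSet_Ioi
  simp only
  rw [show (l : ℝ) + 1 - c - 1 = l + -c by ring, Real.rpow_add hv, Real.rpow_natCast]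
  ring

lemma integral_pow_mul_exp_neg_mul_cpow (l : ℕ) {s : ℂ} (hs : s.re < l + 1) :
    ∫ v in Ioi (0 : ℝ), ((v ^ l * Real.exp (-v) : ℝ) : ℂ) * (v : ℂ) ^ (-s) =
      Complex.Gamma (l + 1 - s) := by
  rw [Complex.Gamma_eq_integral (by simpa using hs), Complex.GammaIntegral]
  refine setIntegral_congr_fun measurableSet_Ioi fun v hv => ?_
  have hv0 : (v : ℂ) ≠ 0 := by exact_mod_cast (ne_of_gt hv)
  rw [show (l : ℂ) + 1 - s - 1 = l + -s by ring, Complex.cpow_add _ _ hv0, Complex.cpow_natCast]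
  push_cast
  ring

/-- Away from the origin c is unrestricted: for v > x the factor (v/x)^k ≥ 1 may be inserted with k
> c - l, which reduces to the integral over (0, ∞). This reflects that the incomplete Gamma factor
has no poles. -/
lemma integrableOn_pow_mul_exp_neg_mul_rpow_Ioi (l : ℕ) (c : ℝ) {x : ℝ} (hx : 0 < x) :
    IntegrableOn (fun v : ℝ => v ^ l * Real.exp (-v) * v ^ (-c)) (Ioi x) := by
  obtain ⟨k, hk⟩ := exists_nat_gt (c - l)
  refine Integrable.mono' (g := fun v : ℝ => x ^ (-(k : ℝ)) * (v ^ (l + k) * Real.exp (-v) * v ^ (-c)))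
    (((integrableOn_pow_mul_exp_neg_mul_rpow (l + k) (c := c)
      (by push_cast; linarith)).mono_set (Ioi_subset_Ioi hx.le)).const_mul _)
    (Measurable.aestronglyMeasurable (by fun_prop)) ?_
  refine (ae_restrict_mem measurableSet_Ioi).mono fun v hv => ?_
  have hv0 : 0 < v := hx.trans hv
  have h1 : 1 ≤ x ^ (-(k : ℝ)) * v ^ k := by
    rw [Real.rpow_neg hx.le, Real.rpow_natCast, ← inv_pow, ← mul_pow]
    refine one_le_pow₀ ?_
    rw [inv_mul_eq_div, one_le_div hx]
    exact le_of_lt hv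
  rw [Real.norm_of_nonneg (by positivity)]
  calc _ ≤ (x ^ (-(k : ℝ)) * v ^ k) * (v ^ l * Real.exp (-v) * v ^ (-c)) :=
        le_mul_of_one_le_left (by positivity) h1
    _ = _ := by ring

lemma integral_pow_mul_exp_neg_mul_cpow_Ioi {m : ℕ} (hm : 0 < m) (s : ℂ) {x : ℝ} (hx : 0 < x) :
    ∫ v in Ioi x, ((v ^ (m - 1) * Real.exp (-v) : ℝ) : ℂ) * (v : ℂ) ^ (-s) =
      upperGamma (m - s) x := by
  rw [upperGamma, if_neg hx.ne']
  refine setIntegral_congr_fun measurableSet_Ioi fun v hv => ?_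
  have hv0 : (v : ℂ) ≠ 0 := by exact_mod_cast (ne_of_gt (hx.trans hv))
  rw [show (m : ℂ) - s - 1 = (m - 1 : ℕ) + -s by rw [natCast_sub_one_add_one hm]; ring,
    Complex.cpow_add _ _ hv0, Complex.cpow_natCast]
  push_cast
  ring

lemma image_div_one_add_Ioi : (fun v : ℝ => v / (1 + v)) '' Ioi 0 = Ioo 0 1 := by
  ext y
  constructor
  · rintro ⟨v, hv, rfl⟩
    have hv : (0 : ℝ) < v := hv
    exact ⟨by positivity, by rw [div_lt_one (by positivity)]; linarith⟩
  · rintro ⟨h0, h1⟩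
    have : 0 < 1 - y := by linarith
    refine ⟨y / (1 - y), by simp only [mem_Ioi]; positivity, ?_⟩
    field_simp
    ring

/-- Pullback of the Euler beta integrand under y = v/(1+v), where 1 - y = 1/(1+v) and dy =
dv/(1+v)². The powers of 1 + v add up to the integer a + b = N. Writing every factor as an
exponential of logarithms reduces the identity to linear algebra in the exponents. -/
lemma beta_integrand_comp {a b : ℂ} {N h : ℕ} {s : ℂ} (ha : a = h + 1 - s) (hab : a + b = N)
    {v : ℝ} (hv : 0 < v) :
    |1 / (1 + v) ^ 2| • (((v / (1 + v) : ℝ) : ℂ) ^ (a - 1) *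
        (1 - ((v / (1 + v) : ℝ) : ℂ)) ^ (b - 1)) =
      ((v ^ h * ((1 + v) ^ N)⁻¹ : ℝ) : ℂ) * (v : ℂ) ^ (-s) := by
  have h1 : 0 < 1 + v := by linarith
  have e1 : (1 : ℂ) - ((v / (1 + v) : ℝ) : ℂ) = (((1 + v)⁻¹ : ℝ) : ℂ) := by
    have : 1 - v / (1 + v) = (1 + v)⁻¹ := by field_simp; ring
    rw [← this]
    push_cast
    ring
  have hpow {x : ℝ} (hx : 0 < x) (n : ℕ) : ((x ^ n : ℝ) : ℂ) = Complex.exp (n * Real.log x) := by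
    rw [mul_comm, ← Complex.ofReal_natCast, ← Complex.ofReal_mul, ← Complex.ofReal_exp,
      mul_comm, Real.exp_nat_mul, Real.exp_log hx]
  have hcpow {x : ℝ} (hx : 0 < x) (z : ℂ) : (x : ℂ) ^ z = Complex.exp (Real.log x * z) := by
    rw [Complex.cpow_def_of_ne_zero (by exact_mod_cast hx.ne'), Complex.ofReal_log hx.le]
  rw [abs_of_pos (by positivity), Complex.real_smul, e1, hcpow (by positivity), hcpow (by positivity),
    hcpow hv, Real.log_div hv.ne' h1.ne', Real.log_inv, one_div, Complex.ofReal_mul,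
    Complex.ofReal_inv, Complex.ofReal_inv, hpow h1, hpow h1, hpow hv, ← Complex.exp_neg,
    ← Complex.exp_neg, ← Complex.exp_add, ← Complex.exp_add, ← Complex.exp_add, ← Complex.exp_add, ← hab]
  congr 1
  rw [ha]
  push_cast
  ring

lemma integrableOn_and_integral_beta_prime {h N : ℕ} {s : ℂ} (hs : s.re < h + 1)
    (hsN : (h : ℝ) + 1 - N < s.re) :
    IntegrableOn (fun v : ℝ => ((v ^ h * ((1 + v) ^ N)⁻¹ : ℝ) : ℂ) * (v : ℂ) ^ (-s)) (Ioi 0) ∧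
    ∫ v in Ioi (0 : ℝ), ((v ^ h * ((1 + v) ^ N)⁻¹ : ℝ) : ℂ) * (v : ℂ) ^ (-s) =
      Complex.Gamma (h + 1 - s) * Complex.Gamma (N - h - 1 + s) / Complex.Gamma N := by
  set a : ℂ := h + 1 - s with ha
  set b : ℂ := N - h - 1 + s with hb
  have hab : a + b = N := by rw [ha, hb]; ring
  have ha0 : 0 < a.re := by simpa [ha] using hs
  have hb0 : 0 < b.re := by simp [hb]; linarith
  have hder : ∀ v ∈ Ioi (0 : ℝ), HasDerivWithinAt (fun v : ℝ => v / (1 + v)) (1 / (1 + v) ^ 2)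
      (Ioi 0) v := by
    intro v hv
    have hv : (0 : ℝ) < v := hv
    have := (hasDerivAt_id v).div ((hasDerivAt_id v).const_add 1) (by simp; positivity)
    convert! this.hasDerivWithinAt using 1
    simp
  have hinj : InjOn (fun v : ℝ => v / (1 + v)) (Ioi 0) := by
    intro x hx y hy hxy
    have hx : (0 : ℝ) < x := hx
    have hy : (0 : ℝ) < y := hy
    simp only at hxy
    rw [div_eq_div_iff (by positivity) (by positivity)] at hxy
    linarith
  have hint := Complex.betaIntegral_convergent ha0 hb0
  rw [intervalIntegrable_iff_integrableOn_Ioo_of_le zero_le_one, ← image_div_one_add_Ioi,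
    integrableOn_image_iff_integrableOn_abs_deriv_smul measurableSet_Ioi hder hinj] at hint
  refine ⟨hint.congr_fun (fun v hv => beta_integrand_comp ha hab hv) measurableSet_Ioi, ?_⟩
  have hN : 0 < (N : ℂ).re := by rw [← hab, Complex.add_re]; linarith
  rw [← hab, mul_comm, Complex.Gamma_mul_Gamma_eq_betaIntegral hb0 ha0, add_comm b a,
    mul_div_cancel_left₀ _ (Complex.Gamma_ne_zero_of_re_pos (by rwa [hab])),
    Complex.betaIntegral_symm, Complex.betaIntegral, intervalIntegral.integral_of_le zero_le_one,
    integral_Ioc_eq_integral_Ioo, ← image_div_one_add_Ioi,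
    integral_image_eq_integral_abs_deriv_smul measurableSet_Ioi hder hinj]
  exact (setIntegral_congr_fun measurableSet_Ioi fun v hv => beta_integrand_comp ha hab hv).symm

/-- The norm of the complex beta integrand at the real point s = c. -/
lemma integrableOn_beta_prime_rpow {h N : ℕ} {c : ℝ} (hc : c < h + 1) (hcN : (h : ℝ) + 1 - N < c) :
    IntegrableOn (fun v : ℝ => v ^ h * ((1 + v) ^ N)⁻¹ * v ^ (-c)) (Ioi 0) := by
  have := (integrableOn_and_integral_beta_prime (s := c) hc hcN).1.norm
  refine IntegrableOn.congr_fun this (fun v hv => ?_) measurableSet_Ioi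
  have hv : (0 : ℝ) < v := hv
  simp only [norm_mul, Complex.norm_real]
  rw [Complex.norm_cpow_eq_rpow_re_of_pos hv, Real.norm_of_nonneg (by positivity),
    Real.norm_of_nonneg (by positivity)]
  simp

end IncompleteGamma

/-! ### Meijer G-functions as real integrals -/

section MeijerIntegrals

open Set

lemma HasMellinInv.const_mul {f : ℝ → ℝ} {F : ℂ → ℂ} {c : ℝ} (h : HasMellinInv f F c) (r : ℝ) :
    HasMellinInv (fun x => r * f x) (fun s => r * F s) c := by
  refine ⟨h.1.const_mul _, fun x hx => ?_⟩
  simp only [mul_assoc]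
  rw [integral_const_mul, mul_left_comm, h.2 x hx, Complex.ofReal_mul]

/-- The function f is common to all separating lines, so every line gives the value f z. The line
chosen by `Classical.epsilon` in the definition of `G` is one of them because a separating line
exists. -/
lemma MeijerParams.wellDefined_and_G_eq {p : MeijerParams} {f : ℝ → ℝ} {F : ℂ → ℂ}
    (hex : ∃ c, p.Separates c) (H : ∀ c, p.Separates c → HasMellinInv f F c)
    (hker : ∀ c, p.Separates c → ∀ s : ℂ, s.re = c → ∀ z : ℂ, p.kernel z s = F s * z ^ (-s))
    {z : ℝ} (hz : 0 < z) : p.WellDefined z ∧ p.G z = f z := by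
  have hk (c : ℝ) (hc : p.Separates c) (t : ℝ) : p.kernel z (c + t * Complex.I) =
      F (c + t * Complex.I) * (z : ℂ) ^ (-((c : ℂ) + t * Complex.I)) :=
    hker c hc _ (by simp) _
  have hline (c : ℝ) (hc : p.Separates c) : p.lineIntegral z c = f z := by
    rw [lineIntegral, ← (H c hc).2 z hz]
    simp only [hk c hc]
  have hG : p.G z = f z := hline _ (Classical.epsilon_spec hex)
  refine ⟨⟨hex, fun c hc => ⟨?_, by rw [hline c hc, hG]⟩⟩, hG⟩
  simp only [hk c hc]
  exact HasMellinInv.integrable_mul_cpow (H c hc).1 hz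

lemma upperGamma_zero_right (a : ℂ) : upperGamma a 0 = Complex.Gamma a := if_pos rfl

/-- An upper parameter 1 in the numerator together with a lower parameter 0 in the denominator
contributes this ratio, which is the weight in `hasMellinInv_lowerGammaNat`. -/
lemma Gamma_neg_div_Gamma_one_sub {s : ℂ} (hs : s.re < 0) :
    Complex.Gamma (-s) / Complex.Gamma (1 - s) = -1 / s := by
  have h0 : -s ≠ 0 := fun h => by rw [neg_eq_zero] at h; simp [h] at hs
  have hG : Complex.Gamma (-s) ≠ 0 := Complex.Gamma_ne_zero_of_re_pos (by simpa using hs)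
  rw [show (1 : ℂ) - s = -s + 1 by ring, Complex.Gamma_add_one _ h0]
  have : s ≠ 0 := by simpa using h0
  field_simp

/-- `∫₀^∞ v^l e^(-v) γ(n, z v) dv`. -/
noncomputable def expLowerGammaIntegral (n l : ℕ) (z : ℝ) : ℝ :=
  ∫ v in Ioi 0, v ^ l * Real.exp (-v) * lowerGammaNat n (z * v)

/-- `∫_φ^∞ t^(m-1) e^(-t) Γ(n, z t) dt`. -/
noncomputable def tailUpperGammaIntegral (n m : ℕ) (φ z : ℝ) : ℝ :=
  ∫ t in Ioi φ, t ^ (m - 1) * Real.exp (-t) * upperGammaNat n (z * t)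

/-- `∫_φ^∞ t^(m-1) e^(-t) γ(n, z t) dt`. -/
noncomputable def tailLowerGammaIntegral (n m : ℕ) (φ z : ℝ) : ℝ :=
  ∫ t in Ioi φ, t ^ (m - 1) * Real.exp (-t) * lowerGammaNat n (z * t)

/-- `Γ(N) ∫₀^∞ v^h (1 + v)^(-N) f(z v) dv`. -/
noncomputable def betaTransform (h N : ℕ) (f : ℝ → ℝ) (z : ℝ) : ℝ :=
  Real.Gamma N * ∫ v in Ioi 0, v ^ h * ((1 + v) ^ N)⁻¹ * f (z * v)

/-- The beta kernel has weight Γ(h+1-s)Γ(μ+s)/Γ(μ+h+1). The prefactor Γ(N) in `betaTransform`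
cancels the denominator, leaving one numerator factor of each kind. -/
lemma HasMellinInv.betaTransform {f : ℝ → ℝ} {F : ℂ → ℂ} {c : ℝ} (H : HasMellinInv f F c)
    {h μ : ℕ} (hc : c < h + 1) (hcμ : -(μ : ℝ) < c) :
    HasMellinInv (betaTransform h (μ + h + 1) f)
      (fun s => F s * (Complex.Gamma (h + 1 - s) * Complex.Gamma (μ + s))) c := by
  have hN : (h : ℝ) + 1 - (μ + h + 1 : ℕ) < c := by push_cast; linarith
  refine ((H.mulConv measurableSet_Ioi subset_rfl (integrableOn_beta_prime_rpow hc hN)).const_mul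
    (Real.Gamma (μ + h + 1 : ℕ))).congr (fun s hs => ?_) fun x hx => rfl
  rw [(integrableOn_and_integral_beta_prime (s := s) (by rwa [hs]) (by rwa [hs])).2,
    ← Complex.Gamma_ofReal, Complex.ofReal_natCast]
  have : Complex.Gamma ((μ + h + 1 : ℕ) : ℂ) ≠ 0 :=
    Complex.Gamma_ne_zero_of_re_pos (by rw [Complex.natCast_re]; positivity)
  rw [show ((μ + h + 1 : ℕ) : ℂ) - h - 1 + s = μ + s by push_cast; ring]
  field_simp

lemma hasMellinInv_tailUpperGammaIntegral {n m : ℕ} (hn : 0 < n) (hm : 0 < m) {φ : ℝ} (hφ : 0 < φ)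
    {c : ℝ} (hc : 0 < c) :
    HasMellinInv (tailUpperGammaIntegral n m φ)
      (fun s => Complex.Gamma (n + s) * (1 / s) * upperGamma (m - s) φ) c := by
  refine ((hasMellinInv_upperGammaNat hn hc).mulConv measurableSet_Ioi (Ioi_subset_Ioi hφ.le)
    (integrableOn_pow_mul_exp_neg_mul_rpow_Ioi (m - 1) c hφ)).congr (fun s hs => ?_) fun x hx => rfl
  rw [integral_pow_mul_exp_neg_mul_cpow_Ioi hm s hφ]

lemma hasMellinInv_tailLowerGammaIntegral {n m : ℕ} (hn : 0 < n) (hm : 0 < m) {φ : ℝ} (hφ : 0 < φ)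
    {c : ℝ} (hc : -(n : ℝ) < c) (hc0 : c < 0) :
    HasMellinInv (tailLowerGammaIntegral n m φ)
      (fun s => Complex.Gamma (n + s) * (-1 / s) * upperGamma (m - s) φ) c := by
  refine ((hasMellinInv_lowerGammaNat hn hc hc0).mulConv measurableSet_Ioi (Ioi_subset_Ioi hφ.le)
    (integrableOn_pow_mul_exp_neg_mul_rpow_Ioi (m - 1) c hφ)).congr (fun s hs => ?_) fun x hx => rfl
  rw [integral_pow_mul_exp_neg_mul_cpow_Ioi hm s hφ]

lemma hasMellinInv_expLowerGammaIntegral {n l : ℕ} (hn : 0 < n)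
    {c : ℝ} (hc : -(n : ℝ) < c) (hc0 : c < 0) :
    HasMellinInv (expLowerGammaIntegral n l)
      (fun s => Complex.Gamma (n + s) * (-1 / s) * Complex.Gamma (l + 1 - s)) c := by
  have hl : c < l + 1 := by have : (0 : ℝ) ≤ l := l.cast_nonneg; linarith
  refine ((hasMellinInv_lowerGammaNat hn hc hc0).mulConv measurableSet_Ioi subset_rfl
    (integrableOn_pow_mul_exp_neg_mul_rpow l hl)).congr (fun s hs => ?_) fun x hx => rfl
  rw [integral_pow_mul_exp_neg_mul_cpow l (by rwa [hs])]

theorem meijerG_ratio {n : ℕ} (hn : 0 < n) (l : ℕ) {z : ℝ} (hz : 0 < z) :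
    (RelayNet.paramsG n l).WellDefined z ∧
      (RelayNet.paramsG n l).G z = expLowerGammaIntegral n l z := by
  have hn1 : (1 : ℝ) ≤ n := by exact_mod_cast hn
  have hl0 : (0 : ℝ) ≤ l := l.cast_nonneg
  have hsep (c : ℝ) : (RelayNet.paramsG n l).Separates c ↔ -(n : ℝ) < c ∧ c < 1 + l ∧ c < 0 := by
    simp [RelayNet.paramsG, MeijerParams.ordinary, MeijerParams.Separates]
  -- The strip is -n < Re s < 0, and n ≥ 1 puts -1/2 inside it.
  refine MeijerParams.wellDefined_and_G_eq ⟨-1 / 2, (hsep _).2 ⟨by linarith, by linarith, by norm_num⟩⟩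
    (fun c hc => hasMellinInv_expLowerGammaIntegral hn ((hsep c).1 hc).1 ((hsep c).1 hc).2.2)
    (fun c hc s hs z => ?_) hz
  have h0 : s.re < 0 := by rw [hs]; exact ((hsep c).1 hc).2.2
  simp only [MeijerParams.kernel, RelayNet.paramsG, MeijerParams.ordinary, List.map_cons,
    List.map_nil, List.prod_cons, List.prod_nil, upperGamma_zero_right]
  rw [← Gamma_neg_div_Gamma_one_sub h0]
  ring_nf

/-- Here Γ(s)/Γ(1+s) = 1/s, so the integral is a tail convolution of Γ(n, ·). Since φ > 0, the
factor Γ(m-s, φ) imposes no right-hand bound: every c > 0 separates. -/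
theorem meijerG_tail_upper {n m : ℕ} (hn : 0 < n) (hm : 0 < m) {φ : ℝ} (hφ : 0 < φ) {z : ℝ}
    (hz : 0 < z) {p : MeijerParams}
    (hp : p = ⟨[(1 - (m : ℂ), φ)], [(1, 0)], [(0, 0), ((n : ℂ), 0)], []⟩) :
    p.WellDefined z ∧ p.G z = tailUpperGammaIntegral n m φ z := by
  have hn1 : (1 : ℝ) ≤ n := by exact_mod_cast hn
  have hsep (c : ℝ) : p.Separates c ↔ 0 < c ∧ -(n : ℝ) < c := by
    simp [hp, MeijerParams.Separates, hφ.ne']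
  refine MeijerParams.wellDefined_and_G_eq ⟨1, (hsep _).2 ⟨by linarith, by linarith⟩⟩
    (fun c hc => hasMellinInv_tailUpperGammaIntegral hn hm hφ ((hsep c).1 hc).1)
    (fun c hc s hs z => ?_) hz
  have h0 : 0 < s.re := by rw [hs]; exact ((hsep c).1 hc).1
  have hs0 : s ≠ 0 := fun h => by simp [h] at h0
  have hG := Complex.Gamma_ne_zero_of_re_pos h0
  simp only [MeijerParams.kernel, hp, List.map_cons,
    List.map_nil, List.prod_cons, List.prod_nil, upperGamma_zero_right, mul_one, zero_add]
  rw [add_comm 1 s, Complex.Gamma_add_one _ hs0, show (1 : ℂ) - (1 - m) - s = m - s by ring]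
  field_simp

theorem meijerG_beta {n h μ : ℕ} (hn : 0 < n) (hμ : 0 < μ) {z : ℝ} (hz : 0 < z) {p : MeijerParams}
    (hp : p = .ordinary [-(h : ℂ), 1] [] [(μ : ℂ), (n : ℂ)] [0]) :
    p.WellDefined z ∧ p.G z = betaTransform h (μ + h + 1) (lowerGammaNat n) z := by
  have hn1 : (1 : ℝ) ≤ n := by exact_mod_cast hn
  have hμ1 : (1 : ℝ) ≤ μ := by exact_mod_cast hμ
  have hh : (0 : ℝ) ≤ h := h.cast_nonneg
  have hsep (c : ℝ) : p.Separates c ↔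
      (-(μ : ℝ) < c ∧ -(n : ℝ) < c) ∧ c < 1 + h ∧ c < 0 := by
    simp [hp, MeijerParams.ordinary, MeijerParams.Separates]
  refine MeijerParams.wellDefined_and_G_eq ⟨-1 / 2,
      (hsep _).2 ⟨⟨by linarith, by linarith⟩, by linarith, by norm_num⟩⟩
    (fun c hc => (hasMellinInv_lowerGammaNat hn ((hsep c).1 hc).1.2
      ((hsep c).1 hc).2.2).betaTransform (by linarith [((hsep c).1 hc).2.1]) ((hsep c).1 hc).1.1)
    (fun c hc s hs z => ?_) hz
  have h0 : s.re < 0 := by rw [hs]; exact ((hsep c).1 hc).2.2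
  simp only [MeijerParams.kernel, hp, MeijerParams.ordinary, List.map_cons,
    List.map_nil, List.prod_cons, List.prod_nil, upperGamma_zero_right]
  rw [← Gamma_neg_div_Gamma_one_sub h0]
  ring_nf

/-- Two successive convolutions of γ(n, ·): with the tail weight t^(m-1) e^(-t) on (φ, ∞), then with
the beta kernel. The incomplete factor is pole-free, so only the complete Gamma factors restrict c.
-/
theorem meijerG_beta_tail_lower {n m h μ : ℕ} (hn : 0 < n) (hm : 0 < m) (hμ : 0 < μ) {φ : ℝ}
    (hφ : 0 < φ) {z : ℝ} (hz : 0 < z) {p : MeijerParams}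
    (hp : p = ⟨[(1 - (m : ℂ), φ), (1, 0), (-(h : ℂ), 0)], [], [((n : ℂ), 0), ((μ : ℂ), 0)],
      [(0, 0)]⟩) :
    p.WellDefined z ∧ p.G z = betaTransform h (μ + h + 1) (tailLowerGammaIntegral n m φ) z := by
  have hn1 : (1 : ℝ) ≤ n := by exact_mod_cast hn
  have hμ1 : (1 : ℝ) ≤ μ := by exact_mod_cast hμ
  have hh : (0 : ℝ) ≤ h := h.cast_nonneg
  have hsep (c : ℝ) : p.Separates c ↔
      (-(n : ℝ) < c ∧ -(μ : ℝ) < c) ∧ c < 0 ∧ c < 1 + h := by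
    simp [hp, MeijerParams.Separates, hφ.ne']
  refine MeijerParams.wellDefined_and_G_eq ⟨-1 / 2,
      (hsep _).2 ⟨⟨by linarith, by linarith⟩, by norm_num, by linarith⟩⟩
    (fun c hc => (hasMellinInv_tailLowerGammaIntegral hn hm hφ ((hsep c).1 hc).1.1
      ((hsep c).1 hc).2.1).betaTransform (by linarith [((hsep c).1 hc).2.2]) ((hsep c).1 hc).1.2)
    (fun c hc s hs z => ?_) hz
  have h0 : s.re < 0 := by rw [hs]; exact ((hsep c).1 hc).2.1
  simp only [MeijerParams.kernel, hp, List.map_cons,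
    List.map_nil, List.prod_cons, List.prod_nil, upperGamma_zero_right]
  rw [← Gamma_neg_div_Gamma_one_sub h0]
  ring_nf

end MeijerIntegrals

/-! ### Gamma laws of the channel gains -/

section GammaLaws

open Set

lemma lintegral_comp_div_pos {z : ℝ} (hz : 0 < z) (f : ℝ → ENNReal) :
    ∫⁻ x, f (x / z) = ENNReal.ofReal z * ∫⁻ x, f x := by
  have := lintegral_image_eq_lintegral_abs_deriv_mul (s := univ) (f := fun x : ℝ => z * x)
    (f' := fun _ => z) MeasurableSet.univ
    (fun x _ => (hasDerivAt_const_mul z).hasDerivWithinAt)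
    (fun x _ y _ h => mul_left_cancel₀ hz.ne' h) (fun x => f (x / z))
  have himg : (fun x : ℝ => z * x) '' univ = univ := by
    rw [image_univ]
    exact (mul_left_surjective₀ hz.ne').range_eq
  simp only [himg, Measure.restrict_univ, mul_div_cancel_left₀ _ hz.ne', abs_of_pos hz] at this
  rw [this, lintegral_const_mul' _ _ ENNReal.ofReal_ne_top]

/-- For independent Gamma variables with a common rate, the sum and the ratio x/z are independent,
the ratio being beta distributed. In density form this lets `lintegral_betaPDF_eq_one` evaluate the
convolution. The endpoints x = 0 and x = z form a null set and are left out. -/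
lemma gammaPDF_mul_gammaPDF_sub {a b r x z : ℝ} (ha : 0 < a) (hb : 0 < b) (hr : 0 < r)
    (hz : 0 < z) (hx : x ≠ 0) (hxz : x ≠ z) :
    gammaPDF a r x * gammaPDF b r (z - x) =
      gammaPDF (a + b) r z * ENNReal.ofReal z⁻¹ * betaPDF a b (x / z) := by
  rcases lt_or_gt_of_ne hx with h | h
  · rw [gammaPDF_of_neg h, betaPDF_eq_zero_of_nonpos (div_nonpos_of_nonpos_of_nonneg h.le hz.le)]
    simp
  rcases lt_or_gt_of_ne hxz with h' | h'
  · have h1 : x / z < 1 := (div_lt_one hz).2 h'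
    have h2 : 0 < z - x := sub_pos.2 h'
    rw [gammaPDF_of_nonneg h.le, gammaPDF_of_nonneg h2.le, gammaPDF_of_nonneg hz.le,
      betaPDF_of_pos_lt_one (div_pos h hz) h1, ← ENNReal.ofReal_mul (by positivity),
      ← ENNReal.ofReal_mul (by positivity), ← ENNReal.ofReal_mul (by positivity)]
    congr 1
    have e1 : 1 - x / z = (z - x) / z := by field_simp
    have e2 : Real.exp (-(r * z)) = Real.exp (-(r * x)) * Real.exp (-(r * (z - x))) := by
      rw [← Real.exp_add]; ring_nf
    have e3 : z ^ (a + b - 1) = z ^ (a - 1) * z ^ (b - 1) * z := by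
      rw [← Real.rpow_add hz, ← Real.rpow_add_one hz.ne']; ring_nf
    have hA := (Real.rpow_pos_of_pos hz (a - 1)).ne'
    have hB := (Real.rpow_pos_of_pos hz (b - 1)).ne'
    have hGa := (Real.Gamma_pos_of_pos ha).ne'
    have hGb := (Real.Gamma_pos_of_pos hb).ne'
    have hGab := (Real.Gamma_pos_of_pos (add_pos ha hb)).ne'
    rw [e1, e2, e3, Real.div_rpow h.le hz.le, Real.div_rpow h2.le hz.le, Real.rpow_add hr, beta]
    field_simp
  · rw [gammaPDF_of_neg (by linarith : z - x < 0),
      betaPDF_eq_zero_of_one_le ((one_le_div hz).2 h'.le)]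
    simp

lemma measurable_gammaPDF (a r : ℝ) : Measurable (gammaPDF a r) :=
  (measurable_gammaPDFReal a r).ennreal_ofReal

lemma lintegral_gammaPDF_mul_gammaPDF_sub {a b r z : ℝ} (ha : 0 < a) (hb : 0 < b) (hr : 0 < r)
    (hz : z ≠ 0) :
    ∫⁻ x, gammaPDF a r x * gammaPDF b r (z - x) = gammaPDF (a + b) r z := by
  rcases lt_or_gt_of_ne hz with h | h
  · rw [gammaPDF_of_neg h, ← lintegral_zero (μ := (volume : Measure ℝ))]
    refine lintegral_congr fun x => ?_
    rcases lt_or_ge x 0 with hx | hx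
    · simp [gammaPDF_of_neg hx]
    · simp [gammaPDF_of_neg (by linarith : z - x < 0)]
  · have hae : ∀ᵐ x : ℝ, gammaPDF a r x * gammaPDF b r (z - x) =
        gammaPDF (a + b) r z * ENNReal.ofReal z⁻¹ * betaPDF a b (x / z) := by
      filter_upwards [Measure.ae_ne volume 0, Measure.ae_ne volume z] with x h0 hxz
      exact gammaPDF_mul_gammaPDF_sub ha hb hr h h0 hxz
    rw [lintegral_congr_ae hae, lintegral_const_mul' _ _ (by simp [gammaPDF, ENNReal.mul_eq_top]),
      lintegral_comp_div_pos h, lintegral_betaPDF_eq_one ha hb, mul_one, mul_assoc,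
      ← ENNReal.ofReal_mul (by positivity), inv_mul_cancel₀ h.ne', ENNReal.ofReal_one, mul_one]

lemma gammaMeasure_conv_gammaMeasure {a b r : ℝ} (ha : 0 < a) (hb : 0 < b) (hr : 0 < r) :
    (gammaMeasure a r).conv (gammaMeasure b r) = gammaMeasure (a + b) r := by
  have := isProbabilityMeasure_gammaMeasure ha hr
  have := isProbabilityMeasure_gammaMeasure hb hr
  refine Measure.ext_of_lintegral _ fun f hf => ?_
  have hm1 := measurable_gammaPDF a r
  have hm2 := measurable_gammaPDF b r
  rw [Measure.lintegral_conv hf]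
  simp only [gammaMeasure]
  rw [lintegral_withDensity_eq_lintegral_mul _ hm1
    (by fun_prop), lintegral_withDensity_eq_lintegral_mul _ (measurable_gammaPDF _ r) hf]
  have e (x : ℝ) : ∫⁻ y, f (x + y) ∂volume.withDensity (gammaPDF b r) =
      ∫⁻ z, gammaPDF b r (z - x) * f z := by
    rw [lintegral_withDensity_eq_lintegral_mul _ hm2 (by fun_prop),
      ← lintegral_add_left_eq_self (fun z => gammaPDF b r (z - x) * f z) x]
    simp
  simp only [Pi.mul_apply, e]
  have e2 (x : ℝ) : gammaPDF a r x * ∫⁻ z, gammaPDF b r (z - x) * f z =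
      ∫⁻ z, gammaPDF a r x * (gammaPDF b r (z - x) * f z) :=
    (lintegral_const_mul _ (by fun_prop)).symm
  simp only [e2]
  rw [lintegral_lintegral_swap (by fun_prop)]
  refine lintegral_congr_ae ?_
  filter_upwards [Measure.ae_ne volume 0] with z hz
  rw [← lintegral_gammaPDF_mul_gammaPDF_sub ha hb hr hz, ← lintegral_mul_const _ (by fun_prop)]
  simp only [mul_assoc]

lemma map_sum_gamma {ι Ω : Type*} [MeasurableSpace Ω] {P : Measure Ω} [IsProbabilityMeasure P]
    {X : ι → Ω → ℝ} (hX : ∀ i, Measurable (X i)) (hind : iIndepFun X P) {s : Finset ι}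
    (hs : s.Nonempty) {a r : ℝ} (ha : 0 < a) (hr : 0 < r)
    (hlaw : ∀ i ∈ s, P.map (X i) = gammaMeasure a r) :
    P.map (∑ i ∈ s, X i) = gammaMeasure (s.card * a) r := by
  induction hs using Finset.Nonempty.cons_induction with
  | singleton i => simpa using hlaw i
  | cons i t hi ht ih =>
    have hti := hind.indepFun_finsetSum_of_notMem hX hi
    have hpos : 0 < (t.card : ℝ) := by exact_mod_cast ht.card_pos
    rw [Finset.sum_cons, add_comm, hti.map_add_eq_map_conv_map (by fun_prop) (hX i),
      ih fun j hj => hlaw j (Finset.mem_cons_of_mem hj), hlaw i (Finset.mem_cons_self i t),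
      gammaMeasure_conv_gammaMeasure (by positivity) ha hr, Finset.card_cons]
    congr 1
    push_cast
    ring

lemma lintegral_eq_setLIntegral_Ioi_of_neg {f : ℝ → ENNReal} (hf : ∀ x < 0, f x = 0) :
    ∫⁻ x, f x = ∫⁻ x in Ioi 0, f x := by
  rw [← lintegral_indicator measurableSet_Ioi]
  refine lintegral_congr_ae ?_
  filter_upwards [Measure.ae_ne volume 0] with x hx
  rcases lt_or_gt_of_ne hx with h | h
  · simp [hf x h, h.le]
  · simp [h]

/-- Change of variables y = r² on the positive half-line, where the Nakagami density lives; the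
Gamma rate comes out as m/w. -/
lemma nakagamiMeasure_map_sq {m w : ℝ} (hm : 0 < m) (hw : 0 < w) :
    (nakagamiMeasure m w).map (fun r => |r| ^ 2) = gammaMeasure m (m / w) := by
  have hmeas : Measurable (nakagamiPDF m w) :=
    Measurable.ite measurableSet_Ici (by fun_prop) measurable_const
  refine Measure.ext_of_lintegral _ fun f hf => ?_
  have hsq : Measurable fun r : ℝ => |r| ^ 2 := by fun_prop
  rw [lintegral_map hf hsq, nakagamiMeasure, gammaMeasure,
    lintegral_withDensity_eq_lintegral_mul _ hmeas.ennreal_ofReal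
      (g := fun r => f (|r| ^ 2)) (hf.comp hsq),
    lintegral_withDensity_eq_lintegral_mul _ (measurable_gammaPDF _ _) hf,
    lintegral_eq_setLIntegral_Ioi_of_neg, lintegral_eq_setLIntegral_Ioi_of_neg]
  · have himg : (fun r : ℝ => r ^ 2) '' Ioi 0 = Ioi 0 := by
      ext y
      constructor
      · rintro ⟨x, hx, rfl⟩
        exact pow_pos (show (0 : ℝ) < x from hx) 2
      · intro hy
        exact ⟨√y, Real.sqrt_pos.2 hy, Real.sq_sqrt (le_of_lt hy)⟩
    have := lintegral_image_eq_lintegral_abs_deriv_mul (s := Ioi 0) (f := fun r : ℝ => r ^ 2)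
      (f' := fun r => 2 * r) measurableSet_Ioi
      (fun x _ => by simpa using (hasDerivAt_pow 2 x).hasDerivWithinAt)
      (fun x hx y hy h => (sq_eq_sq₀ (le_of_lt hx) (le_of_lt hy)).1 h)
      (gammaPDF m (m / w) * f)
    rw [himg] at this
    rw [this]
    refine setLIntegral_congr_fun measurableSet_Ioi fun r hr => ?_
    have hr : (0 : ℝ) < r := hr
    simp only [Pi.mul_apply, sq_abs]
    rw [gammaPDF_of_nonneg (sq_nonneg r), ← mul_assoc, ← ENNReal.ofReal_mul (by positivity),
      nakagamiPDF, if_pos hr.le]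
    congr 2
    rw [abs_of_pos (by positivity), Real.div_rpow hm.le hw.le, ← Real.rpow_natCast r 2,
      ← Real.rpow_mul hr.le, show 2 * m - 1 = (2 : ℕ) * (m - 1) + 1 by push_cast; ring,
      Real.rpow_add_one hr.ne', neg_mul]
    have := (Real.rpow_pos_of_pos hw m).ne'
    have := (Real.Gamma_pos_of_pos hm).ne'
    field_simp
  · intro x hx
    simp [gammaPDF_of_neg hx]
  · intro x hx
    simp [nakagamiPDF, hx.not_ge]

end GammaLaws

/-! ### Splitting, bounds and measurability of incomplete Gamma functions -/

section IncompleteGammaBounds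

open Set

lemma setIntegral_Ioi_comp_affine (g : ℝ → ℝ) (A u : ℝ) {κ : ℝ} (hκ : 0 < κ) :
    ∫ s in Ioi (A + κ * u), g s = κ * ∫ t in Ioi u, g (A + κ * t) := by
  have himg : (fun t : ℝ => A + κ * t) '' Ioi u = Ioi (A + κ * u) := by
    ext y
    constructor
    · rintro ⟨t, ht, rfl⟩
      have ht : u < t := ht
      simp only [mem_Ioi]
      gcongr
    · intro hy
      have hy : A + κ * u < y := hy
      refine ⟨(y - A) / κ, ?_, by field_simp; ring⟩
      rw [mem_Ioi, lt_div_iff₀ hκ]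
      linarith
  rw [← himg, integral_image_eq_integral_abs_deriv_smul measurableSet_Ioi (f' := fun _ => κ)
    (fun t _ => ((hasDerivAt_const_mul κ).const_add A).hasDerivWithinAt)
    (fun x _ y _ h => mul_left_cancel₀ hκ.ne' (add_left_cancel h))]
  simp only [abs_of_pos hκ, smul_eq_mul]
  exact integral_const_mul _ _

lemma integrableOn_pow_mul_exp_neg_Ioi (n : ℕ) {x : ℝ} (hx : 0 ≤ x) :
    IntegrableOn (fun t : ℝ => t ^ n * Real.exp (-t)) (Ioi x) :=
  (integrableOn_pow_mul_exp_neg n).mono_set (Ioi_subset_Ioi hx)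

lemma lowerGammaNat_add_upperGammaNat {n : ℕ} (hn : 0 < n) {x : ℝ} (hx : 0 ≤ x) :
    lowerGammaNat n x + upperGammaNat n x = Real.Gamma n := by
  rw [← upperGammaNat_zero hn, lowerGammaNat, upperGammaNat, upperGammaNat,
    ← setIntegral_union Ioc_disjoint_Ioi_same measurableSet_Ioi
      ((integrableOn_pow_mul_exp_neg _).mono_set Ioc_subset_Ioi_self)
      (integrableOn_pow_mul_exp_neg_Ioi _ hx), Ioc_union_Ioi_eq_Ioi hx]

lemma upperGammaNat_nonneg (n : ℕ) {x : ℝ} (hx : 0 ≤ x) : 0 ≤ upperGammaNat n x :=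
  setIntegral_nonneg measurableSet_Ioi fun t ht => by
    have : 0 ≤ t := hx.trans (le_of_lt ht)
    positivity

lemma lowerGammaNat_nonneg (n : ℕ) (x : ℝ) : 0 ≤ lowerGammaNat n x :=
  setIntegral_nonneg measurableSet_Ioc fun t ht => by
    have : 0 ≤ t := le_of_lt ht.1
    positivity

lemma upperGammaNat_le {n : ℕ} (hn : 0 < n) {x : ℝ} (hx : 0 ≤ x) :
    upperGammaNat n x ≤ Real.Gamma n := by
  linarith [lowerGammaNat_add_upperGammaNat hn hx, lowerGammaNat_nonneg n x]

lemma lowerGammaNat_le {n : ℕ} (hn : 0 < n) {x : ℝ} (hx : 0 ≤ x) :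
    lowerGammaNat n x ≤ Real.Gamma n := by
  linarith [lowerGammaNat_add_upperGammaNat hn hx, upperGammaNat_nonneg n hx]

lemma continuous_lowerGammaNat (n : ℕ) : Continuous (lowerGammaNat n) := by
  have hc : Continuous fun x : ℝ => ∫ t in (0 : ℝ)..x, t ^ (n - 1) * Real.exp (-t) :=
    intervalIntegral.continuous_primitive
      (fun a b => Continuous.intervalIntegrable (by fun_prop) a b) 0
  -- For x ≤ 0 the set `Ioc 0 x` is empty, while an interval integral would be oriented; the maximum
  -- reconciles the two.
  have : lowerGammaNat n = fun x => ∫ t in (0 : ℝ)..max x 0, t ^ (n - 1) * Real.exp (-t) := by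
    ext x
    rw [intervalIntegral.integral_of_le (le_max_right _ _), lowerGammaNat]
    rcases le_total x 0 with h | h
    · simp [h]
    · rw [max_eq_left h]
  rw [this]
  exact hc.comp (continuous_id.max continuous_const)

lemma measurable_lowerGammaNat (n : ℕ) : Measurable (lowerGammaNat n) :=
  (continuous_lowerGammaNat n).measurable

lemma measurable_upperGammaNat (n : ℕ) : Measurable (upperGammaNat n) := by
  have h : Measurable fun p : ℝ × ℝ => p.2 ^ (n - 1) * Real.exp (-p.2) := by fun_prop
  have h' : StronglyMeasurable
      fun p : ℝ × ℝ => {q : ℝ × ℝ | q.1 < q.2}.indicator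
        (fun p => p.2 ^ (n - 1) * Real.exp (-p.2)) p :=
    (h.indicator (measurableSet_lt measurable_fst measurable_snd)).stronglyMeasurable
  have := (StronglyMeasurable.integral_prod_right' (ν := volume) h').measurable
  convert! this using 2 with x
  rw [upperGammaNat, ← integral_indicator measurableSet_Ioi]
  rfl

end IncompleteGammaBounds

/-! ### Expectations against Gamma laws and conditioning -/

section GammaExpectations

open Set

/-- Rescaling t = rx to unit rate makes tails of the law literally incomplete Gamma functions. -/
lemma integral_gammaMeasure {n : ℕ} (hn : 0 < n) {r : ℝ} (hr : 0 < r) (g : ℝ → ℝ) :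
    ∫ x, g x ∂gammaMeasure n r =
      (∫ t in Ioi 0, t ^ (n - 1) * Real.exp (-t) * g (t / r)) / Real.Gamma n := by
  have hn' : (0 : ℝ) < n := by exact_mod_cast hn
  have hG := (Real.Gamma_pos_of_pos hn').ne'
  rw [gammaMeasure, integral_withDensity_eq_integral_toReal_smul (measurable_gammaPDF _ _)
    (.of_forall fun x => ENNReal.ofReal_lt_top)]
  have h1 : ∫ x, (gammaPDF n r x).toReal • g x =
      ∫ x in Ioi 0, r * ((r * x) ^ (n - 1) * Real.exp (-(r * x)) * g x) / Real.Gamma n := by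
    rw [← integral_indicator measurableSet_Ioi]
    refine integral_congr_ae ?_
    filter_upwards [Measure.ae_ne volume 0] with x hx
    rcases lt_or_gt_of_ne hx with h | h
    · simp [gammaPDF_of_neg h, h.le]
    · rw [gammaPDF_of_nonneg h.le, ENNReal.toReal_ofReal (by positivity),
        indicator_of_mem (by exact h), Real.rpow_natCast, ← natCast_sub_one_add_one hn,
        Real.rpow_natCast, smul_eq_mul]
      obtain ⟨k, rfl⟩ := Nat.exists_eq_succ_of_ne_zero hn.ne'
      simp only [Nat.succ_eq_add_one, Nat.add_sub_cancel]
      rw [mul_pow]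
      field_simp
      ring
  rw [h1, integral_div, integral_const_mul]
  have := setIntegral_Ioi_comp_affine (fun t => t ^ (n - 1) * Real.exp (-t) * g (t / r)) 0 0 hr
  simp only [zero_add, mul_zero, mul_div_cancel_left₀ _ hr.ne'] at this
  rw [this]

lemma gammaMeasure_real_Ici {n : ℕ} (hn : 0 < n) {r : ℝ} (hr : 0 < r) {a : ℝ} (ha : 0 ≤ a) :
    (gammaMeasure n r).real (Ici a) = upperGammaNat n (r * a) / Real.Gamma n := by
  rw [← integral_indicator_one measurableSet_Ici, integral_gammaMeasure hn hr, upperGammaNat,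
    ← integral_Ici_eq_integral_Ioi, ← integral_Ici_eq_integral_Ioi (x := r * a),
    ← integral_indicator measurableSet_Ici, ← integral_indicator measurableSet_Ici]
  congr 2
  ext t
  by_cases h : r * a ≤ t
  · have h0 : 0 ≤ t := le_trans (by positivity) h
    have h1 : a ≤ t / r := by rw [le_div_iff₀ hr]; linarith
    simp [h, h0, h1]
  · have h1 : ¬ a ≤ t / r := by rw [le_div_iff₀ hr]; rwa [mul_comm]
    simp [h, h1, indicator]

lemma gammaMeasure_real_Iio {n : ℕ} (hn : 0 < n) {r : ℝ} (hr : 0 < r) {a : ℝ} (ha : 0 ≤ a) :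
    (gammaMeasure n r).real (Iio a) = lowerGammaNat n (r * a) / Real.Gamma n := by
  have hn' : (0 : ℝ) < n := by exact_mod_cast hn
  have := isProbabilityMeasure_gammaMeasure hn' hr
  have hG := (Real.Gamma_pos_of_pos hn').ne'
  rw [← compl_Ici, probReal_compl_eq_one_sub measurableSet_Ici, gammaMeasure_real_Ici hn hr ha,
    ← lowerGammaNat_add_upperGammaNat hn (mul_nonneg hr.le ha)] at *
  field_simp
  ring

variable {Ω : Type*} [MeasurableSpace Ω] {P : Measure Ω} [IsProbabilityMeasure P]

/-- Conditioning on V: the joint law is a product, and Fubini evaluates the sections. -/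
lemma IndepFun.measureReal_eq_integral {V X : Ω → ℝ} (hV : Measurable V) (hX : Measurable X)
    (h : IndepFun V X P) {s : Set (ℝ × ℝ)} (hs : MeasurableSet s) :
    P.real {ω | (V ω, X ω) ∈ s} = ∫ ω, (P.map X).real {x | (V ω, x) ∈ s} ∂P := by
  have := Measure.isProbabilityMeasure_map (μ := P) hX.aemeasurable
  have h1 : P {ω | (V ω, X ω) ∈ s} = ∫⁻ ω, P.map X {x | (V ω, x) ∈ s} ∂P := by
    have e : {ω | (V ω, X ω) ∈ s} = (fun ω => (V ω, X ω)) ⁻¹' s := rfl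
    rw [e, ← Measure.map_apply (hV.prodMk hX) hs,
      (indepFun_iff_map_prod_eq_prod_map_map hV.aemeasurable hX.aemeasurable).1 h,
      Measure.prod_apply hs, lintegral_map (measurable_measure_prodMk_left hs) hV]
    rfl
  rw [measureReal_def, h1]
  symm
  refine integral_toReal ((measurable_measure_prodMk_left hs).comp hV).aemeasurable
    (.of_forall fun ω => ?_)
  exact measure_lt_top _ _

lemma measureReal_le_gamma {V X : Ω → ℝ} (hV : Measurable V) (hX : Measurable X)
    (h : IndepFun V X P) (hV0 : ∀ ω, 0 ≤ V ω) {n : ℕ} (hn : 0 < n) {r : ℝ} (hr : 0 < r)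
    (hlaw : P.map X = gammaMeasure n r) :
    P.real {ω | V ω ≤ X ω} = (∫ ω, upperGammaNat n (r * V ω) ∂P) / Real.Gamma n := by
  have := IndepFun.measureReal_eq_integral hV hX h
    (measurableSet_le measurable_fst measurable_snd)
  simp only [mem_ofPred_eq] at this
  rw [this, ← integral_div]
  refine integral_congr_ae (.of_forall fun ω => ?_)
  simp only
  rw [hlaw]
  exact gammaMeasure_real_Ici hn hr (hV0 ω)

lemma measureReal_gamma_lt {V X : Ω → ℝ} (hV : Measurable V) (hX : Measurable X)
    (h : IndepFun V X P) (hV0 : ∀ ω, 0 ≤ V ω) {n : ℕ} (hn : 0 < n) {r : ℝ} (hr : 0 < r)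
    (hlaw : P.map X = gammaMeasure n r) :
    P.real {ω | X ω < V ω} = (∫ ω, lowerGammaNat n (r * V ω) ∂P) / Real.Gamma n := by
  have := IndepFun.measureReal_eq_integral hV hX h
    (measurableSet_lt measurable_snd measurable_fst)
  simp only [mem_ofPred_eq] at this
  rw [this, ← integral_div]
  refine integral_congr_ae (.of_forall fun ω => ?_)
  simp only
  rw [hlaw]
  exact gammaMeasure_real_Iio hn hr (hV0 ω)

/-- A layer-cake identity: exchanging expectation and integral replaces the random lower limit by
the distribution function of U. Nonnegativity of U keeps the range inside (0, ∞). -/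
lemma integral_setIntegral_Ioi {U : Ω → ℝ} (hU : Measurable U) (hU0 : ∀ ω, 0 ≤ U ω) {g : ℝ → ℝ}
    (hg : IntegrableOn g (Ioi 0)) :
    ∫ ω, (∫ t in Ioi (U ω), g t) ∂P = ∫ t in Ioi 0, g t * P.real {ω | U ω < t} := by
  have e1 (ω : Ω) : ∫ t in Ioi (U ω), g t =
      ∫ t in Ioi 0, {p : Ω × ℝ | U p.1 < p.2}.indicator (fun p => g p.2) (ω, t) := by
    rw [← integral_indicator measurableSet_Ioi, ← integral_indicator measurableSet_Ioi]
    congr 1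
    ext t
    by_cases h : U ω < t
    · have : 0 < t := (hU0 ω).trans_lt h
      simp [h, this]
    · simp [h, indicator]
  simp only [e1]
  have hint : Integrable ({p : Ω × ℝ | U p.1 < p.2}.indicator fun p => g p.2)
      (P.prod (volume.restrict (Ioi 0))) :=
    (hg.comp_snd P).indicator (measurableSet_lt (by fun_prop) (by fun_prop))
  rw [integral_integral_swap (f := fun ω t => {p : Ω × ℝ | U p.1 < p.2}.indicator
    (fun p => g p.2) (ω, t)) hint]
  congr 1
  ext t
  have hm : MeasurableSet {ω | U ω < t} := measurableSet_lt hU measurable_const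
  have : (fun ω => {p : Ω × ℝ | U p.1 < p.2}.indicator (fun p => g p.2) (ω, t)) =
      {ω | U ω < t}.indicator fun _ => g t := rfl
  rw [this, integral_indicator_const _ hm, smul_eq_mul, mul_comm]

end GammaExpectations

/-! ### The non-outage probability of one hop -/

section Hop

open Set

variable {Ω : Type*} [MeasurableSpace Ω] {P : Measure Ω} [IsProbabilityMeasure P]

lemma integrableOn_Ioi_comp_affine {g : ℝ → ℝ} {A u κ : ℝ} (hκ : 0 < κ)
    (hg : IntegrableOn g (Ioi (A + κ * u))) : IntegrableOn (fun t => g (A + κ * t)) (Ioi u) := by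
  have h1 : IntegrableOn (fun t => g (A + t)) (Ioi (κ * u)) := by
    have := (measurePreserving_add_left (volume : Measure ℝ) A).integrableOn_comp_preimage
      (measurableEmbedding_addLeft A) (f := g) (s := Ioi (A + κ * u))
    rw [show (fun t => A + t) ⁻¹' Ioi (A + κ * u) = Ioi (κ * u) by simp] at this
    exact this.2 hg
  exact (integrableOn_Ioi_comp_mul_left_iff (fun t => g (A + t)) u hκ).2 h1

/-- Shift t to A + t and expand (A + t)^(n-1), which is possible because n is an integer. Each term
is a function of A times a function of x, so independence can act on the expectation. -/
lemma upperGammaNat_add {n : ℕ} (hn : 0 < n) (A : ℝ) {x : ℝ} (hx : 0 ≤ x) :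
    upperGammaNat n (A + x) = ∑ l ∈ Finset.range n, (n - 1).choose l *
      (A ^ (n - 1 - l) * Real.exp (-A)) * upperGammaNat (l + 1) x := by
  have h := setIntegral_Ioi_comp_affine (fun t => t ^ (n - 1) * Real.exp (-t)) A x one_pos
  simp only [one_mul] at h
  rw [upperGammaNat, h]
  have e (t : ℝ) : (A + t) ^ (n - 1) * Real.exp (-(A + t)) = ∑ l ∈ Finset.range n,
      (n - 1).choose l * (A ^ (n - 1 - l) * Real.exp (-A)) * (t ^ l * Real.exp (-t)) := by
    rw [add_comm A t, add_pow, Nat.sub_add_cancel hn, Finset.sum_mul]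
    refine Finset.sum_congr rfl fun l _ => ?_
    rw [neg_add, Real.exp_add]
    ring
  simp only [e]
  rw [integral_finsetSum]
  · refine Finset.sum_congr rfl fun l _ => ?_
    rw [integral_const_mul, upperGammaNat, Nat.add_sub_cancel]
  · exact fun l _ => (integrableOn_pow_mul_exp_neg_Ioi l hx).const_mul _

/-- A uniform bound, so that moments of the unbounded inverse power B against the exponential are
integrable without knowing its law. -/
lemma pow_mul_exp_neg_le {ξ : ℝ} (hξ : 0 < ξ) (k : ℕ) {b : ℝ} (hb : 0 ≤ b) :
    |b ^ k * Real.exp (-(ξ * b))| ≤ k.factorial / ξ ^ k := by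
  rw [abs_of_nonneg (by positivity), Real.exp_neg, ← div_eq_mul_inv, div_le_div_iff₀
    (Real.exp_pos _) (by positivity)]
  have := Real.pow_div_factorial_le_exp (x := ξ * b) (by positivity) k
  rw [div_le_iff₀ (by positivity), mul_pow] at this
  linarith

/-- The probability that the gain `X` of the main link reaches the level `(γ - 1) B + γ U` that is
needed for the secrecy rate `log₂ γ`. -/
lemma measureReal_hop {X B U : Ω → ℝ} (hX : Measurable X) (hB : Measurable B) (hU : Measurable U)
    (hB0 : ∀ ω, 0 ≤ B ω) (hU0 : ∀ ω, 0 ≤ U ω) (hBUX : IndepFun (fun ω => (B ω, U ω)) X P)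
    (hBU : IndepFun B U P) {n : ℕ} (hn : 0 < n) {r γ : ℝ} (hr : 0 < r) (hγ : 1 < γ)
    (hlaw : P.map X = gammaMeasure n r) :
    P.real {ω | (γ - 1) * B ω + γ * U ω ≤ X ω} =
      (∑ l ∈ Finset.range n, (n - 1).choose l * (r * (γ - 1)) ^ (n - 1 - l) *
        (∫ ω, B ω ^ (n - 1 - l) * Real.exp (-(r * (γ - 1) * B ω)) ∂P) *
        ∫ ω, upperGammaNat (l + 1) (r * γ * U ω) ∂P) / Real.Gamma n := by
  have hγ0 : 0 < γ - 1 := sub_pos.2 hγ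
  have hγ1 : 0 < γ := one_pos.trans hγ
  have hind : IndepFun (fun ω => (γ - 1) * B ω + γ * U ω) X P :=
    hBUX.comp (φ := fun p : ℝ × ℝ => (γ - 1) * p.1 + γ * p.2) (ψ := id) (by fun_prop) measurable_id
  rw [measureReal_le_gamma (by fun_prop) hX hind (fun ω => by
    have := hB0 ω; have := hU0 ω; positivity) hn hr hlaw]
  congr 1
  have e (ω : Ω) : upperGammaNat n (r * ((γ - 1) * B ω + γ * U ω)) = ∑ l ∈ Finset.range n,
      ((n - 1).choose l * (r * (γ - 1)) ^ (n - 1 - l)) *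
        ((B ω ^ (n - 1 - l) * Real.exp (-(r * (γ - 1) * B ω))) *
          upperGammaNat (l + 1) (r * γ * U ω)) := by
    have := hU0 ω
    rw [show r * ((γ - 1) * B ω + γ * U ω) = r * (γ - 1) * B ω + r * γ * U ω by ring,
      upperGammaNat_add hn _ (by positivity)]
    refine Finset.sum_congr rfl fun l _ => ?_
    rw [mul_pow _ (B ω)]
    ring
  have hm1 (k : ℕ) : Measurable fun b : ℝ => b ^ k * Real.exp (-(r * (γ - 1) * b)) := by fun_prop
  have hm2 (k : ℕ) : Measurable fun u : ℝ => upperGammaNat (k + 1) (r * γ * u) :=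
    (measurable_upperGammaNat _).comp (by fun_prop)
  have hind2 (l : ℕ) : IndepFun (fun ω => B ω ^ (n - 1 - l) * Real.exp (-(r * (γ - 1) * B ω)))
      (fun ω => upperGammaNat (l + 1) (r * γ * U ω)) P := hBU.comp (hm1 _) (hm2 _)
  have hi1 (l : ℕ) : Integrable
      (fun ω => B ω ^ (n - 1 - l) * Real.exp (-(r * (γ - 1) * B ω))) P :=
    .of_bound ((hm1 _).comp hB).aestronglyMeasurable _
      (.of_forall fun ω => pow_mul_exp_neg_le (by positivity) _ (hB0 ω))
  have hi2 (l : ℕ) : Integrable (fun ω => upperGammaNat (l + 1) (r * γ * U ω)) P := by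
    refine .of_bound ((hm2 _).comp hU).aestronglyMeasurable (Real.Gamma (l + 1 : ℕ))
      (.of_forall fun ω => ?_)
    have h0 : 0 ≤ r * γ * U ω := by have := hU0 ω; positivity
    rw [Real.norm_of_nonneg (upperGammaNat_nonneg _ h0)]
    exact upperGammaNat_le l.succ_pos h0
  simp only [e]
  have hi3 (l : ℕ) : Integrable (fun ω => (B ω ^ (n - 1 - l) *
      Real.exp (-(r * (γ - 1) * B ω))) * upperGammaNat (l + 1) (r * γ * U ω)) P :=
    (hind2 l).integrable_mul (hi1 l) (hi2 l)
  rw [integral_finsetSum _ fun l _ => (hi3 l).const_mul _]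
  refine Finset.sum_congr rfl fun l _ => ?_
  rw [integral_const_mul, (hind2 l).integral_fun_mul_eq_mul_integral (hi1 l).1 (hi2 l).1]
  ring

lemma integral_upperGammaNat_comp {U : Ω → ℝ} (hU : Measurable U) (hU0 : ∀ ω, 0 ≤ U ω) (l : ℕ)
    {κ : ℝ} (hκ : 0 < κ) :
    ∫ ω, upperGammaNat (l + 1) (κ * U ω) ∂P =
      ∫ v in Ioi 0, v ^ l * Real.exp (-v) * P.real {ω | U ω < v / κ} := by
  simp only [upperGammaNat, Nat.add_sub_cancel]
  rw [integral_setIntegral_Ioi (U := fun ω => κ * U ω) (by fun_prop)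
    (fun ω => mul_nonneg hκ.le (hU0 ω)) (integrableOn_pow_mul_exp_neg l)]
  simp only [lt_div_iff₀' hκ]

lemma integral_upperGammaNat_gamma {U : Ω → ℝ} (hU : Measurable U) (hU0 : ∀ ω, 0 ≤ U ω) (l : ℕ)
    {κ : ℝ} (hκ : 0 < κ) {n : ℕ} (hn : 0 < n) {r : ℝ} (hr : 0 < r)
    (hlaw : P.map U = gammaMeasure n r) :
    ∫ ω, upperGammaNat (l + 1) (κ * U ω) ∂P =
      expLowerGammaIntegral n l (r / κ) / Real.Gamma n := by
  rw [integral_upperGammaNat_comp hU hU0 l hκ, expLowerGammaIntegral, ← integral_div]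
  refine setIntegral_congr_fun measurableSet_Ioi fun v hv => ?_
  have hv : (0 : ℝ) < v := hv
  have : P.real {ω | U ω < v / κ} = (gammaMeasure n r).real (Iio (v / κ)) := by
    rw [← hlaw, map_measureReal_apply hU measurableSet_Iio]
    rfl
  rw [this, gammaMeasure_real_Iio hn hr (by positivity), show r * (v / κ) = r / κ * v by ring]
  ring

end Hop

/-! ### Expectations of functions of the inverse transmit SNR -/

section InversePower

open Set

/-- The inverse transmit SNR `max (1/a) (Z/b)` under a peak power and an interference constraint. -/
lemma integral_comp_invPower {Ω : Type*} [MeasurableSpace Ω] {P : Measure Ω} {Z : Ω → ℝ} (hZ : Measurable Z) {m : ℕ} (hm : 0 < m) {r : ℝ}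
    (hr : 0 < r) (hlaw : P.map Z = gammaMeasure m r) {a b : ℝ} (ha : 0 < a) (hb : 0 < b)
    {g : ℝ → ℝ} (hg : Measurable g) {C : ℝ} (hC : ∀ x, 0 ≤ x → |g x| ≤ C) :
    ∫ ω, g (max (1 / a) (Z ω / b)) ∂P =
      (lowerGammaNat m (r * b / a) * g (1 / a) +
        ∫ t in Ioi (r * b / a), t ^ (m - 1) * Real.exp (-t) * g (t / (r * b))) / Real.Gamma m := by
  have hmeas : Measurable fun x => g (max (1 / a) (x / b)) := hg.comp (by fun_prop)
  rw [← integral_map (φ := Z) (f := fun x => g (max (1 / a) (x / b))) hZ.aemeasurable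
    hmeas.aestronglyMeasurable, hlaw, integral_gammaMeasure hm hr]
  congr 1
  set φ := r * b / a with hφ
  have hφ0 : 0 < φ := by positivity
  have hint : IntegrableOn (fun t => t ^ (m - 1) * Real.exp (-t) * g (max (1 / a) (t / r / b)))
      (Ioi 0) := by
    refine (integrableOn_pow_mul_exp_neg (m - 1)).mul_bdd (c := C)
      (hmeas.comp (by fun_prop : Measurable fun t : ℝ => t / r)).aestronglyMeasurable
      (.of_forall fun t => hC _ ?_)
    exact le_max_of_le_left (by positivity)
  -- The threshold φ = rb/a is where the interference constraint overtakes the peak power: below it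
  -- the maximum is the constant 1/a, above it t/(rb).
  rw [← Ioc_union_Ioi_eq_Ioi hφ0.le, setIntegral_union Ioc_disjoint_Ioi_same measurableSet_Ioi
    (hint.mono_set Ioc_subset_Ioi_self) (hint.mono_set (Ioi_subset_Ioi hφ0.le)), lowerGammaNat,
    ← integral_mul_const]
  congr 1
  · refine setIntegral_congr_fun measurableSet_Ioc fun t ht => ?_
    rw [max_eq_left]
    have := ht.2
    rw [hφ, le_div_iff₀ ha] at this
    rw [div_div, div_le_div_iff₀ (by positivity) ha]
    linarith
  · refine setIntegral_congr_fun measurableSet_Ioi fun t ht => ?_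
    rw [max_eq_right, div_div]
    have : φ < t := ht
    rw [hφ, div_lt_iff₀ ha] at this
    rw [div_div, div_le_div_iff₀ ha (by positivity)]
    linarith

end InversePower

/-! ### The eavesdropper's gain attenuated by a jammer -/

section Jammer

open Set

variable {Ω : Type*} [MeasurableSpace Ω] {P : Measure Ω} [IsProbabilityMeasure P]

lemma integrableOn_beta_prime_mul {h N : ℕ} (hN : h + 1 < N) {F : ℝ → ℝ} (hF : Measurable F)
    {C : ℝ} (hC : ∀ x, 0 < x → |F x| ≤ C) {z : ℝ} (hz : 0 < z) :
    IntegrableOn (fun v => v ^ h * ((1 + v) ^ N)⁻¹ * F (z * v)) (Ioi 0) := by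
  have hN' : (h : ℝ) + 1 < N := by exact_mod_cast hN
  have h1 := integrableOn_beta_prime_rpow (h := h) (N := N) (c := 0) (by positivity) (by linarith)
  simp only [neg_zero, Real.rpow_zero, mul_one] at h1
  refine Integrable.mul_bdd (c := C) h1
    (hF.comp (measurable_const_mul z)).aestronglyMeasurable ?_
  refine (ae_restrict_mem measurableSet_Ioi).mono fun v hv => hC _ (mul_pos hz hv)

/-- G is expressed through H and F, so boundedness and measurability are required only of those two.
In the application G is the tail integral, H a distribution function and F a lower incomplete Gamma
function. -/
lemma betaTransform_sub {h N : ℕ} (hN : h + 1 < N) {F G H : ℝ → ℝ} (hF : Measurable F)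
    {C D : ℝ} (hC : ∀ x, 0 < x → |F x| ≤ C) (hH : Measurable H) (hD : ∀ x, 0 < x → |H x| ≤ D)
    {a b s p : ℝ} (ha : 0 < a) (hG : ∀ x, 0 < x → G (b * x) = s * H x - p * F (a * x))
    {z : ℝ} (hz : 0 < z) :
    betaTransform h N G (b * z) = s * betaTransform h N H z - p * betaTransform h N F (a * z) := by
  have e : ∫ v in Ioi 0, v ^ h * ((1 + v) ^ N)⁻¹ * G (b * z * v) = ∫ v in Ioi 0,
      (s * (v ^ h * ((1 + v) ^ N)⁻¹ * H (z * v)) -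
        p * (v ^ h * ((1 + v) ^ N)⁻¹ * F (a * z * v))) := by
    refine setIntegral_congr_fun measurableSet_Ioi fun v hv => ?_
    rw [mul_assoc b, hG _ (mul_pos hz hv), ← mul_assoc a]
    ring
  rw [betaTransform, e, integral_sub
    ((integrableOn_beta_prime_mul hN hH hD hz).const_mul s)
    ((integrableOn_beta_prime_mul hN hF hC (mul_pos ha hz)).const_mul p), integral_const_mul,
    integral_const_mul, betaTransform, betaTransform]
  ring

/-- The scale (1+q)/q is chosen so that 1 + q + qw becomes (1+q)(1+x); the binomial expansion of
(1+w)^(n-1) then leaves pure beta kernels. -/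
lemma one_add_pow_mul_inv_comp {n N : ℕ} (hn : 0 < n) {q : ℝ} (hq : 0 < q) {x : ℝ} (hx : 0 < x) :
    (1 + (1 + q) / q * x) ^ (n - 1) * ((1 + q + q * ((1 + q) / q * x)) ^ N)⁻¹ =
      ∑ h ∈ Finset.range n, (n - 1).choose h * ((1 + q) / q) ^ h * ((1 + q) ^ N)⁻¹ *
        (x ^ h * ((1 + x) ^ N)⁻¹) := by
  have h1 : 1 + q + q * ((1 + q) / q * x) = (1 + q) * (1 + x) := by field_simp
  rw [h1, add_comm, add_pow, Nat.sub_add_cancel hn, Finset.sum_mul, mul_pow, mul_inv]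
  refine Finset.sum_congr rfl fun h _ => ?_
  rw [mul_pow, one_pow]
  ring

lemma integrableOn_one_add_pow_mul_inv {n N : ℕ} (hn : 0 < n) (hN : n < N) {q : ℝ} (hq : 0 < q) :
    IntegrableOn (fun w => (1 + w) ^ (n - 1) * ((1 + q + q * w) ^ N)⁻¹) (Ioi 0) := by
  have hz : 0 < (1 + q) / q := by positivity
  rw [← mul_zero ((1 + q) / q), ← integrableOn_Ioi_comp_mul_left_iff _ _ hz]
  refine IntegrableOn.congr_fun (f := fun x : ℝ => ∑ h ∈ Finset.range n, (n - 1).choose h *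
    ((1 + q) / q) ^ h * ((1 + q) ^ N)⁻¹ * (x ^ h * ((1 + x) ^ N)⁻¹))
    (integrable_finsetSum _ fun h hh => ?_)
    (fun x hx => (one_add_pow_mul_inv_comp hn hq hx).symm) measurableSet_Ioi
  have hh := Finset.mem_range.1 hh
  have := integrableOn_beta_prime_mul (h := h) (N := N) (by omega) (F := fun _ => 1)
    measurable_const (C := 1) (fun _ _ => by simp) one_pos
  simp only [mul_one] at this
  exact Integrable.const_mul this _

lemma integral_one_add_pow_mul_inv_mul {n N : ℕ} (hn : 0 < n) (hN : n < N) {q : ℝ} (hq : 0 < q)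
    {F : ℝ → ℝ} (hF : Measurable F) {C : ℝ} (hC : ∀ x, 0 < x → |F x| ≤ C) :
    Real.Gamma N * ∫ w in Ioi 0, (1 + w) ^ (n - 1) * ((1 + q + q * w) ^ N)⁻¹ * F w =
      ∑ h ∈ Finset.range n, (n - 1).choose h * ((1 + q) / q) ^ (h + 1) * ((1 + q) ^ N)⁻¹ *
        betaTransform h N F ((1 + q) / q) := by
  have hz : 0 < (1 + q) / q := by positivity
  have h1 := setIntegral_Ioi_comp_affine
    (fun w => (1 + w) ^ (n - 1) * ((1 + q + q * w) ^ N)⁻¹ * F w) 0 0 hz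
  simp only [mul_zero, zero_add] at h1
  have e : ∫ t in Ioi 0, (1 + (1 + q) / q * t) ^ (n - 1) *
      ((1 + q + q * ((1 + q) / q * t)) ^ N)⁻¹ * F ((1 + q) / q * t) =
      ∫ t in Ioi 0, ∑ h ∈ Finset.range n, (n - 1).choose h * ((1 + q) / q) ^ h * ((1 + q) ^ N)⁻¹ *
        (t ^ h * ((1 + t) ^ N)⁻¹ * F ((1 + q) / q * t)) := by
    refine setIntegral_congr_fun measurableSet_Ioi fun t ht => ?_
    rw [one_add_pow_mul_inv_comp hn hq ht, Finset.sum_mul]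
    exact Finset.sum_congr rfl fun h _ => by ring
  rw [h1, e, integral_finsetSum _ fun h hh => ?_]
  · rw [Finset.mul_sum, Finset.mul_sum]
    refine Finset.sum_congr rfl fun h _ => ?_
    rw [integral_const_mul, betaTransform]
    ring
  · have hh := Finset.mem_range.1 hh
    exact (integrableOn_beta_prime_mul (by omega) hF hC hz).const_mul _

lemma integral_pow_mul_exp_neg_mul (n : ℕ) {c : ℝ} (hc : 0 < c) :
    ∫ v in Ioi (0 : ℝ), v ^ n * Real.exp (-(c * v)) = Real.Gamma (n + 1) * (c ^ (n + 1))⁻¹ := by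
  have := Real.integral_rpow_mul_exp_neg_mul_Ioi (a := n + 1) (by positivity) hc
  simp only [add_sub_cancel_right, Real.rpow_natCast] at this
  rw [this, mul_comm, ← Nat.cast_add_one, Real.rpow_natCast]
  simp

lemma integrableOn_pow_mul_exp_neg_mul (n : ℕ) {c : ℝ} (hc : 0 < c) :
    IntegrableOn (fun v : ℝ => v ^ n * Real.exp (-(c * v))) (Ioi 0) := by
  -- A non-integrable function would have integral 0, but the computed value is positive.
  by_contra h
  have := integral_pow_mul_exp_neg_mul n hc
  rw [integral_undef h] at this
  have : 0 < Real.Gamma (n + 1) * (c ^ (n + 1))⁻¹ := by positivity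
  linarith

/-- The Tonelli check for exchanging v and w: the kernel is positive, and its v-integral is a
multiple of (1+w)^(n-1) (1+q+qw)^(-(l+n+1)), integrable because n < l + n + 1. -/
lemma integrable_jammer_kernel {n l : ℕ} (hn : 0 < n) {q : ℝ} (hq : 0 < q) :
    Integrable (fun p : ℝ × ℝ => p.1 ^ (l + n) * (1 + p.2) ^ (n - 1) *
      Real.exp (-((1 + q + q * p.2) * p.1)))
      ((volume.restrict (Ioi 0)).prod (volume.restrict (Ioi 0))) := by
  rw [integrable_prod_iff' (Measurable.aestronglyMeasurable (by fun_prop))]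
  constructor
  · refine (ae_restrict_mem measurableSet_Ioi).mono fun w hw => ?_
    have hw : (0 : ℝ) < w := hw
    refine ((integrableOn_pow_mul_exp_neg_mul (l + n) (c := 1 + q + q * w)
      (by positivity)).const_mul ((1 + w) ^ (n - 1))).congr (.of_forall fun v => ?_)
    simp only
    ring
  · refine IntegrableOn.congr_fun (f := fun w : ℝ => Real.Gamma ((l + n : ℕ) + 1) *
      ((1 + w) ^ (n - 1) * ((1 + q + q * w) ^ (l + n + 1))⁻¹))
      (Integrable.const_mul (integrableOn_one_add_pow_mul_inv hn (by omega) hq) _)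
      (fun w hw => ?_) measurableSet_Ioi
    have hw : (0 : ℝ) < w := hw
    simp only
    rw [mul_left_comm, ← integral_pow_mul_exp_neg_mul (l + n) (c := 1 + q + q * w) (by positivity),
      ← integral_const_mul]
    refine setIntegral_congr_fun measurableSet_Ioi fun v hv => ?_
    have hv : (0 : ℝ) < v := hv
    rw [Real.norm_of_nonneg (by positivity)]
    ring

lemma abs_measureReal_le_one (s : Set Ω) : |P.real s| ≤ 1 := by
  rw [abs_of_nonneg measureReal_nonneg]
  exact measureReal_le_one

/-- Monotonicity is recorded because it makes distribution functions measurable. -/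
lemma monotone_measureReal_lt (W : Ω → ℝ) : Monotone fun w => P.real {ω | W ω < w} :=
  fun _ _ hab => measureReal_mono fun _ hω => lt_of_lt_of_le hω hab

lemma integral_upperGammaNat_one_add {W : Ω → ℝ} (hW : Measurable W) (hW0 : ∀ ω, 0 ≤ W ω)
    {n : ℕ} (hn : 0 < n) {a : ℝ} (ha : 0 < a) :
    ∫ ω, upperGammaNat n (a * (1 + W ω)) ∂P = ∫ w in Ioi 0,
      a ^ n * (1 + w) ^ (n - 1) * Real.exp (-(a * (1 + w))) * P.real {ω | W ω < w} := by
  have hg : IntegrableOn (fun t : ℝ => t ^ (n - 1) * Real.exp (-t)) (Ioi (a + a * 0)) :=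
    integrableOn_pow_mul_exp_neg_Ioi _ (by simp [ha.le])
  have := integral_setIntegral_Ioi (P := P) hW hW0 ((integrableOn_Ioi_comp_affine ha hg).const_mul a)
  have e (ω : Ω) : upperGammaNat n (a * (1 + W ω)) = ∫ t in Ioi (W ω),
      a * ((a + a * t) ^ (n - 1) * Real.exp (-(a + a * t))) := by
    rw [mul_add, mul_one, upperGammaNat, setIntegral_Ioi_comp_affine _ _ _ ha, integral_const_mul]
  simp only [e]
  rw [this]
  congr 1
  ext w
  obtain ⟨k, rfl⟩ := Nat.exists_eq_succ_of_ne_zero hn.ne'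
  simp only [Nat.succ_eq_add_one, Nat.add_sub_cancel]
  rw [show a + a * w = a * (1 + w) by ring, mul_pow]
  ring

/-- The expectation is the integral of v^l e^(-v) against the distribution function of Y/(1+W). Its
complement is Pr(Y ≥ (v/κ)(1+W)); conditioning on W and the layer-cake identity turn this into an
integral against the distribution function of W. Exchanging the integrals, the v-integral is
elementary and leaves the kernel evaluated by `integral_one_add_pow_mul_inv_mul`. The law of W stays
arbitrary. -/
lemma integral_upperGammaNat_jam {Y W : Ω → ℝ} (hY : Measurable Y) (hW : Measurable W)
    (hY0 : ∀ ω, 0 ≤ Y ω) (hW0 : ∀ ω, 0 ≤ W ω) (hind : IndepFun W Y P) (l : ℕ)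
    {κ : ℝ} (hκ : 0 < κ) {n : ℕ} (hn : 0 < n) {r : ℝ} (hr : 0 < r)
    (hlaw : P.map Y = gammaMeasure n r) :
    ∫ ω, upperGammaNat (l + 1) (κ * (Y ω / (1 + W ω))) ∂P = Real.Gamma (l + 1) -
      (r / κ) ^ n * (∑ h ∈ Finset.range n, (n - 1).choose h * ((1 + r / κ) / (r / κ)) ^ (h + 1) *
        ((1 + r / κ) ^ (l + n + 1))⁻¹ * betaTransform h (l + n + 1) (fun w => P.real {ω | W ω < w})
          ((1 + r / κ) / (r / κ))) / Real.Gamma n := by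
  set q := r / κ with hq
  have hq0 : 0 < q := by positivity
  set F : ℝ → ℝ := fun w => P.real {ω | W ω < w} with hF
  have hFm : Measurable F := (monotone_measureReal_lt W).measurable
  have hUm : Measurable fun ω => Y ω / (1 + W ω) := by fun_prop
  have hn' : (0 : ℝ) < n := by exact_mod_cast hn
  have hG := (Real.Gamma_pos_of_pos hn').ne'
  rw [integral_upperGammaNat_comp hUm
    (fun ω => div_nonneg (hY0 ω) (by linarith [hW0 ω])) l hκ,
    ← integral_one_add_pow_mul_inv_mul hn (by omega) hq0 hFm (C := 1)
      (fun x _ => abs_measureReal_le_one _)]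
  set p : ℝ → ℝ := fun v => P.real {ω | Y ω / (1 + W ω) < v / κ} with hp
  have hpm : Measurable p :=
    (monotone_measureReal_lt _).measurable.comp (by fun_prop : Measurable fun v : ℝ => v / κ)
  have hpv (v : ℝ) (hv : 0 < v) : 1 - p v = (∫ w in Ioi 0, (q * v) ^ n * (1 + w) ^ (n - 1) *
      Real.exp (-(q * v * (1 + w))) * F w) / Real.Gamma n := by
    have hc : {ω | Y ω / (1 + W ω) < v / κ}ᶜ = {ω | v / κ * (1 + W ω) ≤ Y ω} := by
      ext ω
      have : 0 < 1 + W ω := by linarith [hW0 ω]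
      simp only [mem_compl_iff, mem_ofPred_eq, not_lt]
      rw [le_div_iff₀ this]
    have hind' : IndepFun (fun ω => v / κ * (1 + W ω)) Y P :=
      hind.comp (φ := fun w => v / κ * (1 + w)) (ψ := id) (by fun_prop) measurable_id
    rw [hp]
    simp only
    rw [← probReal_compl_eq_one_sub (measurableSet_lt hUm measurable_const), hc,
      measureReal_le_gamma (by fun_prop) hY hind'
        (fun ω => by have := hW0 ω; positivity) hn hr hlaw,
      ← integral_upperGammaNat_one_add hW hW0 hn (mul_pos hq0 hv)]
    congr 2
    ext ω
    rw [hq]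
    congr 1
    ring
  have hpi : IntegrableOn (fun v => v ^ l * Real.exp (-v) * p v) (Ioi 0) :=
    (integrableOn_pow_mul_exp_neg l).mul_bdd hpm.aestronglyMeasurable
      (.of_forall fun v => abs_measureReal_le_one _)
  have e1 : ∫ v in Ioi 0, v ^ l * Real.exp (-v) * p v = Real.Gamma (l + 1) -
      ∫ v in Ioi 0, v ^ l * Real.exp (-v) * (1 - p v) := by
    simp only [mul_sub, mul_one]
    rw [integral_sub (integrableOn_pow_mul_exp_neg l) hpi, integral_pow_mul_exp_neg]
    ring
  have e2 : ∫ v in Ioi 0, v ^ l * Real.exp (-v) * (1 - p v) = (∫ v in Ioi 0, ∫ w in Ioi 0,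
      q ^ n * (v ^ (l + n) * (1 + w) ^ (n - 1) * Real.exp (-((1 + q + q * w) * v)) * F w)) /
        Real.Gamma n := by
    rw [← integral_div]
    refine setIntegral_congr_fun measurableSet_Ioi fun v hv => ?_
    rw [hpv v hv, mul_div_assoc', ← integral_const_mul]
    congr 2
    ext w
    rw [show -((1 + q + q * w) * v) = -v + -(q * v * (1 + w)) by ring, Real.exp_add]
    ring
  have hint : Integrable (fun x : ℝ × ℝ => q ^ n * (x.1 ^ (l + n) * (1 + x.2) ^ (n - 1) *
      Real.exp (-((1 + q + q * x.2) * x.1)) * F x.2))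
      ((volume.restrict (Ioi 0)).prod (volume.restrict (Ioi 0))) :=
    ((integrable_jammer_kernel hn hq0).mul_bdd (hFm.comp measurable_snd).aestronglyMeasurable
      (.of_forall fun v => abs_measureReal_le_one _)).const_mul _
  -- With v innermost, each w contributes Γ(l+n+1) / (1+q+qw)^(l+n+1).
  rw [e1, e2, integral_integral_swap hint]
  congr 2
  rw [← integral_const_mul, ← integral_const_mul]
  refine setIntegral_congr_fun measurableSet_Ioi fun w hw => ?_
  have hw : (0 : ℝ) < w := hw
  have := integral_pow_mul_exp_neg_mul (l + n) (c := 1 + q + q * w) (by positivity)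
  rw [← Nat.cast_add_one] at this
  rw [show q ^ n * (Real.Gamma (l + n + 1 : ℕ) * ((1 + w) ^ (n - 1) *
    ((1 + q + q * w) ^ (l + n + 1))⁻¹ * F w)) = q ^ n * (1 + w) ^ (n - 1) * F w *
    (Real.Gamma (l + n + 1 : ℕ) * ((1 + q + q * w) ^ (l + n + 1))⁻¹) by ring, ← this,
    ← integral_const_mul]
  congr 1
  ext v
  ring

end Jammer

/-! ### Capacities as linear inequalities between gains; independence and laws of the links -/

namespace RelayNet

section Network

open Set

variable {c : RelayNet} {Ω : Type*} {h : c.Link → Ω → ℝ}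

/-- The σ-algebra generated by the fading amplitudes of a set of links. -/
abbrev sigmaLinks (h : c.Link → Ω → ℝ) (T : Set c.Link) : MeasurableSpace Ω :=
  ⨆ q ∈ T, MeasurableSpace.comap (h q) inferInstance

lemma measurable_gain_sigmaLinks {T : Set c.Link} {q : c.Link} (hq : q ∈ T) :
    Measurable[sigmaLinks h T] (c.gain h q) := by
  have h1 : Measurable[sigmaLinks h T] (h q) :=
    Measurable.mono (comap_measurable (h q))
      (le_iSup₂ (f := fun q (_ : q ∈ T) => MeasurableSpace.comap (h q) inferInstance) q hq) le_rfl
  exact (by fun_prop : Measurable fun x : ℝ => |x| ^ 2).comp h1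

lemma measurable_sum_gain_sigmaLinks {T : Set c.Link} {n : ℕ} {q : Fin n → c.Link}
    (hq : ∀ u, q u ∈ T) : Measurable[sigmaLinks h T] fun ω => ∑ u, c.gain h (q u) ω :=
  Finset.measurable_sum _ fun u _ => measurable_gain_sigmaLinks (hq u)

lemma gain_nonneg (q : c.Link) (ω : Ω) : 0 ≤ c.gain h q ω := sq_nonneg _

lemma sum_gain_nonneg {n : ℕ} (q : Fin n → c.Link) (ω : Ω) : 0 ≤ ∑ u, c.gain h (q u) ω :=
  Finset.sum_nonneg fun u _ => gain_nonneg (q u) ω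

/-- The inverse of the transmit SNR `P_{S_i} / N_0`. -/
noncomputable def invPowerS (c : RelayNet) (h : c.Link → Ω → ℝ) (i : Fin c.N) (ω : Ω) : ℝ :=
  max (1 / c.gamS i) (c.gain h (.SP i) ω / c.gamI)

/-- The inverse of the transmit SNR `P_R / N_0`. -/
noncomputable def invPowerR (c : RelayNet) (h : c.Link → Ω → ℝ) (ω : Ω) : ℝ :=
  max (1 / c.gamR) (c.gain h .RP ω / c.gamI)

lemma gamS_pos (i : Fin c.N) : 0 < c.gamS i := div_pos (c.PSmax_pos i) c.N0_pos
lemma gamR_pos : 0 < c.gamR := div_pos c.PRmax_pos c.N0_pos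
lemma gamI_pos : 0 < c.gamI := div_pos c.PI_pos c.N0_pos
lemma one_lt_gam : 1 < c.gam := Real.one_lt_rpow one_lt_two c.Rs_pos

lemma lamSR_pos (i : Fin c.N) : 0 < c.lamSR i :=
  div_pos (Nat.cast_pos.2 (c.mSR_pos i)) (c.wSR_pos i)
lemma lamSP_pos (i : Fin c.N) : 0 < c.lamSP i :=
  div_pos (Nat.cast_pos.2 (c.mSP_pos i)) (c.wSP_pos i)
lemma lamSE_pos (i : Fin c.N) (k : Fin c.M) : 0 < c.lamSE i k :=
  div_pos (Nat.cast_pos.2 (c.mSE_pos i k)) (c.wSE_pos i k)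
lemma lamRD_pos : 0 < c.lamRD := div_pos (Nat.cast_pos.2 c.mRD_pos) c.wRD_pos
lemma lamRP_pos : 0 < c.lamRP := div_pos (Nat.cast_pos.2 c.mRP_pos) c.wRP_pos
lemma lamRE_pos (k : Fin c.M) : 0 < c.lamRE k :=
  div_pos (Nat.cast_pos.2 (c.mRE_pos k)) (c.wRE_pos k)

lemma nSR_pos (i : Fin c.N) : 0 < c.nSR i := Nat.mul_pos c.LR_pos (c.mSR_pos i)
lemma nSE_pos (i : Fin c.N) (k : Fin c.M) : 0 < c.nSE i k :=
  Nat.mul_pos (c.LE_pos k) (c.mSE_pos i k)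
lemma nRD_pos : 0 < c.nRD := Nat.mul_pos c.LD_pos c.mRD_pos
lemma nRE_pos (k : Fin c.M) : 0 < c.nRE k := Nat.mul_pos (c.LE_pos k) (c.mRE_pos k)

lemma invPowerS_pos (i : Fin c.N) (ω : Ω) : 0 < c.invPowerS h i ω :=
  lt_max_of_lt_left (one_div_pos.2 (gamS_pos i))
lemma invPowerR_pos (ω : Ω) : 0 < c.invPowerR h ω :=
  lt_max_of_lt_left (one_div_pos.2 gamR_pos)

/-- Positivity of g is essential: at g = 0 the convention q/0 = 0 would make the transmit power
vanish instead of attaining its peak. -/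
lemma min_div_eq_inv_max {p q n g : ℝ} (hp : 0 < p) (hq : 0 < q) (hn : 0 < n) (hg : 0 < g) :
    min p (q / g) / n = (max (1 / (p / n)) (g / (q / n)))⁻¹ := by
  have e1 : (1 / (p / n)) = (p / n)⁻¹ := one_div _
  have e2 : g / (q / n) = (q / g / n)⁻¹ := by field_simp
  rw [e1, e2]
  rcases le_total p (q / g) with hle | hle
  · rw [min_eq_left hle, max_eq_left, inv_inv]
    gcongr
  · rw [min_eq_right hle, max_eq_right, inv_inv]
    gcongr

lemma powerS_div_eq {i : Fin c.N} {ω : Ω} (hg : 0 < c.gain h (.SP i) ω) :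
    c.powerS h i ω / c.N0 = (c.invPowerS h i ω)⁻¹ :=
  min_div_eq_inv_max (c.PSmax_pos i) c.PI_pos c.N0_pos hg

lemma powerR_div_eq {ω : Ω} (hg : 0 < c.gain h .RP ω) :
    c.powerR h ω / c.N0 = (c.invPowerR h ω)⁻¹ :=
  min_div_eq_inv_max c.PRmax_pos c.PI_pos c.N0_pos hg

/-- In the zero branch both sides fail: R > 0 excludes the left, and 2^R > 1 makes the right force x
> y. -/
lemma le_secrecyCapacity_iff {R x y : ℝ} (hR : 0 < R) (hx : 0 ≤ x) (hy : 0 ≤ y) :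
    R ≤ secrecyCapacity x y ↔ (2 : ℝ) ^ R * (1 + y) ≤ 1 + x := by
  have h1 : 1 < (2 : ℝ) ^ R := Real.one_lt_rpow one_lt_two hR
  have hy1 : 0 < 1 + y := by linarith
  rw [secrecyCapacity]
  split_ifs with hxy
  · rw [Real.le_logb_iff_rpow_le one_lt_two (by positivity), le_div_iff₀ hy1]
  · constructor
    · intro h; linarith
    · intro h
      nlinarith

lemma gam_mul_le_iff {g B x u : ℝ} (hB : 0 < B) :
    g * (1 + B⁻¹ * u) ≤ 1 + B⁻¹ * x ↔ (g - 1) * B + g * u ≤ x := by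
  rw [← mul_le_mul_iff_right₀ hB]
  have e1 : B * (g * (1 + B⁻¹ * u)) = g * B + g * u := by field_simp
  have e2 : B * (1 + B⁻¹ * x) = B + x := by field_simp
  rw [e1, e2]
  constructor <;> intro h <;> linarith

lemma powerS_nonneg (i : Fin c.N) (ω : Ω) : 0 ≤ c.powerS h i ω :=
  le_min (c.PSmax_pos i).le (div_nonneg c.PI_pos.le (gain_nonneg _ _))

lemma powerR_nonneg (ω : Ω) : 0 ≤ c.powerR h ω :=
  le_min c.PRmax_pos.le (div_nonneg c.PI_pos.le (gain_nonneg _ _))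

lemma le_cap1_iff {i : Fin c.N} {k : Fin c.M} {ω : Ω} (hg : 0 < c.gain h (.SP i) ω) :
    c.Rs ≤ c.cap1 h i k ω ↔ (c.gam - 1) * c.invPowerS h i ω +
      c.gam * (∑ u, c.gain h (.SE i k u) ω) ≤ ∑ u, c.gain h (.SR i u) ω := by
  have hp := div_nonneg (powerS_nonneg (h := h) i ω) c.N0_pos.le
  rw [cap1, snrR, snrE1, le_secrecyCapacity_iff c.Rs_pos (mul_nonneg hp (sum_gain_nonneg _ ω))
    (mul_nonneg hp (sum_gain_nonneg _ ω)), powerS_div_eq hg]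
  exact gam_mul_le_iff (invPowerS_pos i ω)

lemma le_cap2_iff {k : Fin c.M} {ω : Ω} (hg : 0 < c.gain h .RP ω) :
    c.Rs ≤ c.cap2 h k ω ↔ (c.gam - 1) * c.invPowerR h ω +
      c.gam * (∑ u, c.gain h (.RE k u) ω) ≤ ∑ t, c.gain h (.RD t) ω := by
  have hp := div_nonneg (powerR_nonneg (h := h) ω) c.N0_pos.le
  rw [cap2, snrD, snrE2, le_secrecyCapacity_iff c.Rs_pos (mul_nonneg hp (sum_gain_nonneg _ ω))
    (mul_nonneg hp (sum_gain_nonneg _ ω)), powerR_div_eq hg]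
  exact gam_mul_le_iff (invPowerR_pos ω)

/-- The jamming-to-noise ratio at `E_k`. -/
noncomputable def jamSnr (c : RelayNet) (h : c.Link → Ω → ℝ) (J : Fin c.N) (k : Fin c.M)
    (ω : Ω) : ℝ := (∑ u, c.gain h (.SE J k u) ω) / c.invPowerS h J ω

lemma jamSnr_nonneg (J : Fin c.N) (k : Fin c.M) (ω : Ω) : 0 ≤ c.jamSnr h J k ω :=
  div_nonneg (sum_gain_nonneg _ ω) (invPowerS_pos J ω).le

lemma le_cap1Jam_iff {i J : Fin c.N} {k : Fin c.M} {ω : Ω} (hg : 0 < c.gain h (.SP i) ω)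
    (hgJ : 0 < c.gain h (.SP J) ω) :
    c.Rs ≤ c.cap1Jam h i J k ω ↔ (c.gam - 1) * c.invPowerS h i ω +
      c.gam * ((∑ u, c.gain h (.SE i k u) ω) / (1 + c.jamSnr h J k ω)) ≤
        ∑ u, c.gain h (.SR i u) ω := by
  have hp := div_nonneg (powerS_nonneg (h := h) i ω) c.N0_pos.le
  have hpJ := div_nonneg (powerS_nonneg (h := h) J ω) c.N0_pos.le
  have hJ : c.powerS h J ω / c.N0 * ∑ u, c.gain h (.SE J k u) ω + 1 = 1 + c.jamSnr h J k ω := by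
    rw [powerS_div_eq hgJ, jamSnr, add_comm, inv_mul_eq_div]
  have h0 := jamSnr_nonneg (h := h) J k ω
  have hE : c.snrE1Jam h i J k ω = (c.invPowerS h i ω)⁻¹ *
      ((∑ u, c.gain h (.SE i k u) ω) / (1 + c.jamSnr h J k ω)) := by
    rw [snrE1Jam, hJ, powerS_div_eq hg, mul_div_assoc]
  have hE0 : 0 ≤ c.snrE1Jam h i J k ω := by
    rw [hE]
    exact mul_nonneg (inv_nonneg.2 (invPowerS_pos i ω).le)
      (div_nonneg (sum_gain_nonneg _ ω) (by linarith))
  rw [cap1Jam, snrR, le_secrecyCapacity_iff c.Rs_pos (mul_nonneg hp (sum_gain_nonneg _ ω)) hE0,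
    hE, powerS_div_eq hg]
  exact gam_mul_le_iff (invPowerS_pos i ω)

lemma measurable_secrecyCapacity :
    Measurable fun p : ℝ × ℝ => secrecyCapacity p.1 p.2 :=
  Measurable.ite (measurableSet_lt measurable_snd measurable_fst)
    (by unfold Real.logb; fun_prop) measurable_const

section Measurability

variable {m : MeasurableSpace Ω}

lemma measurable_powerS {i : Fin c.N} (hi : Measurable (c.gain h (.SP i))) :
    Measurable (c.powerS h i) := measurable_const.min (measurable_const.div hi)

lemma measurable_cap1 {i : Fin c.N} {k : Fin c.M} (hi : Measurable (c.gain h (.SP i)))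
    (hX : Measurable fun ω => ∑ u, c.gain h (.SR i u) ω)
    (hY : Measurable fun ω => ∑ u, c.gain h (.SE i k u) ω) : Measurable (c.cap1 h i k) :=
  measurable_secrecyCapacity.comp
    ((((measurable_powerS hi).div_const _).mul hX).prodMk
      (((measurable_powerS hi).div_const _).mul hY))

lemma measurable_cap1Jam {i J : Fin c.N} {k : Fin c.M} (hi : Measurable (c.gain h (.SP i)))
    (hJ : Measurable (c.gain h (.SP J)))
    (hX : Measurable fun ω => ∑ u, c.gain h (.SR i u) ω)
    (hY : Measurable fun ω => ∑ u, c.gain h (.SE i k u) ω)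
    (hYJ : Measurable fun ω => ∑ u, c.gain h (.SE J k u) ω) : Measurable (c.cap1Jam h i J k) :=
  measurable_secrecyCapacity.comp
    ((((measurable_powerS hi).div_const _).mul hX).prodMk
      ((((measurable_powerS hi).div_const _).mul hY).div
        ((((measurable_powerS hJ).div_const _).mul hYJ).add_const 1)))

lemma measurable_cap2 {k : Fin c.M} (hi : Measurable (c.gain h .RP))
    (hX : Measurable fun ω => ∑ t, c.gain h (.RD t) ω)
    (hY : Measurable fun ω => ∑ u, c.gain h (.RE k u) ω) : Measurable (c.cap2 h k) :=
  have hP : Measurable (c.powerR h) := measurable_const.min (measurable_const.div hi)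
  measurable_secrecyCapacity.comp
    (((hP.div_const _).mul hX).prodMk ((hP.div_const _).mul hY))

end Measurability

namespace IsNakagamiFading

variable [MeasurableSpace Ω] {P : Measure Ω}

lemma indep_sigmaLinks (hf : c.IsNakagamiFading P h) (T : Set c.Link) :
    Indep (sigmaLinks h Tᶜ) (sigmaLinks h T) P :=
  indep_iSup_of_disjoint (fun q => (hf.measurable q).comap_le) hf.indep.iIndep
    disjoint_compl_left

/-- Later independence claims reduce to listing which links each variable uses, with T containing
those of one of them. -/
lemma indepFun (hf : c.IsNakagamiFading P h) (T : Set c.Link) {α β : Type*} [MeasurableSpace α]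
    [MeasurableSpace β] {F : Ω → α} {G : Ω → β} (hF : Measurable[sigmaLinks h Tᶜ] F)
    (hG : Measurable[sigmaLinks h T] G) : IndepFun F G P := by
  rw [IndepFun_iff_Indep]
  exact indep_of_indep_of_le_left (indep_of_indep_of_le_right (hf.indep_sigmaLinks T) hG.comap_le)
    hF.comap_le

lemma measurable_gain (hf : c.IsNakagamiFading P h) (q : c.Link) : Measurable (c.gain h q) :=
  (by fun_prop : Measurable fun x : ℝ => |x| ^ 2).comp (hf.measurable q)

lemma measurable_sum_gain (hf : c.IsNakagamiFading P h) {n : ℕ} (q : Fin n → c.Link) :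
    Measurable fun ω => ∑ u, c.gain h (q u) ω :=
  Finset.measurable_sum _ fun u _ => hf.measurable_gain (q u)

lemma severity_pos (q : c.Link) : 0 < c.severity q := by
  cases q <;> simp [severity, c.mSR_pos, c.mSP_pos, c.mSE_pos, c.mRD_pos, c.mRP_pos, c.mRE_pos]

lemma meanGain_pos (q : c.Link) : 0 < c.meanGain q := by
  cases q <;> simp [meanGain, c.wSR_pos, c.wSP_pos, c.wSE_pos, c.wRD_pos, c.wRP_pos, c.wRE_pos]

lemma map_gain (hf : c.IsNakagamiFading P h) (q : c.Link) :
    P.map (c.gain h q) = gammaMeasure (c.severity q) (c.severity q / c.meanGain q) := by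
  rw [← nakagamiMeasure_map_sq (Nat.cast_pos.2 (severity_pos q)) (meanGain_pos q), ← hf.law q,
    Measure.map_map (by fun_prop) (hf.measurable q)]
  rfl

lemma map_sum_gain [IsProbabilityMeasure P] (hf : c.IsNakagamiFading P h) {n : ℕ} (hn : 0 < n) {q : Fin n → c.Link}
    (hq : Function.Injective q) {m : ℕ} {w : ℝ} (hm : ∀ u, c.severity (q u) = m)
    (hw : ∀ u, c.meanGain (q u) = w) :
    P.map (fun ω => ∑ u, c.gain h (q u) ω) = gammaMeasure (n * m : ℕ) (m / w) := by
  have hind : iIndepFun (fun u => c.gain h (q u)) P :=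
    (hf.indep.precomp hq).comp (fun _ x => |x| ^ 2) fun _ => by fun_prop
  have hm0 : 0 < m := hm ⟨0, hn⟩ ▸ severity_pos _
  have hw0 : 0 < w := hw ⟨0, hn⟩ ▸ meanGain_pos _
  have := map_sum_gamma (fun u => hf.measurable_gain (q u)) hind (s := Finset.univ)
    ⟨⟨0, hn⟩, Finset.mem_univ _⟩ (a := m) (r := m / w) (by positivity) (by positivity)
    (fun u _ => by rw [hf.map_gain, hm, hw])
  rw [Finset.card_fin] at this
  rw [Nat.cast_mul, ← this]
  congr 1
  ext ω
  simp

/-- The Gamma law has no atom at 0, so the degenerate zero gain in the transmit power does not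
affect probabilities. -/
lemma ae_gain_pos (hf : c.IsNakagamiFading P h) (q : c.Link) : ∀ᵐ ω ∂P, 0 < c.gain h q ω := by
  have hne : ∀ᵐ x ∂P.map (c.gain h q), x ≠ 0 := by
    rw [hf.map_gain q]
    exact (withDensity_absolutelyContinuous _ _).ae_le (Measure.ae_ne volume 0)
  filter_upwards [ae_of_ae_map (hf.measurable_gain q).aemeasurable hne] with ω hω
  exact lt_of_le_of_ne (gain_nonneg q ω) (Ne.symm hω)

end IsNakagamiFading

end Network

end RelayNet

/-! ### Incomplete Gamma moments of the inverse transmit SNR -/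

section Moments

open Set

lemma integral_pow_mul_exp_invPower {Ω : Type*} [MeasurableSpace Ω] {P : Measure Ω} {Z : Ω → ℝ}
    (hZ : Measurable Z) {m : ℕ} (hm : 0 < m) {r : ℝ} (hr : 0 < r)
    (hlaw : P.map Z = gammaMeasure m r) {a b : ℝ} (ha : 0 < a) (hb : 0 < b) {ξ : ℝ} (hξ : 0 < ξ)
    (k : ℕ) :
    ∫ ω, max (1 / a) (Z ω / b) ^ k * Real.exp (-(ξ * max (1 / a) (Z ω / b))) ∂P =
      (lowerGammaNat m (r * b / a) * ((1 / a) ^ k * Real.exp (-(ξ / a))) +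
        r ^ m * upperGammaNat (m + k) (r * b / a + ξ / a) / (b ^ k * (r + ξ / b) ^ (m + k))) /
        Real.Gamma m := by
  rw [integral_comp_invPower hZ hm hr hlaw ha hb
    (g := fun x => x ^ k * Real.exp (-(ξ * x))) (by fun_prop)
    (fun x hx => pow_mul_exp_neg_le hξ k hx)]
  congr 2
  · rw [mul_one_div]
  -- On the tail the exponentials combine to e^(-dt) with d = 1 + ξ/(rb). Rescaling by d moves the
  -- limit to rb/a + ξ/a, and rd = r + ξ/b is the base of the power in the result.
  · have hd : 0 < 1 + ξ / (r * b) := by positivity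
    have h1 := setIntegral_Ioi_comp_affine (fun t => t ^ (m + k - 1) * Real.exp (-t)) 0
      (r * b / a) hd
    simp only [zero_add] at h1
    have h2 : (1 + ξ / (r * b)) * (r * b / a) = r * b / a + ξ / a := by field_simp
    rw [upperGammaNat, ← h2, h1, mul_comm (r ^ m), ← integral_const_mul, ← integral_mul_const,
      ← integral_div]
    refine setIntegral_congr_fun measurableSet_Ioi fun t ht => ?_
    have e1 : -((1 + ξ / (r * b)) * t) = -t + -(ξ * (t / (r * b))) := by
      field_simp
      ring
    have e2 : r + ξ / b = r * (1 + ξ / (r * b)) := by field_simp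
    rw [e1, Real.exp_add, e2]
    generalize 1 + ξ / (r * b) = d at hd
    generalize Real.exp (-t) = A
    generalize Real.exp (-(ξ * (t / (r * b)))) = D
    obtain ⟨j, rfl⟩ := Nat.exists_eq_succ_of_ne_zero hm.ne'
    rw [show j.succ + k - 1 = j + k by omega, show j.succ + k = j + k + 1 by omega,
      show j.succ - 1 = j by omega, Nat.succ_eq_add_one, div_pow, mul_pow, mul_pow r d]
    field_simp
    ring

lemma integral_upperGammaNat_invPower {Ω : Type*} [MeasurableSpace Ω] {P : Measure Ω} {Z : Ω → ℝ}
    (hZ : Measurable Z) {m : ℕ} (hm : 0 < m) {r : ℝ} (hr : 0 < r)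
    (hlaw : P.map Z = gammaMeasure m r) {a b : ℝ} (ha : 0 < a) (hb : 0 < b) {ξ : ℝ} (hξ : 0 < ξ)
    {n : ℕ} (hn : 0 < n) :
    ∫ ω, upperGammaNat n (ξ * max (1 / a) (Z ω / b)) ∂P =
      (lowerGammaNat m (r * b / a) * upperGammaNat n (ξ / a) +
        tailUpperGammaIntegral n m (r * b / a) (ξ / (r * b))) / Real.Gamma m := by
  rw [integral_comp_invPower hZ hm hr hlaw ha hb (C := Real.Gamma n)
    (g := fun x => upperGammaNat n (ξ * x))
    ((measurable_upperGammaNat n).comp (by fun_prop)) fun x hx => ?_, mul_one_div,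
    tailUpperGammaIntegral]
  · congr 3
    ext t
    rw [mul_div_assoc', div_mul_eq_mul_div]
  · rw [abs_of_nonneg (upperGammaNat_nonneg n (by positivity))]
    exact upperGammaNat_le hn (by positivity)

lemma integral_lowerGammaNat_invPower {Ω : Type*} [MeasurableSpace Ω] {P : Measure Ω} {Z : Ω → ℝ}
    (hZ : Measurable Z) {m : ℕ} (hm : 0 < m) {r : ℝ} (hr : 0 < r)
    (hlaw : P.map Z = gammaMeasure m r) {a b : ℝ} (ha : 0 < a) (hb : 0 < b) {ξ : ℝ} (hξ : 0 < ξ)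
    {n : ℕ} (hn : 0 < n) :
    ∫ ω, lowerGammaNat n (ξ * max (1 / a) (Z ω / b)) ∂P =
      (lowerGammaNat m (r * b / a) * lowerGammaNat n (ξ / a) +
        tailLowerGammaIntegral n m (r * b / a) (ξ / (r * b))) / Real.Gamma m := by
  rw [integral_comp_invPower hZ hm hr hlaw ha hb (C := Real.Gamma n)
    (g := fun x => lowerGammaNat n (ξ * x))
    ((measurable_lowerGammaNat n).comp (by fun_prop)) fun x hx => ?_, mul_one_div,
    tailLowerGammaIntegral]
  · congr 3
    ext t
    rw [mul_div_assoc', div_mul_eq_mul_div]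
  · rw [abs_of_nonneg (lowerGammaNat_nonneg n _)]
    exact lowerGammaNat_le hn (by positivity)

end Moments

/-! ### Non-outage probabilities of the network as real integrals -/

namespace RelayNet.IsNakagamiFading

open Set

variable {c : RelayNet} {Ω : Type*} [MeasurableSpace Ω] {P : Measure Ω} {h : c.Link → Ω → ℝ}

lemma measurable_invPowerS (hf : c.IsNakagamiFading P h) (i : Fin c.N) :
    Measurable (c.invPowerS h i) :=
  measurable_const.max ((hf.measurable_gain _).div_const _)

lemma measurable_invPowerR (hf : c.IsNakagamiFading P h) : Measurable (c.invPowerR h) :=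
  measurable_const.max ((hf.measurable_gain _).div_const _)

lemma measurable_jamSnr (hf : c.IsNakagamiFading P h) (J : Fin c.N) (k : Fin c.M) :
    Measurable (c.jamSnr h J k) :=
  (hf.measurable_sum_gain _).div (hf.measurable_invPowerS J)

variable [IsProbabilityMeasure P]
lemma map_SR (hf : c.IsNakagamiFading P h) (i : Fin c.N) :
    P.map (fun ω => ∑ u, c.gain h (.SR i u) ω) = gammaMeasure (c.nSR i) (c.lamSR i) :=
  hf.map_sum_gain c.LR_pos (fun _ _ h => by cases h; rfl) (fun _ => rfl) fun _ => rfl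

lemma map_SE (hf : c.IsNakagamiFading P h) (i : Fin c.N) (k : Fin c.M) :
    P.map (fun ω => ∑ u, c.gain h (.SE i k u) ω) = gammaMeasure (c.nSE i k) (c.lamSE i k) :=
  hf.map_sum_gain (c.LE_pos k) (fun _ _ h => by cases h; rfl) (fun _ => rfl) fun _ => rfl

lemma map_RD (hf : c.IsNakagamiFading P h) :
    P.map (fun ω => ∑ t, c.gain h (.RD t) ω) = gammaMeasure c.nRD c.lamRD :=
  hf.map_sum_gain c.LD_pos (fun _ _ h => by cases h; rfl) (fun _ => rfl) fun _ => rfl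

lemma map_RE (hf : c.IsNakagamiFading P h) (k : Fin c.M) :
    P.map (fun ω => ∑ u, c.gain h (.RE k u) ω) = gammaMeasure (c.nRE k) (c.lamRE k) :=
  hf.map_sum_gain (c.LE_pos k) (fun _ _ h => by cases h; rfl) (fun _ => rfl) fun _ => rfl

lemma measureReal_le_cap1 (hf : c.IsNakagamiFading P h) (i : Fin c.N) (k : Fin c.M) :
    P.real {ω | c.Rs ≤ c.cap1 h i k ω} =
      (∑ l ∈ Finset.range (c.nSR i), (c.nSR i - 1).choose l *
        (c.lamSR i * (c.gam - 1)) ^ (c.nSR i - 1 - l) *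
        (∫ ω, c.invPowerS h i ω ^ (c.nSR i - 1 - l) *
          Real.exp (-(c.lamSR i * (c.gam - 1) * c.invPowerS h i ω)) ∂P) *
        (expLowerGammaIntegral (c.nSE i k) l (c.lamSE i k / (c.lamSR i * c.gam)) /
          Real.Gamma (c.nSE i k))) / Real.Gamma (c.nSR i) := by
  have hg : (0 : ℝ) < c.gam := one_pos.trans one_lt_gam
  have e : P.real {ω | c.Rs ≤ c.cap1 h i k ω} = P.real {ω | (c.gam - 1) * c.invPowerS h i ω +
      c.gam * (∑ u, c.gain h (.SE i k u) ω) ≤ ∑ u, c.gain h (.SR i u) ω} := by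
    refine measureReal_congr ?_
    filter_upwards [hf.ae_gain_pos (.SP i)] with ω hω
    exact propext (le_cap1_iff hω)
  have i1 : IndepFun (fun ω => (c.invPowerS h i ω, ∑ u, c.gain h (.SE i k u) ω))
      (fun ω => ∑ u, c.gain h (.SR i u) ω) P := by
    refine hf.indepFun {q | ∃ u, q = .SR i u} (Measurable.prodMk (measurable_const.max
      ((measurable_gain_sigmaLinks ?_).div_const _)) (measurable_sum_gain_sigmaLinks ?_))
      (measurable_sum_gain_sigmaLinks ?_) <;> simp
  have i2 : IndepFun (c.invPowerS h i) (fun ω => ∑ u, c.gain h (.SE i k u) ω) P := by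
    refine hf.indepFun {q | ∃ u, q = .SE i k u} (measurable_const.max
      ((measurable_gain_sigmaLinks ?_).div_const _)) (measurable_sum_gain_sigmaLinks ?_) <;> simp
  rw [e, measureReal_hop (hf.measurable_sum_gain _) (hf.measurable_invPowerS i)
    (hf.measurable_sum_gain _) (fun ω => (invPowerS_pos i ω).le) (sum_gain_nonneg _) i1 i2
    (nSR_pos i) (lamSR_pos i) one_lt_gam (hf.map_SR i)]
  simp only [integral_upperGammaNat_gamma (hf.measurable_sum_gain _) (sum_gain_nonneg _) _
    (mul_pos (lamSR_pos i) hg) (nSE_pos i k) (lamSE_pos i k) (hf.map_SE i k)]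

lemma measureReal_le_cap2 (hf : c.IsNakagamiFading P h) (k : Fin c.M) :
    P.real {ω | c.Rs ≤ c.cap2 h k ω} =
      (∑ l ∈ Finset.range c.nRD, (c.nRD - 1).choose l *
        (c.lamRD * (c.gam - 1)) ^ (c.nRD - 1 - l) *
        (∫ ω, c.invPowerR h ω ^ (c.nRD - 1 - l) *
          Real.exp (-(c.lamRD * (c.gam - 1) * c.invPowerR h ω)) ∂P) *
        (expLowerGammaIntegral (c.nRE k) l (c.lamRE k / (c.lamRD * c.gam)) /
          Real.Gamma (c.nRE k))) / Real.Gamma c.nRD := by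
  have hg : (0 : ℝ) < c.gam := one_pos.trans one_lt_gam
  have e : P.real {ω | c.Rs ≤ c.cap2 h k ω} = P.real {ω | (c.gam - 1) * c.invPowerR h ω +
      c.gam * (∑ u, c.gain h (.RE k u) ω) ≤ ∑ t, c.gain h (.RD t) ω} := by
    refine measureReal_congr ?_
    filter_upwards [hf.ae_gain_pos .RP] with ω hω
    exact propext (le_cap2_iff hω)
  have i1 : IndepFun (fun ω => (c.invPowerR h ω, ∑ u, c.gain h (.RE k u) ω))
      (fun ω => ∑ t, c.gain h (.RD t) ω) P := by
    refine hf.indepFun {q | ∃ t, q = .RD t} (Measurable.prodMk (measurable_const.max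
      ((measurable_gain_sigmaLinks ?_).div_const _)) (measurable_sum_gain_sigmaLinks ?_))
      (measurable_sum_gain_sigmaLinks ?_) <;> simp
  have i2 : IndepFun (c.invPowerR h) (fun ω => ∑ u, c.gain h (.RE k u) ω) P := by
    refine hf.indepFun {q | ∃ u, q = .RE k u} (measurable_const.max
      ((measurable_gain_sigmaLinks ?_).div_const _)) (measurable_sum_gain_sigmaLinks ?_) <;> simp
  rw [e, measureReal_hop (hf.measurable_sum_gain _) hf.measurable_invPowerR
    (hf.measurable_sum_gain _) (fun ω => (invPowerR_pos ω).le) (sum_gain_nonneg _) i1 i2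
    nRD_pos lamRD_pos one_lt_gam hf.map_RD]
  simp only [integral_upperGammaNat_gamma (hf.measurable_sum_gain _) (sum_gain_nonneg _) _
    (mul_pos lamRD_pos hg) (nRE_pos k) (lamRE_pos k) (hf.map_RE k)]

/-- Condition on the jammer's power: the jamming gain lies below w times the inverse power.
Averaging γ(n, ·) over that inverse power splits into a peak-power part and an interference-limited
part. -/
lemma measureReal_jamSnr_lt (hf : c.IsNakagamiFading P h) (J : Fin c.N) (k : Fin c.M) {w : ℝ}
    (hw : 0 < w) :
    P.real {ω | c.jamSnr h J k ω < w} =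
      (lowerGammaNat (c.mSP J) (c.phiS J) *
          lowerGammaNat (c.nSE J k) (c.lamSE J k / c.gamS J * w) +
        tailLowerGammaIntegral (c.nSE J k) (c.mSP J) (c.phiS J)
          (c.lamSE J k / (c.lamSP J * c.gamI) * w)) /
        (Real.Gamma (c.mSP J) * Real.Gamma (c.nSE J k)) := by
  have e : {ω | c.jamSnr h J k ω < w} =
      {ω | ∑ u, c.gain h (.SE J k u) ω < w * c.invPowerS h J ω} := by
    ext ω
    simp only [mem_ofPred_eq]
    rw [jamSnr, div_lt_iff₀ (invPowerS_pos J ω)]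
  have i1 : IndepFun (fun ω => w * c.invPowerS h J ω)
      (fun ω => ∑ u, c.gain h (.SE J k u) ω) P := by
    refine hf.indepFun {q | ∃ u, q = .SE J k u} (Measurable.const_mul (measurable_const.max
      ((measurable_gain_sigmaLinks ?_).div_const _)) w) (measurable_sum_gain_sigmaLinks ?_) <;> simp
  rw [e, measureReal_gamma_lt ((hf.measurable_invPowerS J).const_mul w)
    (hf.measurable_sum_gain _) i1 (fun ω => mul_nonneg hw.le (invPowerS_pos J ω).le)
    (nSE_pos J k) (lamSE_pos J k) (hf.map_SE J k)]
  simp only [← mul_assoc]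
  have := integral_lowerGammaNat_invPower (hf.measurable_gain (.SP J)) (c.mSP_pos J) (lamSP_pos J)
    (hf.map_gain (.SP J)) (gamS_pos J) (gamI_pos (c := c)) (mul_pos (lamSE_pos J k) hw) (nSE_pos J k)
  simp only [invPowerS]
  rw [this, div_div, phiS, div_mul_eq_mul_div, div_mul_eq_mul_div]

lemma measureReal_le_cap1Jam (hf : c.IsNakagamiFading P h) {i J : Fin c.N} (hJ : J ≠ i)
    (k : Fin c.M) :
    P.real {ω | c.Rs ≤ c.cap1Jam h i J k ω} =
      (lowerGammaNat (c.mSP i) (c.phiS i) *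
          upperGammaNat (c.nSR i) (c.lamSR i * (c.gam - 1) / c.gamS i) +
        tailUpperGammaIntegral (c.nSR i) (c.mSP i) (c.phiS i)
          (c.lamSR i * (c.gam - 1) / (c.lamSP i * c.gamI))) /
          (Real.Gamma (c.mSP i) * Real.Gamma (c.nSR i)) -
      (∑ l ∈ Finset.range (c.nSR i), (c.nSR i - 1).choose l *
        (c.lamSR i * (c.gam - 1)) ^ (c.nSR i - 1 - l) *
        (∫ ω, c.invPowerS h i ω ^ (c.nSR i - 1 - l) *
          Real.exp (-(c.lamSR i * (c.gam - 1) * c.invPowerS h i ω)) ∂P) *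
        ((c.lamSE i k / (c.lamSR i * c.gam)) ^ c.nSE i k *
          (∑ h' ∈ Finset.range (c.nSE i k), (c.nSE i k - 1).choose h' *
            ((1 + c.lamSE i k / (c.lamSR i * c.gam)) / (c.lamSE i k / (c.lamSR i * c.gam))) ^
              (h' + 1) * ((1 + c.lamSE i k / (c.lamSR i * c.gam)) ^ (l + c.nSE i k + 1))⁻¹ *
            betaTransform h' (l + c.nSE i k + 1) (fun w => P.real {ω | c.jamSnr h J k ω < w})
              ((1 + c.lamSE i k / (c.lamSR i * c.gam)) / (c.lamSE i k / (c.lamSR i * c.gam)))) /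
          Real.Gamma (c.nSE i k))) / Real.Gamma (c.nSR i) := by
  have hg : (0 : ℝ) < c.gam := one_pos.trans one_lt_gam
  have hξ : 0 < c.lamSR i * (c.gam - 1) := mul_pos (lamSR_pos i) (sub_pos.2 one_lt_gam)
  have e : P.real {ω | c.Rs ≤ c.cap1Jam h i J k ω} = P.real {ω | (c.gam - 1) * c.invPowerS h i ω +
      c.gam * ((∑ u, c.gain h (.SE i k u) ω) / (1 + c.jamSnr h J k ω)) ≤
        ∑ u, c.gain h (.SR i u) ω} := by
    refine measureReal_congr ?_
    filter_upwards [hf.ae_gain_pos (.SP i), hf.ae_gain_pos (.SP J)] with ω hω hω'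
    exact propext (le_cap1Jam_iff hω hω')
  have hfr : Measurable fun p : ℝ × ℝ × ℝ × ℝ =>
      (max (1 / c.gamS i) (p.1 / c.gamI), p.2.1 / (1 + p.2.2.1 / max (1 / c.gamS J)
        (p.2.2.2 / c.gamI))) := by fun_prop
  have hfu : Measurable fun p : ℝ × ℝ × ℝ => p.1 / (1 + p.2.1 / max (1 / c.gamS J)
        (p.2.2 / c.gamI)) := by fun_prop
  have hfb : Measurable fun z : ℝ => max (1 / c.gamS i) (z / c.gamI) := by fun_prop
  have i1 : IndepFun (fun ω => (c.invPowerS h i ω,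
      (∑ u, c.gain h (.SE i k u) ω) / (1 + c.jamSnr h J k ω)))
      (fun ω => ∑ u, c.gain h (.SR i u) ω) P := by
    refine hf.indepFun {q | ∃ u, q = .SR i u} (hfr.comp (Measurable.prodMk
      (measurable_gain_sigmaLinks (q := .SP i) ?_) (Measurable.prodMk
      (measurable_sum_gain_sigmaLinks (q := fun u => .SE i k u) ?_) (Measurable.prodMk
      (measurable_sum_gain_sigmaLinks (q := fun u => .SE J k u) ?_)
      (measurable_gain_sigmaLinks (q := .SP J) ?_)))))
      (measurable_sum_gain_sigmaLinks ?_) <;> simp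
  -- Here and in `i3` the condition J ≠ i is needed: the jammer's links to P and to the eavesdropper
  -- must differ from those of the source.
  have i2 : IndepFun (fun ω => (∑ u, c.gain h (.SE i k u) ω) / (1 + c.jamSnr h J k ω))
      (c.invPowerS h i) P := by
    refine hf.indepFun {.SP i} (hfu.comp (Measurable.prodMk
      (measurable_sum_gain_sigmaLinks (q := fun u => .SE i k u) ?_) (Measurable.prodMk
      (measurable_sum_gain_sigmaLinks (q := fun u => .SE J k u) ?_)
      (measurable_gain_sigmaLinks (q := .SP J) ?_))))
      (hfb.comp (measurable_gain_sigmaLinks ?_)) <;> simp [hJ]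
  have i3 : IndepFun (c.jamSnr h J k) (fun ω => ∑ u, c.gain h (.SE i k u) ω) P := by
    refine hf.indepFun {q | ∃ u, q = .SE i k u} (Measurable.div
      (measurable_sum_gain_sigmaLinks (q := fun u => .SE J k u) ?_)
      (measurable_const.max ((measurable_gain_sigmaLinks (q := .SP J) ?_).div_const _)))
      (measurable_sum_gain_sigmaLinks ?_) <;> simp [hJ]
  have i4 : IndepFun (c.invPowerS h i) (fun ω => ∑ u, c.gain h (.SR i u) ω) P :=
    i1.comp measurable_fst measurable_id
  have hum : Measurable fun ω => (∑ u, c.gain h (.SE i k u) ω) / (1 + c.jamSnr h J k ω) :=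
    (hf.measurable_sum_gain _).div ((hf.measurable_jamSnr J k).const_add 1)
  have hup := integral_upperGammaNat_jam (hf.measurable_sum_gain _) (hf.measurable_jamSnr J k)
    (sum_gain_nonneg _) (jamSnr_nonneg J k) i3
  -- The hop formula at U = 0 has Γ(l+1) in place of E Γ(l+1, κU), which is exactly the leading part
  -- produced by `integral_upperGammaNat_jam`. Comparing with `hop1` resums those parts into a
  -- single expectation of Γ(n, ξB).
  have hop0 := measureReal_hop (P := P) (hf.measurable_sum_gain _) (hf.measurable_invPowerS i)
    (U := fun _ => 0) measurable_const (fun ω => (invPowerS_pos i ω).le) (fun _ => le_rfl)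
    (i4.comp (φ := fun b => (b, (0 : ℝ))) (by fun_prop) measurable_id)
    (indepFun_const_right _ (0 : ℝ)) (nSR_pos i) (lamSR_pos i) (one_lt_gam (c := c)) (hf.map_SR i)
  have hop1 := measureReal_le_gamma (P := P) (V := fun ω => (c.gam - 1) * c.invPowerS h i ω)
    ((hf.measurable_invPowerS i).const_mul _) (hf.measurable_sum_gain _)
    (i4.comp (measurable_const_mul (c.gam - 1)) measurable_id)
    (fun ω => mul_nonneg (sub_pos.2 one_lt_gam).le (invPowerS_pos i ω).le) (nSR_pos i)
    (lamSR_pos i) (hf.map_SR i)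
  have hm := integral_upperGammaNat_invPower (hf.measurable_gain (.SP i)) (c.mSP_pos i)
    (lamSP_pos i) (hf.map_gain (.SP i)) (gamS_pos i) (gamI_pos (c := c)) hξ (nSR_pos i)
  simp only [mul_zero, add_zero, upperGammaNat_zero (Nat.succ_pos _), integral_const,
    probReal_univ, one_smul] at hop0
  simp only [← mul_assoc] at hop1
  rw [hop1] at hop0
  rw [phiS, ← div_div, ← hm]
  have hinv (ω : Ω) : max (1 / c.gamS i) (c.gain h (.SP i) ω / c.gamI) = c.invPowerS h i ω := rfl
  simp only [hinv]
  rw [hop0, e, measureReal_hop (hf.measurable_sum_gain _) (hf.measurable_invPowerS i)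
    hum (fun ω => (invPowerS_pos i ω).le)
    (fun ω => div_nonneg (sum_gain_nonneg _ ω) (by linarith [jamSnr_nonneg (h := h) J k ω])) i1
    i2.symm (nSR_pos i) (lamSR_pos i) one_lt_gam (hf.map_SR i), ← sub_div,
    ← Finset.sum_sub_distrib]
  simp only [hup _ (mul_pos (lamSR_pos i) hg) (nSE_pos i k) (lamSE_pos i k) (hf.map_SE i k),
    mul_sub, Nat.cast_succ]

end RelayNet.IsNakagamiFading

/-! ### Algebra that matches coefficients with the closed forms -/

lemma incompleteGamma_bracket {n m l : ℕ} (hl : l < n) (hm : 0 < m) {r a b ξ : ℝ} (hr : 0 < r)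
    (ha : 0 < a) (hb : 0 < b) (hξ : 0 < ξ) {E : ℝ}
    (hE : E = (lowerGammaNat m (r * b / a) * ((1 / a) ^ (n - 1 - l) * Real.exp (-(ξ / a))) +
        r ^ m * upperGammaNat (m + (n - 1 - l)) (r * b / a + ξ / a) /
          (b ^ (n - 1 - l) * (r + ξ / b) ^ (m + (n - 1 - l)))) / Real.Gamma m) :
    lowerGamma m (r * b / a) * (Real.exp (-(b / a * ξ / b)) : ℂ) /
        ((b / a : ℝ) : ℂ) ^ (-(n : ℤ) + l + 1) +
      (r : ℂ) ^ m * upperGamma ((m : ℂ) + n - l - 1) (r * b / a + b / a * ξ / b) /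
        ((r + ξ / b : ℝ) : ℂ) ^ ((m : ℤ) + n - l - 1) =
      ((Real.Gamma m * b ^ (n - 1 - l) * E : ℝ) : ℂ) := by
  -- With k = n - 1 - l, the integer exponents become -k and m + k, and the complex order of the
  -- incomplete Gamma function becomes the positive integer m + k.
  obtain ⟨k, rfl⟩ : ∃ k, n = l + 1 + k := ⟨n - (l + 1), by omega⟩
  have hk : l + 1 + k - 1 - l = k := by omega
  have h1 : -((l + 1 + k : ℕ) : ℤ) + l + 1 = -(k : ℤ) := by push_cast; ring
  have h2 : (m : ℤ) + (l + 1 + k : ℕ) - l - 1 = (m + k : ℕ) := by push_cast; ring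
  have h3 : (m : ℂ) + (l + 1 + k : ℕ) - l - 1 = (m + k : ℕ) := by push_cast; ring
  have h4 : b / a * ξ / b = ξ / a := by field_simp
  have hG : Real.Gamma m ≠ 0 := (Real.Gamma_pos_of_pos (Nat.cast_pos.2 hm)).ne'
  have hE' : Real.Gamma m * b ^ k * E = lowerGammaNat m (r * b / a) * Real.exp (-(ξ / a)) *
      (b / a) ^ k + r ^ m * upperGammaNat (m + k) (r * b / a + ξ / a) / (r + ξ / b) ^ (m + k) := by
    rw [hk] at hE
    have : r + ξ / b ≠ 0 := by positivity
    rw [hE, div_pow, div_pow, one_pow]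
    generalize r + ξ / b = d at *
    field_simp
  rw [hk, hE', h1, h2, h3, h4, lowerGamma_natCast hm (by positivity),
    upperGamma_natCast (by omega) (by positivity), zpow_neg, zpow_natCast, zpow_natCast, div_inv_eq_mul]
  push_cast
  ring

/-- The power bookkeeping of the jammer sum: L, E, g, w, d stand for λ_SR, λ_SE, γ, ϖ, γ - 1, so
that q = E/(Lg), 1 + q = w/(Lg) and (1+q)/q = w/E. -/
lemma div_pow_mul_div_pow_eq {L E g w : ℝ} (hL : L ≠ 0) (hE : E ≠ 0) (hg : g ≠ 0) (hw : w ≠ 0)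
    (d : ℝ) (l j h e : ℕ) :
    (L * d) ^ j * (E / (L * g)) ^ (h + 1 + e) * (w / E) ^ (h + 1) *
        ((w / (L * g)) ^ (l + 1 + e + (h + 1)))⁻¹ =
      g * L ^ (l + 1 + j) * E ^ e * (g ^ l * d ^ j) / w ^ (l + 1 + e) := by
  have e1 : (L * d) ^ j = L ^ j * d ^ j := mul_pow _ _ _
  have e2 : (w / (L * g)) ^ (l + 1 + e + (h + 1)) =
      w ^ (l + 1 + e) * w ^ (h + 1) / ((L * g) ^ (h + 1 + e) * (L ^ (l + 1) * (g ^ l * g))) := by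
    rw [div_pow, pow_add w, show l + 1 + e + (h + 1) = (h + 1 + e) + (l + 1) by ring,
      pow_add (L * g), mul_pow L g (l + 1), pow_succ g]
  rw [e1, e2, div_pow, div_pow, pow_add E, pow_add L (l + 1)]
  have := pow_ne_zero (h + 1 + e) (mul_ne_zero hL hg)
  have := pow_ne_zero (h + 1) hw
  have := pow_ne_zero (l + 1 + e) hw
  have := pow_ne_zero (h + 1) hE
  generalize (L * g) ^ (h + 1 + e) = y1 at *
  generalize w ^ (h + 1) = y2 at *
  generalize w ^ (l + 1 + e) = y3 at *
  generalize E ^ (h + 1) = y4 at *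
  field_simp

/-! ### Closed forms of the outage probabilities -/

namespace RelayNet

variable {c : RelayNet}

lemma xiSR_pos (i : Fin c.N) : 0 < c.xiSR i := mul_pos (lamSR_pos i) (sub_pos.2 one_lt_gam)
lemma xiRD_pos : 0 < c.xiRD := mul_pos lamRD_pos (sub_pos.2 one_lt_gam)
lemma gam_pos : 0 < c.gam := one_pos.trans one_lt_gam
lemma varpi_pos (i : Fin c.N) (k : Fin c.M) : 0 < c.varpi i k :=
  add_pos (mul_pos gam_pos (lamSR_pos i)) (lamSE_pos i k)
lemma phiS_pos (i : Fin c.N) : 0 < c.phiS i :=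
  div_pos (mul_pos (lamSP_pos i) gamI_pos) (gamS_pos i)

lemma argM1_eq (i J : Fin c.N) (k : Fin c.M) :
    c.argM1 i J k = c.lamSE J k / c.gamS J * (c.varpi i k / c.lamSE i k) := by
  rw [argM1, theta, mul_div_assoc', div_mul_div_comm, mul_comm (c.varpi i k)]

lemma argM2_eq (i J : Fin c.N) (k : Fin c.M) :
    c.argM2 i J k = c.lamSE J k / (c.lamSP J * c.gamI) * (c.varpi i k / c.lamSE i k) := by
  rw [argM2, varsigma, div_mul_eq_mul_div, div_div, div_mul_div_comm, mul_right_comm]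

/-- Since h < n, the parameter μ = n - h + l is a positive integer, and the beta exponent μ + h + 1
= l + n + 1 does not depend on h. This is the exponent arising in `integral_upperGammaNat_jam`. -/
lemma paramsM1_spec (i J : Fin c.N) (k : Fin c.M) {h : ℕ} (hh : h < c.nSE i k) (l : ℕ) :
    (c.paramsM1 i J k h l).WellDefined (c.argM1 i J k) ∧ (c.paramsM1 i J k h l).G (c.argM1 i J k) =
      betaTransform h (l + c.nSE i k + 1) (lowerGammaNat (c.nSE J k)) (c.argM1 i J k) := by
  have hμ : c.mu i k h l = ((c.nSE i k - h + l : ℕ) : ℤ) := by rw [mu]; omega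
  have hN : l + c.nSE i k + 1 = (c.nSE i k - h + l) + h + 1 := by omega
  rw [hN]
  refine meijerG_beta (nSE_pos J k) (by omega) ?_ (by rw [paramsM1, hμ, Int.cast_natCast])
  rw [argM1_eq]
  exact mul_pos (div_pos (lamSE_pos J k) (gamS_pos J)) (div_pos (varpi_pos i k) (lamSE_pos i k))

lemma paramsM2_spec (i J : Fin c.N) (k : Fin c.M) {h : ℕ} (hh : h < c.nSE i k) (l : ℕ) :
    (c.paramsM2 i J k h l).WellDefined (c.argM2 i J k) ∧ (c.paramsM2 i J k h l).G (c.argM2 i J k) =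
      betaTransform h (l + c.nSE i k + 1)
        (tailLowerGammaIntegral (c.nSE J k) (c.mSP J) (c.phiS J)) (c.argM2 i J k) := by
  have hμ : c.mu i k h l = ((c.nSE i k - h + l : ℕ) : ℤ) := by rw [mu]; omega
  have hN : l + c.nSE i k + 1 = (c.nSE i k - h + l) + h + 1 := by omega
  rw [hN]
  refine meijerG_beta_tail_lower (nSE_pos J k) (c.mSP_pos J) (by omega) (phiS_pos J) ?_
    (by rw [paramsM2, hμ, Int.cast_natCast])
  rw [argM2_eq]
  exact mul_pos (div_pos (lamSE_pos J k) (mul_pos (lamSP_pos J) gamI_pos))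
    (div_pos (varpi_pos i k) (lamSE_pos i k))

lemma paramsM3_spec (i : Fin c.N) :
    (c.paramsM3 i).WellDefined (c.argM3 i) ∧ (c.paramsM3 i).G (c.argM3 i) =
      tailUpperGammaIntegral (c.nSR i) (c.mSP i) (c.phiS i) (c.argM3 i) :=
  meijerG_tail_upper (nSR_pos i) (c.mSP_pos i) (phiS_pos i)
    (div_pos (xiSR_pos i) (mul_pos (lamSP_pos i) gamI_pos)) rfl

lemma paramsG_argG1_spec (i : Fin c.N) (k : Fin c.M) (l : ℕ) :
    (paramsG (c.nSE i k) l).WellDefined (c.argG1 i k) ∧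
      (paramsG (c.nSE i k) l).G (c.argG1 i k) = expLowerGammaIntegral (c.nSE i k) l (c.argG1 i k) :=
  meijerG_ratio (nSE_pos i k) l (div_pos (lamSE_pos i k) (mul_pos (lamSR_pos i) gam_pos))

lemma paramsG_argG2_spec (k : Fin c.M) (l : ℕ) :
    (paramsG (c.nRE k) l).WellDefined (c.argG2 k) ∧
      (paramsG (c.nRE k) l).G (c.argG2 k) = expLowerGammaIntegral (c.nRE k) l (c.argG2 k) :=
  meijerG_ratio (nRE_pos k) l (div_pos (lamRE_pos k) (mul_pos lamRD_pos gam_pos))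

variable (c) in
theorem meijerWellDefined : c.MeijerWellDefined :=
  ⟨fun i J _ k _ hh l _ => ⟨(paramsM1_spec i J k hh l).1, (paramsM2_spec i J k hh l).1⟩,
    fun i => (paramsM3_spec i).1, fun i k l _ => (paramsG_argG1_spec i k l).1,
    fun k l _ => (paramsG_argG2_spec k l).1⟩

namespace IsNakagamiFading

variable {Ω : Type*} [MeasurableSpace Ω] {P : Measure Ω} {h : c.Link → Ω → ℝ}

lemma bracket1_eq (hf : c.IsNakagamiFading P h) (i : Fin c.N) {l : ℕ} (hl : l < c.nSR i) :
    c.bracket1 i l = ((Real.Gamma (c.mSP i) * c.gamI ^ (c.nSR i - 1 - l) *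
      ∫ ω, c.invPowerS h i ω ^ (c.nSR i - 1 - l) *
        Real.exp (-(c.xiSR i * c.invPowerS h i ω)) ∂P : ℝ) : ℂ) :=
  incompleteGamma_bracket hl (c.mSP_pos i) (lamSP_pos i) (gamS_pos i) gamI_pos (xiSR_pos i)
    (integral_pow_mul_exp_invPower (hf.measurable_gain (.SP i)) (c.mSP_pos i) (lamSP_pos i)
      (hf.map_gain (.SP i)) (gamS_pos i) (gamI_pos (c := c)) (xiSR_pos i) _)

lemma bracket2_eq (hf : c.IsNakagamiFading P h) {l : ℕ} (hl : l < c.nRD) :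
    c.bracket2 l = ((Real.Gamma c.mRP * c.gamI ^ (c.nRD - 1 - l) *
      ∫ ω, c.invPowerR h ω ^ (c.nRD - 1 - l) *
        Real.exp (-(c.xiRD * c.invPowerR h ω)) ∂P : ℝ) : ℂ) := by
  have := incompleteGamma_bracket hl c.mRP_pos lamRP_pos
    (gamR_pos (c := c)) (gamI_pos (c := c)) (xiRD_pos (c := c))
    (integral_pow_mul_exp_invPower (hf.measurable_gain .RP) c.mRP_pos lamRP_pos
      (hf.map_gain .RP) gamR_pos gamI_pos xiRD_pos (c.nRD - 1 - l))
  rw [bracket2, mul_comm (Real.exp _ : ℂ), add_comm (c.nRD : ℂ), add_comm (c.nRD : ℤ),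
    add_comm (c.xiRD / c.gamI)]
  exact this

/-- The links of the second hop. -/
def secondHop (c : RelayNet) : Set c.Link :=
  {q | (∃ t, q = .RD t) ∨ q = .RP ∨ ∃ k u, q = .RE k u}

/-- A minimum exceeds the rate when both capacities do; X uses no second-hop link, so the two events
are independent. -/
lemma measureReal_le_min_cap2 (hf : c.IsNakagamiFading P h) (k : Fin c.M) {X : Ω → ℝ}
    (hX : Measurable[sigmaLinks h (secondHop c)ᶜ] X) :
    P.real {ω | c.Rs ≤ min (X ω) (c.cap2 h k ω)} =
      P.real {ω | c.Rs ≤ X ω} * P.real {ω | c.Rs ≤ c.cap2 h k ω} := by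
  have hi : IndepFun X (c.cap2 h k) P := by
    refine hf.indepFun (secondHop c) hX (measurable_cap2 (measurable_gain_sigmaLinks ?_)
      (measurable_sum_gain_sigmaLinks ?_) (measurable_sum_gain_sigmaLinks ?_)) <;> simp [secondHop]
  have := hi.measure_inter_preimage_eq_mul _ _ (measurableSet_Ici (a := c.Rs))
    (measurableSet_Ici (a := c.Rs))
  simp only [measureReal_def, ← ENNReal.toReal_mul]
  refine congrArg ENNReal.toReal (Eq.trans (congrArg P ?_) this)
  ext ω
  simp

variable [IsProbabilityMeasure P]

lemma measureReal_lt_eq {X : Ω → ℝ} (hX : Measurable X) (r : ℝ) :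
    P.real {ω | X ω < r} = 1 - P.real {ω | r ≤ X ω} := by
  rw [← probReal_compl_eq_one_sub (measurableSet_le measurable_const hX)]
  congr 1
  ext ω
  simp

lemma sop1_eq (hf : c.IsNakagamiFading P h) (i : Fin c.N) (k : Fin c.M) :
    c.sop1 P h i k = 1 - P.real {ω | c.Rs ≤ c.cap1 h i k ω} :=
  measureReal_lt_eq (measurable_cap1 (hf.measurable_gain _) (hf.measurable_sum_gain _)
    (hf.measurable_sum_gain _)) _

lemma sop1Jam_eq (hf : c.IsNakagamiFading P h) (i J : Fin c.N) (k : Fin c.M) :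
    c.sop1Jam P h i J k = 1 - P.real {ω | c.Rs ≤ c.cap1Jam h i J k ω} :=
  measureReal_lt_eq (measurable_cap1Jam (hf.measurable_gain _) (hf.measurable_gain _)
    (hf.measurable_sum_gain _) (hf.measurable_sum_gain _) (hf.measurable_sum_gain _)) _

lemma sop2_eq (hf : c.IsNakagamiFading P h) (k : Fin c.M) :
    c.sop2 P h k = 1 - P.real {ω | c.Rs ≤ c.cap2 h k ω} :=
  measureReal_lt_eq (measurable_cap2 (hf.measurable_gain _) (hf.measurable_sum_gain _)
    (hf.measurable_sum_gain _)) _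

lemma sopNoJam_eq (hf : c.IsNakagamiFading P h) (i : Fin c.N) :
    c.sopNoJam P h i = 1 - ∏ k, (1 - c.sop1 P h i k) * (1 - c.sop2 P h k) := by
  rw [sopNoJam]
  congr 1
  refine Finset.prod_congr rfl fun k _ => ?_
  rw [hf.sop1_eq, hf.sop2_eq, sub_sub_cancel, sub_sub_cancel]
  refine hf.measureReal_le_min_cap2 k (measurable_cap1 (measurable_gain_sigmaLinks ?_)
    (measurable_sum_gain_sigmaLinks ?_) (measurable_sum_gain_sigmaLinks ?_)) <;> simp [secondHop]

lemma sopJam_eq (hf : c.IsNakagamiFading P h) (i J : Fin c.N) :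
    c.sopJam P h i J = 1 - ∏ k, (1 - c.sop1Jam P h i J k) * (1 - c.sop2 P h k) := by
  rw [sopJam]
  congr 1
  refine Finset.prod_congr rfl fun k _ => ?_
  rw [hf.sop1Jam_eq, hf.sop2_eq, sub_sub_cancel, sub_sub_cancel]
  refine hf.measureReal_le_min_cap2 k (measurable_cap1Jam (measurable_gain_sigmaLinks ?_)
    (measurable_gain_sigmaLinks ?_) (measurable_sum_gain_sigmaLinks ?_)
    (measurable_sum_gain_sigmaLinks ?_) (measurable_sum_gain_sigmaLinks ?_)) <;> simp [secondHop]

theorem sop2_eq_closed2 (hf : c.IsNakagamiFading P h) (k : Fin c.M) :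
    (c.sop2 P h k : ℂ) = c.closed2 k := by
  have hG : Real.Gamma c.mRP ≠ 0 := (Real.Gamma_pos_of_pos (Nat.cast_pos.2 c.mRP_pos)).ne'
  have hl0 : c.lamRD ≠ 0 := lamRD_pos.ne'
  have hI : c.gamI ≠ 0 := gamI_pos.ne'
  rw [hf.sop2_eq, hf.measureReal_le_cap2, closed2, Complex.ofReal_sub, Complex.ofReal_one,
    Finset.sum_div, Complex.ofReal_sum, Finset.mul_sum]
  congr 1
  refine Finset.sum_congr rfl fun l hl => ?_
  have hl := Finset.mem_range.1 hl
  rw [(paramsG_argG2_spec k l).2, hf.bracket2_eq hl, ← Complex.ofReal_mul, ← Complex.ofReal_mul,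
    ← Complex.ofReal_mul, argG2, bCoef, xiRD]
  congr 1
  obtain ⟨j, hj⟩ : ∃ j, c.nRD = l + 1 + j := ⟨c.nRD - (l + 1), by omega⟩
  have h1 : c.nRD - 1 - l = j := by omega
  have h2 : (c.nRD : ℤ) - 1 - l = j := by omega
  have h3 : -(c.nRD : ℤ) + l + 1 = -j := by omega
  have h4 : c.lamRD ^ c.nRD = c.lamRD ^ (l + 1) * c.lamRD ^ j := by rw [hj, pow_add]
  rw [h1, h2, h3, h4, zpow_neg, zpow_natCast, zpow_natCast, mul_pow]
  generalize (∫ ω, c.invPowerR h ω ^ j * Real.exp (-(c.lamRD * (c.gam - 1) * c.invPowerR h ω)) ∂P)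
    = E
  generalize Real.Gamma c.nRD = A
  generalize Real.Gamma c.mRP = B at *
  have := pow_ne_zero j hI
  have := pow_ne_zero (l + 1) hl0
  generalize c.gamI ^ j = x at *
  generalize c.lamRD ^ (l + 1) = y at *
  field_simp

theorem sop1_eq_closed1 (hf : c.IsNakagamiFading P h) (i : Fin c.N) (k : Fin c.M) :
    (c.sop1 P h i k : ℂ) = c.closed1 i k := by
  have hG : Real.Gamma (c.mSP i) ≠ 0 := (Real.Gamma_pos_of_pos (Nat.cast_pos.2 (c.mSP_pos i))).ne'
  have hl0 : c.lamSR i ≠ 0 := (lamSR_pos i).ne'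
  have hg : c.gam ≠ 0 := gam_pos.ne'
  have hI : c.gamI ≠ 0 := gamI_pos.ne'
  rw [hf.sop1_eq, hf.measureReal_le_cap1, closed1, Complex.ofReal_sub, Complex.ofReal_one,
    Finset.sum_div, Complex.ofReal_sum, Finset.mul_sum]
  congr 1
  refine Finset.sum_congr rfl fun l hl => ?_
  have hl := Finset.mem_range.1 hl
  rw [(paramsG_argG1_spec i k l).2, hf.bracket1_eq i hl, ← Complex.ofReal_mul, ← Complex.ofReal_mul,
    ← Complex.ofReal_mul, argG1, upsilon, xiSR]
  congr 1
  obtain ⟨j, hj⟩ : ∃ j, c.nSR i = l + 1 + j := ⟨c.nSR i - (l + 1), by omega⟩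
  have h1 : c.nSR i - 1 - l = j := by omega
  have h2 : (c.nSR i : ℤ) - 1 - l = j := by omega
  have h3 : -(c.nSR i : ℤ) + l + 1 = -j := by omega
  have h4 : c.lamSR i ^ c.nSR i = c.lamSR i ^ (l + 1) * c.lamSR i ^ j := by rw [hj, pow_add]
  rw [h1, h2, h3, h4, zpow_neg, zpow_natCast, zpow_natCast, mul_pow, mul_pow, pow_succ c.gam]
  generalize (∫ ω, c.invPowerS h i ω ^ j *
    Real.exp (-(c.lamSR i * (c.gam - 1) * c.invPowerS h i ω)) ∂P) = E
  generalize Real.Gamma (c.nSR i) = A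
  generalize Real.Gamma (c.mSP i) = B at *
  have := pow_ne_zero j hI
  have := pow_ne_zero (l + 1) hl0
  have := pow_ne_zero l hg
  generalize c.gamI ^ j = x at *
  generalize c.lamSR i ^ (l + 1) = y at *
  generalize c.gam ^ l = g at *
  field_simp

/-- Linearity of the beta transform applied to the two parts of the distribution function in
`measureReal_jamSnr_lt`. The arguments of both G-functions are their scale factors times the common
point ϖ/λ_SE. -/
lemma bracket_meijer_jam (hf : c.IsNakagamiFading P h) (i J : Fin c.N) (k : Fin c.M) {h' : ℕ}
    (hh : h' < c.nSE i k) (l : ℕ) :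
    lowerGamma (c.mSP J) (c.phiS J) * (c.paramsM1 i J k h' l).G (c.argM1 i J k) +
        (c.paramsM2 i J k h' l).G (c.argM2 i J k) =
      ((Real.Gamma (c.mSP J) * Real.Gamma (c.nSE J k) * betaTransform h' (l + c.nSE i k + 1)
        (fun w => P.real {ω | c.jamSnr h J k ω < w}) (c.varpi i k / c.lamSE i k) : ℝ) : ℂ) := by
  have hA : Real.Gamma (c.mSP J) ≠ 0 := (Real.Gamma_pos_of_pos (Nat.cast_pos.2 (c.mSP_pos J))).ne'
  have hB : Real.Gamma (c.nSE J k) ≠ 0 :=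
    (Real.Gamma_pos_of_pos (Nat.cast_pos.2 (nSE_pos J k))).ne'
  rw [(paramsM1_spec i J k hh l).2, (paramsM2_spec i J k hh l).2,
    lowerGamma_natCast (c.mSP_pos J) (phiS_pos J).le, argM1_eq, argM2_eq,
    betaTransform_sub (G := tailLowerGammaIntegral (c.nSE J k) (c.mSP J) (c.phiS J)) (by omega)
      (measurable_lowerGammaNat (c.nSE J k))
      (C := Real.Gamma (c.nSE J k)) (fun x hx => ?_) (H := fun w => P.real {ω | c.jamSnr h J k ω < w})
      (monotone_measureReal_lt _).measurable (D := 1) (fun x _ => abs_measureReal_le_one _)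
      (a := c.lamSE J k / c.gamS J) (s := Real.Gamma (c.mSP J) * Real.Gamma (c.nSE J k))
      (p := lowerGammaNat (c.mSP J) (c.phiS J)) (div_pos (lamSE_pos J k) (gamS_pos J))
      (fun x hx => ?_) (div_pos (varpi_pos i k) (lamSE_pos i k))]
  · push_cast
    ring
  · rw [abs_of_nonneg (lowerGammaNat_nonneg _ _)]
    exact lowerGammaNat_le (nSE_pos J k) hx.le
  · rw [hf.measureReal_jamSnr_lt J k hx]
    field_simp
    ring

theorem sop1Jam_eq_closed1Jam (hf : c.IsNakagamiFading P h) {i J : Fin c.N} (hJ : J ≠ i)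
    (k : Fin c.M) : (c.sop1Jam P h i J k : ℂ) = c.closed1Jam i J k := by
  have hG : Real.Gamma (c.mSP i) ≠ 0 := (Real.Gamma_pos_of_pos (Nat.cast_pos.2 (c.mSP_pos i))).ne'
  have hA : Real.Gamma (c.mSP J) ≠ 0 := (Real.Gamma_pos_of_pos (Nat.cast_pos.2 (c.mSP_pos J))).ne'
  have hB : Real.Gamma (c.nSE J k) ≠ 0 :=
    (Real.Gamma_pos_of_pos (Nat.cast_pos.2 (nSE_pos J k))).ne'
  have hl0 : c.lamSR i ≠ 0 := (lamSR_pos i).ne'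
  have hE0 : c.lamSE i k ≠ 0 := (lamSE_pos i k).ne'
  have hw : c.varpi i k ≠ 0 := (varpi_pos i k).ne'
  have hg : c.gam ≠ 0 := gam_pos.ne'
  have hI : c.gamI ≠ 0 := gamI_pos.ne'
  -- The abstract quantities 1 + q and (1+q)/q of the jammer computation are identified with
  -- expressions in ϖ.
  have hz : 1 + c.lamSE i k / (c.lamSR i * c.gam) = c.varpi i k / (c.lamSR i * c.gam) := by
    rw [varpi]; field_simp
  have hz' : c.varpi i k / (c.lamSR i * c.gam) / (c.lamSE i k / (c.lamSR i * c.gam)) =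
      c.varpi i k / c.lamSE i k := by field_simp
  have hs : c.sigma i * c.xiSR i / c.gamI = c.lamSR i * (c.gam - 1) / c.gamS i := by
    rw [sigma, xiSR]
    have := (gamS_pos i).ne'
    field_simp
  have hs0 : 0 < c.lamSR i * (c.gam - 1) / c.gamS i := div_pos (xiSR_pos i) (gamS_pos i)
  rw [hf.sop1Jam_eq, hf.measureReal_le_cap1Jam hJ, hz, hz', closed1Jam, hs,
    lowerGamma_natCast (c.mSP_pos i) (phiS_pos i).le, upperGamma_natCast (nSR_pos i) hs0,
    (paramsM3_spec i).2, ← sub_add, mul_comm (Real.Gamma (c.mSP i)), Complex.ofReal_add]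
  congr 1
  · rw [argM3, xiSR]
    push_cast
    rfl
  simp only [Finset.mul_sum]
  rw [Finset.sum_comm, Finset.sum_div, Complex.ofReal_sum]
  refine Finset.sum_congr rfl fun l hl => ?_
  have hl := Finset.mem_range.1 hl
  rw [Finset.sum_div, Finset.mul_sum, Finset.sum_div, Complex.ofReal_sum]
  refine Finset.sum_congr rfl fun h' hh => ?_
  have hh := Finset.mem_range.1 hh
  rw [hf.bracket1_eq i hl, hf.bracket_meijer_jam i J k hh l, ← Complex.ofReal_mul,
    ← Complex.ofReal_mul, ← Complex.ofReal_mul, ← Complex.ofReal_mul, upsilon, omegaCoef, alphaCoef,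
    betaCoef, xiSR]
  congr 1
  obtain ⟨j, hj⟩ : ∃ j, c.nSR i = l + 1 + j := ⟨c.nSR i - (l + 1), by omega⟩
  obtain ⟨e, he⟩ : ∃ e, c.nSE i k = h' + 1 + e := ⟨c.nSE i k - (h' + 1), by omega⟩
  have h1 : c.nSR i - 1 - l = j := by omega
  have h2 : (c.nSR i : ℤ) - 1 - l = j := by omega
  have h3 : -(c.nSR i : ℤ) + l + 1 = -j := by omega
  have h4 : c.lamSR i ^ c.nSR i = c.lamSR i ^ (l + 1 + j) := by rw [hj]
  have h5 : (c.nSE i k : ℤ) - h' - 1 = e := by omega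
  have h6 : (c.nSE i k : ℤ) + l - h' = (l + 1 + e : ℕ) := by omega
  have h7 (x : ℝ) : x ^ c.nSE i k = x ^ (h' + 1 + e) := by rw [he]
  have h8 (x : ℝ) : x ^ (l + c.nSE i k + 1) = x ^ ((l + 1 + e) + (h' + 1)) := by
    congr 1; omega
  rw [h1, h2, h3, h4, h5, h6, h7, h8, zpow_neg, zpow_natCast, zpow_natCast, zpow_natCast,
    zpow_natCast]
  generalize (∫ ω, c.invPowerS h i ω ^ j *
    Real.exp (-(c.lamSR i * (c.gam - 1) * c.invPowerS h i ω)) ∂P) = E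
  generalize betaTransform h' _ _ _ = T
  generalize Real.Gamma (c.nSR i) = A
  generalize Real.Gamma (c.nSE i k) = A'
  generalize c.varpi i k = w at *
  generalize c.gam - 1 = d
  have key := div_pow_mul_div_pow_eq hl0 hE0 hg hw d l j h' e
  generalize c.lamSR i ^ (l + 1 + j) = y1 at *
  generalize (w / (c.lamSR i * c.gam)) ^ (l + 1 + e + (h' + 1)) = y2 at *
  generalize (w / c.lamSE i k) ^ (h' + 1) = y3 at *
  generalize (c.lamSE i k / (c.lamSR i * c.gam)) ^ (h' + 1 + e) = y4 at *
  generalize (c.lamSR i * d) ^ j = y5 at *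
  have := pow_ne_zero (l + 1 + e) hw
  have := pow_ne_zero j hI
  generalize w ^ (l + 1 + e) = y6 at *
  generalize c.gamI ^ j = y7 at *
  generalize c.lamSE i k ^ e = y8 at *
  generalize c.gam ^ l = y9 at *
  generalize d ^ j = y10 at *
  generalize Real.Gamma (c.mSP i) = B at *
  generalize Real.Gamma (c.mSP J) = B1 at *
  generalize Real.Gamma (c.nSE J k) = B2 at *
  generalize ((c.nSR i - 1).choose l : ℝ) = b1
  generalize ((c.nSE i k - 1).choose h' : ℝ) = b2
  -- The Gamma values of the primary links, of the jamming gain, and the powers of γ̄_I occur on the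
  -- closed-form side together with their inverses; inserting these units lets `ring` finish.
  calc _ = b1 * E * b2 * T / (A' * A) * (y5 * y4 * y3 * y2⁻¹) := by ring
    _ = b1 * E * b2 * T / (A' * A) * (c.gam * y1 * y8 * (y9 * y10) / y6) *
        ((B * B⁻¹) * (B1 * B1⁻¹) * (B2 * B2⁻¹) * (y7 * y7⁻¹)) := by
      rw [key, mul_inv_cancel₀ hG, mul_inv_cancel₀ hA, mul_inv_cancel₀ hB, mul_inv_cancel₀ ‹y7 ≠ 0›]
      simp only [mul_one]
    _ = _ := by ring

end IsNakagamiFading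

end RelayNet

/-! ### Assembly of the overall and system outage probabilities -/

theorem theorem1 (c : RelayNet) {Ω : Type*} [MeasurableSpace Ω] (P : Measure Ω)
    [IsProbabilityMeasure P] (h : c.Link → Ω → ℝ) (hfading : c.IsNakagamiFading P h) :
    c.MeijerWellDefined ∧
    (∀ i J : Fin c.N, J ≠ i → ∀ k, (c.sop1Jam P h i J k : ℂ) = c.closed1Jam i J k) ∧
    (∀ i k, (c.sop1 P h i k : ℂ) = c.closed1 i k) ∧
    (∀ k, (c.sop2 P h k : ℂ) = c.closed2 k) ∧
    (∀ i J : Fin c.N, J ≠ i →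
      c.sopJam P h i J = 1 - ∏ k, (1 - c.sop1Jam P h i J k) * (1 - c.sop2 P h k) ∧
      (c.sopJam P h i J : ℂ) = 1 - ∏ k, (1 - c.closed1Jam i J k) * (1 - c.closed2 k)) ∧
    (∀ i,
      c.sopNoJam P h i = 1 - ∏ k, (1 - c.sop1 P h i k) * (1 - c.sop2 P h k) ∧
      (c.sopNoJam P h i : ℂ) = 1 - ∏ k, (1 - c.closed1 i k) * (1 - c.closed2 k)) ∧
    (c.sopSystemJam P h : ℂ) =
      1 / ((c.N : ℂ) * ((c.N : ℂ) - 1)) *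
        ∑ i, ∑ J ∈ Finset.univ.filter (fun J => J ≠ i),
          (1 - ∏ k, (1 - c.closed1Jam i J k) * (1 - c.closed2 k)) ∧
    (c.sopSystemNoJam P h : ℂ) =
      1 / (c.N : ℂ) * ∑ i, (1 - ∏ k, (1 - c.closed1 i k) * (1 - c.closed2 k)) := by
  have hJam : ∀ i J : Fin c.N, J ≠ i →
      (c.sopJam P h i J : ℂ) = 1 - ∏ k, (1 - c.closed1Jam i J k) * (1 - c.closed2 k) := by
    intro i J hJ
    simp only [hfading.sopJam_eq, ← hfading.sop1Jam_eq_closed1Jam hJ, ← hfading.sop2_eq_closed2]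
    push_cast
    rfl
  have hNo : ∀ i,
      (c.sopNoJam P h i : ℂ) = 1 - ∏ k, (1 - c.closed1 i k) * (1 - c.closed2 k) := by
    intro i
    simp only [hfading.sopNoJam_eq, ← hfading.sop1_eq_closed1, ← hfading.sop2_eq_closed2]
    push_cast
    rfl
  refine ⟨c.meijerWellDefined, fun i J hJ k => hfading.sop1Jam_eq_closed1Jam hJ k,
    hfading.sop1_eq_closed1, hfading.sop2_eq_closed2,
    fun i J hJ => ⟨hfading.sopJam_eq i J, hJam i J hJ⟩, fun i => ⟨hfading.sopNoJam_eq i, hNo i⟩,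
    ?_, ?_⟩
  · rw [RelayNet.sopSystemJam]
    push_cast
    congr 1
    exact Finset.sum_congr rfl fun i _ => Finset.sum_congr rfl fun J hJ =>
      hJam i J (Finset.mem_filter.1 hJ).2
  · rw [RelayNet.sopSystemNoJam]
    push_cast
    congr 1
    exact Finset.sum_congr rfl fun i _ => hNo i
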